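/- Let $k$ be a field, let $q\in k^\times$ be not a root of unity, and let $n\ge 1$. Let $M_q(n)$ be the unital associative $k$-algebra on the generators $x_{ij}$, $1\le i,j\le n$, with the relations \begin{align*} x_{j\ell}x_{i\ell}&=q\,x_{i\ell}x_{j\ell},\qquad x_{\ell j}x_{\ell i}=q\,x_{\ell i}x_{\ell j} && (i<j,\ \text{any } \ell),\\ x_{\ell i}x_{rj}&=x_{rj}x_{\ell i},\qquad x_{ri}x_{\ell j}-x_{\ell j}x_{ri}=(q^{-1}-q)\,x_{rj}x_{\ell i} && (r<\ell,\ i<j), \end{align*} and let $\mathcal D_q=\sum_{\sigma\in S_n}(-q^{-1})^{\ell(\sigma)}x_{1\sigma(1)}\cdots x_{n\sigma(n)}$ be its quantum determinant, where $\ell(\sigma)$ is the number of inversions of $\sigma$. Put $$GL_q(n)=M_q(n)[t]/\langle t\,\mathcal D_q-1\rangle\quad(t\text{ a central variable}),\qquad SL_q(n)=M_q(n)/\langle \mathcal D_q-1\rangle .$$ On each of these three algebras $A$ let $\varepsilon$ be the counit, that is, the character with $\varepsilon(x_{ij})=\delta_{ij}$, and let $f_{q,n}^{-1}$ be the character with $f_{q,n}^{-1}(x_{ij})=\delta_{ij}\,q^{\,n+1-2i}$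 (both take the value $1$ on $\mathcal D_q$, hence on $t$ in the case of $GL_q(n)$). Let ${}_{f_{q,n}^{-1}}k$ be the $A$-bimodule $k$ on which $A$ acts on the left by $f_{q,n}^{-1}$ and on the right by $\varepsilon$. Let $H_\ell(A,M)$ denote the Hochschild homology of the $k$-algebra $A$ with coefficients in the $A$-bimodule $M$, that is, the homology of the complex $M\otimes A^{\otimes \ast}$ with the Hochschild boundary; $H_{-1}=0$. Then for every $\ell\ge 0$ the map $$H_\ell\big(M_q(n),{}_{f_{q,n}^{-1}}k\big)\longrightarrow H_\ell\big(GL_q(n),{}_{f_{q,n}^{-1}}k\big)$$ induced by the canonical homomorphism $M_q(n)\to GL_q(n)$ and the identity of $k$ is an isomorphism, and there is an isomorphism of $k$-vector spaces $$H_\ell\big(GL_q(n),{}_{f_{q,n}^{-1}}k\big)\;\cong\; H_\ell\big(SL_q(n),{}_{f_{q,n}^{-1}}k\big)\oplus H_{\ell-1}\big(SL_q(n),{}_{f_{q,n}^{-1}}k\big).$$ -/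

import Mathlib

open CategoryTheory TensorProduct

universe u

noncomputable section

/-! # Hochschild homology of an algebra with coefficients in a bimodule -/

namespace Hochschild

section Complex

set_option linter.unusedSectionVars false

variable (k A M : Type u) [CommRing k] [Ring A] [Algebra k A] [AddCommGroup M] [Module k M]
  [Module A M] [Module Aᵐᵒᵖ M] [IsScalarTower k A M] [IsScalarTower k Aᵐᵒᵖ M]
  [SMulCommClass A Aᵐᵒᵖ M]

/-- The Hochschild chains `M ⊗ A ⊗ ⋯ ⊗ A` (with `n` factors `A`, bracketed to the left). -/
def chains : ℕ → ModuleCat.{u} k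
  | 0 => ModuleCat.of k M
  | n + 1 => ModuleCat.of k (chains n ⊗[k] A)

/-- The map `(c, a) ↦ c ⊗ a`. -/
def snoc (n : ℕ) : chains k A M n →ₗ[k] A →ₗ[k] chains k A M (n + 1) :=
  TensorProduct.mk k (chains k A M n) A

variable {k A M} in
/-- The linear map on `chains (n + 1)` given by a bilinear map, `c ⊗ a ↦ f c a`. -/
def unsnoc {N : Type u} [AddCommGroup N] [Module k N] {n : ℕ}
    (f : chains k A M n →ₗ[k] A →ₗ[k] N) : chains k A M (n + 1) →ₗ[k] N :=
  (TensorProduct.lift f : chains k A M n ⊗[k] A →ₗ[k] N)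

/-- The left action on chains, through the factor `M`:
`a ▷ (m ⊗ a₁ ⊗ ⋯ ⊗ aₙ) = a m ⊗ a₁ ⊗ ⋯ ⊗ aₙ`. -/
def leftAct : (n : ℕ) → A →ₗ[k] (chains k A M n →ₗ[k] chains k A M n)
  | 0 => (Algebra.lsmul k k M : A →ₐ[k] Module.End k M).toLinearMap
  | n + 1 => (LinearMap.rTensorHom A : (chains k A M n →ₗ[k] chains k A M n) →ₗ[k]
      (chains k A M n ⊗[k] A →ₗ[k] chains k A M n ⊗[k] A)) ∘ₗ leftAct n

/-- The right action on chains, through the last factor: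
`m ◁ a = m a` and `(m ⊗ a₁ ⊗ ⋯ ⊗ aₙ) ◁ a = m ⊗ a₁ ⊗ ⋯ ⊗ aₙ a`. -/
def rightAct : (n : ℕ) → A →ₗ[k] (chains k A M n →ₗ[k] chains k A M n)
  | 0 => (Algebra.lsmul k k M : Aᵐᵒᵖ →ₐ[k] Module.End k M).toLinearMap ∘ₗ
      (MulOpposite.opLinearEquiv k : A ≃ₗ[k] Aᵐᵒᵖ).toLinearMap
  | n + 1 => (LinearMap.lTensorHom (chains k A M n) : (A →ₗ[k] A) →ₗ[k]
      (chains k A M n ⊗[k] A →ₗ[k] chains k A M n ⊗[k] A)) ∘ₗ (LinearMap.mul k A).flip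

/-- The part of the Hochschild boundary made of the faces that multiply neighbours, in
degree `n + 1`: `m ⊗ a₁ ⊗ ⋯ ⊗ aₙ₊₁` is sent to
`m a₁ ⊗ a₂ ⊗ ⋯ ⊗ aₙ₊₁ + ∑ i ∈ {1, …, n}, (-1) ^ i (m ⊗ a₁ ⊗ ⋯ ⊗ aᵢ aᵢ₊₁ ⊗ ⋯ ⊗ aₙ₊₁)`.
It is given by recursion: `c ⊗ a` is sent to the value at `c`, tensored with `a`, plus
`(-1) ^ n (c ◁ a)`, where `n` is the degree of `c`. -/
def innerFaces : (n : ℕ) → (chains k A M (n + 1) →ₗ[k] chains k A M n)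
  | 0 => unsnoc (rightAct k A M 0).flip
  | n + 1 => unsnoc
      (snoc k A M n ∘ₗ innerFaces n + (-1 : k) ^ (n + 1) • (rightAct k A M (n + 1)).flip)

/-- The Hochschild boundary in degree `n + 1`: the sum of `innerFaces` and of the last,
cyclic face `(-1) ^ (n + 1) (aₙ₊₁ m ⊗ a₁ ⊗ ⋯ ⊗ aₙ)`. -/
def boundary (n : ℕ) : chains k A M (n + 1) →ₗ[k] chains k A M n :=
  innerFaces k A M n + (-1 : k) ^ (n + 1) • unsnoc (leftAct k A M n).flip

variable {k A M}

lemma chains_ext {N : Type u} [AddCommGroup N] [Module k N] {n : ℕ}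
    {f g : chains k A M (n + 1) →ₗ[k] N}
    (h : ∀ c a, f (snoc k A M n c a) = g (snoc k A M n c a)) : f = g :=
  TensorProduct.ext' (M := chains k A M n) (N := A) h

lemma unsnoc_snoc {N : Type u} [AddCommGroup N] [Module k N] {n : ℕ}
    (f : chains k A M n →ₗ[k] A →ₗ[k] N) (c : chains k A M n) (a : A) :
    unsnoc f (snoc k A M n c a) = f c a := rfl

lemma leftAct_snoc (n : ℕ) (a b : A) (c : chains k A M n) :
    leftAct k A M (n + 1) a (snoc k A M n c b) = snoc k A M n (leftAct k A M n a c) b := rfl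

lemma rightAct_snoc (n : ℕ) (a b : A) (c : chains k A M n) :
    rightAct k A M (n + 1) a (snoc k A M n c b) = snoc k A M n c (b * a) := rfl

lemma innerFaces_zero (a : A) (m : chains k A M 0) :
    innerFaces k A M 0 (snoc k A M 0 m a) = rightAct k A M 0 a m := rfl

lemma innerFaces_succ (n : ℕ) (a : A) (c : chains k A M (n + 1)) :
    innerFaces k A M (n + 1) (snoc k A M (n + 1) c a) =
      snoc k A M n (innerFaces k A M n c) a +
      (-1 : k) ^ (n + 1) • rightAct k A M (n + 1) a c := rfl

lemma boundary_snoc (n : ℕ) (a : A) (c : chains k A M n) :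
    boundary k A M n (snoc k A M n c a) =
      innerFaces k A M n (snoc k A M n c a) + (-1 : k) ^ (n + 1) • leftAct k A M n a c := rfl

lemma leftAct_mul (n : ℕ) (a b : A) :
    leftAct k A M n (a * b) = leftAct k A M n a ∘ₗ leftAct k A M n b := by
  induction n with
  | zero => exact LinearMap.ext fun m : M => mul_smul a b m
  | succ n ih =>
    refine chains_ext fun c d => ?_
    simp only [LinearMap.comp_apply, leftAct_snoc, ih]

lemma rightAct_mul (n : ℕ) (a b : A) :
    rightAct k A M n (a * b) = rightAct k A M n b ∘ₗ rightAct k A M n a := by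
  cases n with
  | zero => exact LinearMap.ext fun m : M => mul_smul (MulOpposite.op b) (MulOpposite.op a) m
  | succ n =>
    refine chains_ext fun c d => ?_
    simp only [LinearMap.comp_apply, rightAct_snoc, mul_assoc]

lemma leftAct_rightAct (n : ℕ) (a b : A) (c : chains k A M n) :
    leftAct k A M n a (rightAct k A M n b c) = rightAct k A M n b (leftAct k A M n a c) := by
  cases n with
  | zero => exact smul_comm a (MulOpposite.op b) (show M from c)
  | succ n =>
    refine LinearMap.congr_fun (f := leftAct k A M (n + 1) a ∘ₗ rightAct k A M (n + 1) b)
      (g := rightAct k A M (n + 1) b ∘ₗ leftAct k A M (n + 1) a) (chains_ext fun c d => ?_) c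
    simp only [LinearMap.comp_apply, rightAct_snoc, leftAct_snoc]

lemma innerFaces_leftAct (n : ℕ) (a : A) :
    innerFaces k A M n ∘ₗ leftAct k A M (n + 1) a =
      leftAct k A M n a ∘ₗ innerFaces k A M n := by
  induction n with
  | zero =>
    refine chains_ext fun c d => ?_
    simp only [LinearMap.comp_apply, leftAct_snoc, innerFaces_zero, leftAct_rightAct]
  | succ n ih =>
    refine chains_ext fun c d => ?_
    have := LinearMap.congr_fun ih c
    simp only [LinearMap.comp_apply] at this
    simp only [LinearMap.comp_apply, leftAct_snoc, innerFaces_succ, map_add, map_smul, this,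
      leftAct_rightAct]

lemma innerFaces_rightAct (n : ℕ) (a : A) :
    innerFaces k A M n ∘ₗ rightAct k A M (n + 1) a =
      rightAct k A M n a ∘ₗ innerFaces k A M n := by
  refine chains_ext fun c d => ?_
  cases n with
  | zero => simp only [LinearMap.comp_apply, rightAct_snoc, innerFaces_zero, rightAct_mul]
  | succ n =>
    simp only [LinearMap.comp_apply, rightAct_snoc, innerFaces_succ, map_add, map_smul,
      rightAct_mul]

lemma innerFaces_comp (n : ℕ) :
    innerFaces k A M n ∘ₗ innerFaces k A M (n + 1) = 0 := by
  induction n with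
  | zero =>
    refine chains_ext fun c d => ?_
    have h := LinearMap.congr_fun (innerFaces_rightAct 0 d) c
    simp only [LinearMap.comp_apply] at h
    simp only [LinearMap.comp_apply, innerFaces_succ, map_add, map_smul, h, innerFaces_zero,
      LinearMap.zero_apply]
    module
  | succ n ih =>
    refine chains_ext fun c d => ?_
    have h := LinearMap.congr_fun (innerFaces_rightAct (n + 1) d) c
    have h' := LinearMap.congr_fun ih c
    simp only [LinearMap.comp_apply, LinearMap.zero_apply] at h h'
    simp only [LinearMap.comp_apply, innerFaces_succ, map_add, map_smul, h, h',
      LinearMap.zero_apply, map_zero]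
    module

lemma boundary_comp (n : ℕ) : boundary k A M n ∘ₗ boundary k A M (n + 1) = 0 := by
  refine chains_ext fun c a => ?_
  have key : ∀ a : A, unsnoc (leftAct k A M n).flip ∘ₗ leftAct k A M (n + 1) a =
      unsnoc (leftAct k A M n).flip ∘ₗ rightAct k A M (n + 1) a := by
    intro a
    refine chains_ext fun s b => ?_
    simp only [LinearMap.comp_apply, leftAct_snoc, rightAct_snoc, unsnoc_snoc,
      LinearMap.flip_apply, leftAct_mul]
  have h1 := LinearMap.congr_fun (key a) c
  have h2 := LinearMap.congr_fun (innerFaces_comp (k := k) (A := A) (M := M) n)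
    (snoc k A M (n + 1) c a)
  have h3 := LinearMap.congr_fun (innerFaces_leftAct (k := k) (M := M) n a) c
  simp only [LinearMap.comp_apply, LinearMap.zero_apply] at h1 h2 h3
  have hb : ∀ y : chains k A M (n + 1), boundary k A M n y =
      innerFaces k A M n y + (-1 : k) ^ (n + 1) • unsnoc (leftAct k A M n).flip y := fun _ => rfl
  rw [LinearMap.comp_apply, boundary_snoc, hb, map_add, map_smul, h2, h3, map_add, map_smul, h1,
    innerFaces_succ, map_add, map_smul, unsnoc_snoc, LinearMap.flip_apply, LinearMap.zero_apply]
  module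

variable (k A M) in
/-- The Hochschild boundary as a morphism of `k`-modules. -/
def boundaryHom (n : ℕ) : chains k A M (n + 1) ⟶ chains k A M n :=
  ModuleCat.ofHom (X := chains k A M (n + 1)) (Y := chains k A M n) (boundary k A M n)

lemma boundaryHom_comp (n : ℕ) : boundaryHom k A M (n + 1) ≫ boundaryHom k A M n = 0 :=
  ModuleCat.hom_ext (boundary_comp n)

variable (k A M) in
/-- The Hochschild complex `CH_*(A, M)`. -/
def complex : ChainComplex (ModuleCat.{u} k) ℕ :=
  ChainComplex.of (chains k A M) (boundaryHom k A M) boundaryHom_comp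

lemma complex_d (n : ℕ) : (complex k A M).d (n + 1) n = boundaryHom k A M n :=
  ChainComplex.of_d (chains k A M) (boundaryHom k A M) n

variable (k A M) in
/-- The Hochschild homology `H_ℓ(A, M)`. -/
def homology (l : ℕ) : ModuleCat.{u} k := (complex k A M).homology l

section Functoriality

variable {B N : Type u} [Ring B] [Algebra k B] [AddCommGroup N] [Module k N]
  [Module B N] [Module Bᵐᵒᵖ N] [IsScalarTower k B N] [IsScalarTower k Bᵐᵒᵖ N]
  [SMulCommClass B Bᵐᵒᵖ N]

/-- The map `m ⊗ a₁ ⊗ ⋯ ⊗ aₙ ↦ g m ⊗ φ a₁ ⊗ ⋯ ⊗ φ aₙ` on chains. -/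
def chainsMap (φ : A →ₐ[k] B) (g : M →ₗ[k] N) : (n : ℕ) → (chains k A M n →ₗ[k] chains k B N n)
  | 0 => g
  | n + 1 => unsnoc ((snoc k B N n).compl₁₂ (chainsMap φ g n) φ.toLinearMap)

lemma chainsMap_snoc (φ : A →ₐ[k] B) (g : M →ₗ[k] N) (n : ℕ) (c : chains k A M n) (a : A) :
    chainsMap φ g (n + 1) (snoc k A M n c a) = snoc k B N n (chainsMap φ g n c) (φ a) := rfl

lemma chainsMap_leftAct (φ : A →ₐ[k] B) (g : M →ₗ[k] N)
    (hl : ∀ a m, g (a • m) = φ a • g m) (n : ℕ) (a : A) :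
    chainsMap φ g n ∘ₗ leftAct k A M n a = leftAct k B N n (φ a) ∘ₗ chainsMap φ g n := by
  induction n with
  | zero => exact LinearMap.ext fun m : M => hl a m
  | succ n ih =>
    refine chains_ext fun c d => ?_
    have := LinearMap.congr_fun ih c
    simp only [LinearMap.comp_apply] at this
    simp only [LinearMap.comp_apply, leftAct_snoc, chainsMap_snoc, this]

lemma chainsMap_rightAct (φ : A →ₐ[k] B) (g : M →ₗ[k] N)
    (hr : ∀ a m, g (MulOpposite.op a • m) = MulOpposite.op (φ a) • g m) (n : ℕ) (a : A) :
    chainsMap φ g n ∘ₗ rightAct k A M n a = rightAct k B N n (φ a) ∘ₗ chainsMap φ g n := by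
  cases n with
  | zero => exact LinearMap.ext fun m : M => hr a m
  | succ n =>
    refine chains_ext fun c d => ?_
    simp only [LinearMap.comp_apply, rightAct_snoc, chainsMap_snoc, map_mul]

lemma chainsMap_innerFaces (φ : A →ₐ[k] B) (g : M →ₗ[k] N)
    (hr : ∀ a m, g (MulOpposite.op a • m) = MulOpposite.op (φ a) • g m) (n : ℕ) :
    chainsMap φ g n ∘ₗ innerFaces k A M n = innerFaces k B N n ∘ₗ chainsMap φ g (n + 1) := by
  induction n with
  | zero =>
    refine chains_ext fun c d => ?_
    have h := LinearMap.congr_fun (chainsMap_rightAct φ g hr 0 d) c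
    simp only [LinearMap.comp_apply] at h
    simp only [LinearMap.comp_apply, innerFaces_zero, chainsMap_snoc, h]
  | succ n ih =>
    refine chains_ext fun c d => ?_
    have h := LinearMap.congr_fun (chainsMap_rightAct φ g hr (n + 1) d) c
    have h' := LinearMap.congr_fun ih c
    simp only [LinearMap.comp_apply] at h h'
    simp only [LinearMap.comp_apply, innerFaces_succ, chainsMap_snoc (n := n + 1), map_add,
      map_smul, h, chainsMap_snoc φ g n, h']

lemma chainsMap_boundary (φ : A →ₐ[k] B) (g : M →ₗ[k] N)
    (hl : ∀ a m, g (a • m) = φ a • g m)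
    (hr : ∀ a m, g (MulOpposite.op a • m) = MulOpposite.op (φ a) • g m) (n : ℕ) :
    chainsMap φ g n ∘ₗ boundary k A M n = boundary k B N n ∘ₗ chainsMap φ g (n + 1) := by
  refine chains_ext fun c d => ?_
  have h := LinearMap.congr_fun (chainsMap_leftAct φ g hl n d) c
  have h' := LinearMap.congr_fun (chainsMap_innerFaces φ g hr n) (snoc k A M n c d)
  simp only [LinearMap.comp_apply] at h h'
  simp only [LinearMap.comp_apply, boundary_snoc, map_add, map_smul, h, h', chainsMap_snoc]

/-- The chain map `CH_*(A, M) ⟶ CH_*(B, N)` induced by an algebra homomorphism `φ : A → B` and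
a map `g : M → N` of bimodules over `φ`. -/
def complexMap (φ : A →ₐ[k] B) (g : M →ₗ[k] N) (hl : ∀ a m, g (a • m) = φ a • g m)
    (hr : ∀ a m, g (MulOpposite.op a • m) = MulOpposite.op (φ a) • g m) :
    complex k A M ⟶ complex k B N :=
  ChainComplex.ofHom
    (fun n => ModuleCat.ofHom (X := chains k A M n) (Y := chains k B N n) (chainsMap φ g n))
    fun n => by
      rw [complex_d, complex_d]
      exact ModuleCat.hom_ext (chainsMap_boundary φ g hl hr n).symm

/-- The map `H_ℓ(A, M) → H_ℓ(B, N)` induced by an algebra homomorphism `φ : A → B` and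
a map `g : M → N` of bimodules over `φ`. -/
def homologyMap (φ : A →ₐ[k] B) (g : M →ₗ[k] N) (hl : ∀ a m, g (a • m) = φ a • g m)
    (hr : ∀ a m, g (MulOpposite.op a • m) = MulOpposite.op (φ a) • g m) (l : ℕ) :
    homology k A M l →ₗ[k] homology k B N l :=
  (HomologicalComplex.homologyMap (complexMap φ g hl hr) l).hom

end Functoriality

end Complex

/-! ### One-dimensional bimodules -/

section CharBimodule

variable {k A : Type u} [Field k] [Ring A] [Algebra k A]

/-- The bimodule `k` over `A` on which `A` acts on the left through the character `α` and on the
right through the character `β`. -/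
@[nolint unusedArguments]
def CharBimodule (_α _β : A →ₐ[k] k) : Type u := k

variable (α β : A →ₐ[k] k)

instance : AddCommGroup (CharBimodule α β) := inferInstanceAs (AddCommGroup k)

instance : Module k (CharBimodule α β) := inferInstanceAs (Module k k)

instance : Module A (CharBimodule α β) :=
  letI : Module k k := inferInstance
  (Module.compHom k (α : A →+* k) : Module A k)

instance : Module Aᵐᵒᵖ (CharBimodule α β) :=
  (Module.compHom k ((β : A →+* k).fromOpposite fun _ _ => Commute.all _ _) : Module Aᵐᵒᵖ k)

/-- The linear identification of the bimodule with `k`. -/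
def CharBimodule.equiv : CharBimodule α β ≃ₗ[k] k := LinearEquiv.refl k k

lemma CharBimodule.equiv_smul (a : A) (m : CharBimodule α β) :
    equiv α β (a • m) = α a * equiv α β m := rfl

lemma CharBimodule.equiv_op_smul (a : A) (m : CharBimodule α β) :
    equiv α β (MulOpposite.op a • m) = β a * equiv α β m := rfl

instance : IsScalarTower k A (CharBimodule α β) :=
  ⟨fun c a m => (CharBimodule.equiv α β).injective <| by
    rw [CharBimodule.equiv_smul, map_smul, map_smul, CharBimodule.equiv_smul, smul_mul_assoc]⟩

instance : IsScalarTower k Aᵐᵒᵖ (CharBimodule α β) :=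
  ⟨fun c a m => (CharBimodule.equiv α β).injective <| by
    obtain ⟨a, rfl⟩ := MulOpposite.op_surjective a
    rw [← MulOpposite.op_smul, CharBimodule.equiv_op_smul, map_smul, map_smul,
      CharBimodule.equiv_op_smul, smul_mul_assoc]⟩

instance : SMulCommClass A Aᵐᵒᵖ (CharBimodule α β) :=
  ⟨fun a b m => (CharBimodule.equiv α β).injective <| by
    obtain ⟨b, rfl⟩ := MulOpposite.op_surjective b
    simp only [CharBimodule.equiv_op_smul, CharBimodule.equiv_smul]
    ring⟩

end CharBimodule

end Hochschild

/-! # Quantum matrices and quantum linear groups -/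

namespace Quantum

variable {k : Type u} [Field k] (q : kˣ) (n : ℕ)

variable (k) in
/-- The generator `x i j` of the free algebra. -/
def gen {n : ℕ} (i j : Fin n) : FreeAlgebra k (Fin n × Fin n) := FreeAlgebra.ι k (i, j)

/-- The defining relations of the algebra of quantum `n × n`-matrices. -/
inductive MatrixRel : FreeAlgebra k (Fin n × Fin n) → FreeAlgebra k (Fin n × Fin n) → Prop
  | col (i j l : Fin n) (hij : i < j) :
      MatrixRel (gen k j l * gen k i l) ((q : k) • (gen k i l * gen k j l))
  | row (i j l : Fin n) (hij : i < j) :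
      MatrixRel (gen k l j * gen k l i) ((q : k) • (gen k l i * gen k l j))
  | anti (r l i j : Fin n) (hrl : r < l) (hij : i < j) :
      MatrixRel (gen k l i * gen k r j) (gen k r j * gen k l i)
  | diag (r l i j : Fin n) (hrl : r < l) (hij : i < j) :
      MatrixRel (gen k r i * gen k l j - gen k l j * gen k r i)
        (((q⁻¹ : kˣ) - (q : k) : k) • (gen k r j * gen k l i))

/-- The algebra `M_q(n)` of quantum matrices. -/
def QMat : Type u := RingQuot (MatrixRel q n)

instance : Ring (QMat q n) := inferInstanceAs (Ring (RingQuot (MatrixRel q n)))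

instance : Algebra k (QMat q n) := inferInstanceAs (Algebra k (RingQuot (MatrixRel q n)))

namespace QMat

/-- The projection of the free algebra onto `M_q(n)`. -/
def mk : FreeAlgebra k (Fin n × Fin n) →ₐ[k] QMat q n := RingQuot.mkAlgHom k (MatrixRel q n)

/-- The generator `x i j` of `M_q(n)`. -/
def x {n : ℕ} (i j : Fin n) : QMat q n := mk q n (gen k i j)

end QMat

/-- The length of a permutation: the number of its inversions. -/
def permLength {n : ℕ} (σ : Equiv.Perm (Fin n)) : ℕ :=
  (Finset.univ.filter fun p : Fin n × Fin n => p.1 < p.2 ∧ σ p.2 < σ p.1).card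

/-- The quantum determinant `∑ σ, (-q⁻¹) ^ ℓ(σ) x 1 σ(1) ⋯ x n σ(n)`. -/
def qdet : QMat q n :=
  ∑ σ : Equiv.Perm (Fin n), (-((q⁻¹ : kˣ) : k)) ^ permLength σ •
    (List.ofFn fun i : Fin n => QMat.x q i (σ i)).prod

/-- The relation `t D = 1` in the polynomial algebra `M_q(n)[t]`, in which the variable `t` is
central. -/
inductive GLRel : Polynomial (QMat q n) → Polynomial (QMat q n) → Prop
  | inv : GLRel (Polynomial.X * Polynomial.C (qdet q n)) 1

/-- The quantum general linear group `GL_q(n) = M_q(n)[t] / ⟨t D - 1⟩`. -/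
def QGL : Type u := RingQuot (GLRel q n)

instance : Ring (QGL q n) := inferInstanceAs (Ring (RingQuot (GLRel q n)))

instance : Algebra k (QGL q n) := inferInstanceAs (Algebra k (RingQuot (GLRel q n)))

/-- The relation `D = 1` in `M_q(n)`. -/
inductive SLRel : QMat q n → QMat q n → Prop
  | det : SLRel (qdet q n) 1

/-- The quantum special linear group `SL_q(n) = M_q(n) / ⟨D - 1⟩`. -/
def QSL : Type u := RingQuot (SLRel q n)

instance : Ring (QSL q n) := inferInstanceAs (Ring (RingQuot (SLRel q n)))

instance : Algebra k (QSL q n) := inferInstanceAs (Algebra k (RingQuot (SLRel q n)))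

namespace QGL

/-- The projection of `M_q(n)[t]` onto `GL_q(n)`. -/
def mk : Polynomial (QMat q n) →ₐ[k] QGL q n := RingQuot.mkAlgHom k (GLRel q n)

/-- The canonical map `M_q(n) → GL_q(n)`. -/
def ofMat : QMat q n →ₐ[k] QGL q n := (mk q n).comp Polynomial.CAlgHom

end QGL

namespace QSL

/-- The projection of `M_q(n)` onto `SL_q(n)`. -/
def ofMat : QMat q n →ₐ[k] QSL q n := RingQuot.mkAlgHom k (SLRel q n)

end QSL

/-! ### Diagonal characters -/

section Characters

variable {n}

/-- The character of the free algebra with `x i j ↦ δ i j * a i`. -/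
def freeChar (a : Fin n → k) : FreeAlgebra k (Fin n × Fin n) →ₐ[k] k :=
  FreeAlgebra.lift k fun p => if p.1 = p.2 then a p.1 else 0

lemma freeChar_gen (a : Fin n → k) (i j : Fin n) :
    freeChar a (gen k i j) = if i = j then a i else 0 := by
  simp [freeChar, gen]

lemma freeChar_rel (a : Fin n → k) ⦃x y : FreeAlgebra k (Fin n × Fin n)⦄
    (h : MatrixRel q n x y) : freeChar a x = freeChar a y := by
  cases h with
  | col i j l hij =>
    simp only [map_mul, map_smul, freeChar_gen, smul_eq_mul]
    split_ifs <;> simp_all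
  | row i j l hij =>
    simp only [map_mul, map_smul, freeChar_gen, smul_eq_mul]
    split_ifs <;> simp_all
  | anti r l i j hrl hij => simp only [map_mul, mul_comm]
  | diag r l i j hrl hij =>
    simp only [map_mul, map_smul, map_sub, freeChar_gen, smul_eq_mul]
    split_ifs with h1 h2 h3 h4 <;> first | (exfalso; omega) | ring

/-- The character of `M_q(n)` with `x i j ↦ δ i j * a i`. -/
def QMat.char (a : Fin n → k) : QMat q n →ₐ[k] k :=
  RingQuot.liftAlgHom k ⟨freeChar a, freeChar_rel q a⟩

lemma QMat.char_mk (a : Fin n → k) (y : FreeAlgebra k (Fin n × Fin n)) :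
    QMat.char q a (QMat.mk q n y) = freeChar a y :=
  RingQuot.liftAlgHom_mkAlgHom_apply k _ _ _

lemma QMat.char_x (a : Fin n → k) (i j : Fin n) :
    QMat.char q a (QMat.x q i j) = if i = j then a i else 0 := by
  rw [QMat.x, QMat.char_mk, freeChar_gen]

lemma QMat.char_qdet (a : Fin n → k) : QMat.char q a (qdet q n) = ∏ i, a i := by
  rw [qdet, map_sum, Finset.sum_eq_single (1 : Equiv.Perm (Fin n))]
  · have h : permLength (1 : Equiv.Perm (Fin n)) = 0 := by
      rw [permLength, Finset.card_eq_zero, Finset.filter_eq_empty_iff]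
      rintro p - ⟨h1, h2⟩
      exact absurd h1 (not_lt.2 h2.le)
    rw [h, pow_zero, one_smul, map_list_prod, List.map_ofFn, List.prod_ofFn]
    simp [QMat.char_x]
  · intro σ _ hσ
    obtain ⟨i, hi⟩ : ∃ i, σ i ≠ i := by
      by_contra! h
      exact hσ (Equiv.ext h)
    rw [map_smul, map_list_prod, List.map_ofFn, List.prod_ofFn,
      Finset.prod_eq_zero (Finset.mem_univ i), smul_zero]
    simp [QMat.char_x, hi.symm]
  · simp

/-- The character of `GL_q(n)` with `x i j ↦ δ i j * a i` and `t ↦ 1`, for `a` with product `1`. -/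
def QGL.char (a : Fin n → k) (ha : ∏ i, a i = 1) : QGL q n →ₐ[k] k :=
  RingQuot.liftAlgHom k ⟨Polynomial.eval₂AlgHom (QMat.char q a) 1 fun _ => Commute.all _ _, by
    rintro _ _ ⟨⟩
    simp [QMat.char_qdet, ha]⟩

lemma QGL.char_ofMat (a : Fin n → k) (ha : ∏ i, a i = 1) (y : QMat q n) :
    QGL.char q a ha (QGL.ofMat q n y) = QMat.char q a y :=
  (RingQuot.liftAlgHom_mkAlgHom_apply k _ _ _).trans (Polynomial.eval₂_C _ _)

/-- The character of `SL_q(n)` with `x i j ↦ δ i j * a i`, for `a` with product `1`. -/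
def QSL.char (a : Fin n → k) (ha : ∏ i, a i = 1) : QSL q n →ₐ[k] k :=
  RingQuot.liftAlgHom k ⟨QMat.char q a, by
    rintro _ _ ⟨⟩
    rw [QMat.char_qdet, ha, map_one]⟩

lemma QSL.char_ofMat (a : Fin n → k) (ha : ∏ i, a i = 1) (y : QMat q n) :
    QSL.char q a ha (QSL.ofMat q n y) = QMat.char q a y :=
  RingQuot.liftAlgHom_mkAlgHom_apply k _ _ _

variable (n)

/-- The scalars `q ^ (n + 1 - 2 i)` for `i = 1, …, n`; an index `i : Fin n` of the code stands for
the index `i + 1`. -/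
def fInvScalar (i : Fin n) : k := ((q ^ ((n : ℤ) + 1 - 2 * (((i : ℕ) : ℤ) + 1)) : kˣ) : k)

lemma prod_fInvScalar : ∏ i, fInvScalar q n i = 1 := by
  have h : ∀ m : ℕ, ∑ i : Fin m, (((i : ℕ) : ℤ) + 1) * 2 = m * (m + 1) := by
    intro m
    induction m with
    | zero => simp
    | succ m ih =>
      rw [Fin.sum_univ_castSucc]
      simp only [Fin.val_castSucc, Fin.val_last, ih]
      push_cast
      ring
  have h' : ∑ i : Fin n, ((n : ℤ) + 1 - 2 * (((i : ℕ) : ℤ) + 1)) = 0 := by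
    have := h n
    rw [Finset.sum_sub_distrib]
    simp only [Finset.sum_const, Finset.card_univ, Fintype.card_fin, nsmul_eq_mul]
    simp only [mul_comm (2 : ℤ), this]
    ring
  simp only [fInvScalar]
  rw [← Units.coe_prod]
  have : ∀ s : Finset (Fin n), ∏ i ∈ s, q ^ ((n : ℤ) + 1 - 2 * (((i : ℕ) : ℤ) + 1)) =
      q ^ (∑ i ∈ s, ((n : ℤ) + 1 - 2 * (((i : ℕ) : ℤ) + 1))) := by
    intro s
    induction s using Finset.induction_on with
    | empty => simp
    | insert i s hi ih => rw [Finset.prod_insert hi, Finset.sum_insert hi, zpow_add, ih]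
  rw [this, h', zpow_zero, Units.val_one]

/-- The character `f⁻¹` of `M_q(n)`, with `x i j ↦ δ i j * q ^ (n + 1 - 2 i)`. -/
def QMat.fInv : QMat q n →ₐ[k] k := QMat.char q (fInvScalar q n)

/-- The counit of `M_q(n)`, with `x i j ↦ δ i j`. -/
def QMat.counit : QMat q n →ₐ[k] k := QMat.char q 1

/-- The character `f⁻¹` of `GL_q(n)`, with `x i j ↦ δ i j * q ^ (n + 1 - 2 i)`. -/
def QGL.fInv : QGL q n →ₐ[k] k := QGL.char q (fInvScalar q n) (prod_fInvScalar q n)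

/-- The counit of `GL_q(n)`, with `x i j ↦ δ i j`. -/
def QGL.counit : QGL q n →ₐ[k] k := QGL.char q 1 (by simp)

/-- The character `f⁻¹` of `SL_q(n)`, with `x i j ↦ δ i j * q ^ (n + 1 - 2 i)`. -/
def QSL.fInv : QSL q n →ₐ[k] k := QSL.char q (fInvScalar q n) (prod_fInvScalar q n)

/-- The counit of `SL_q(n)`, with `x i j ↦ δ i j`. -/
def QSL.counit : QSL q n →ₐ[k] k := QSL.char q 1 (by simp)

end Characters

/-! ### The homology groups -/

/-- `H_ℓ(M_q(n), k)`, where `M_q(n)` acts on `k` by `f⁻¹` on the left and by the counit on the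
right. -/
def matHomology (l : ℕ) : ModuleCat.{u} k :=
  Hochschild.homology k (QMat q n) (Hochschild.CharBimodule (QMat.fInv q n) (QMat.counit q n)) l

/-- `H_ℓ(GL_q(n), k)`, where `GL_q(n)` acts on `k` by `f⁻¹` on the left and by the counit on the
right. -/
def glHomology (l : ℕ) : ModuleCat.{u} k :=
  Hochschild.homology k (QGL q n) (Hochschild.CharBimodule (QGL.fInv q n) (QGL.counit q n)) l

/-- `H_ℓ(SL_q(n), k)`, where `SL_q(n)` acts on `k` by `f⁻¹` on the left and by the counit on the
right. -/
def slHomology (l : ℕ) : ModuleCat.{u} k :=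
  Hochschild.homology k (QSL q n) (Hochschild.CharBimodule (QSL.fInv q n) (QSL.counit q n)) l

/-- The map `H_ℓ(M_q(n), k) → H_ℓ(GL_q(n), k)` induced by the canonical map `M_q(n) → GL_q(n)`
and the identity of `k`. -/
def matToGL (l : ℕ) : matHomology q n l →ₗ[k] glHomology q n l :=
  Hochschild.homologyMap (QGL.ofMat q n)
    ((Hochschild.CharBimodule.equiv (QMat.fInv q n) (QMat.counit q n)).trans
      (Hochschild.CharBimodule.equiv (QGL.fInv q n) (QGL.counit q n)).symm).toLinearMap
    (fun a m => congrArg (· * Hochschild.CharBimodule.equiv _ _ m)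
      (QGL.char_ofMat q (fInvScalar q n) (prod_fInvScalar q n) a).symm)
    (fun a m => congrArg (· * Hochschild.CharBimodule.equiv _ _ m)
      (QGL.char_ofMat q 1 (by simp) a).symm) l

end Quantum

end

/-! Let β be a character of an algebra A, and let a left A-module V become a bimodule with right
action through β. Its Hochschild homology behaves as Tor over A of k_β and V. In degree 0 it is V
modulo all β(a)v − av. Free modules are acyclic by an explicit contraction
(`subsingleton_twistHomology_of_free`), and short exact sequences of modules give long ones because
k is a field. Hence, by dimension shifting (`twistHomologyMap_bijective_of_covers`), a class of
semilinear maps that is stable under kernels of suitable acyclic covers induces isomorphisms in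
every degree once it does so in degree 0. This is used twice.

Localization. The quantum determinant D is central in A = M_q(n) (`commute_qdet`), so the kernel of
A[t] → B = GL_q(n) is generated by tD − 1, and multiplication by tD − 1 on A[t] gives a free
resolution of B over A of length one. In degree 0 it becomes multiplication by t − 1 on k[t],
because the counit sends D to 1, and this is injective. So free B-modules are acyclic over A
(`subsingleton_twistHomology_restrict`). In degree 0 inverting D adds no commutators, and dimension
shifting gives the comparison of M_q(n) with GL_q(n).

Splitting. Multiplying the first row by a central element multiplies D by it. Dividing the first row
by D therefore maps SL_q(n) to GL_q(n), and GL_q(n) ≅ SL_q(n)[T, T⁻¹] with D corresponding to T.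
Both characters send T to 1. Resolve k by multiplication by T − 1 on k[T, T⁻¹]. The homology of S[T,
T⁻¹] in k[T, T⁻¹] is that of S in k (`IsLaurentExtension.bijective`), and there T − 1 acts by zero
(`LaurentModule.homologyMap_mulSubOne`). The long exact sequence breaks into short exact sequences
of vector spaces, which split.

Centrality of D. Multiplication by the entries of a row, or on the right by those of a column,
defines operators on functions of finite sets that satisfy the relations of a q-exterior algebra;
iterating them yields the minors. Minors built from rows agree with those built from columns
(`IsQMatrix.rowMinor_eq_colMinor`). So the same minors, weighted by powers of −q⁻¹, form an adjugate
on both sides of the matrix, and evaluating matrix · adjugate · matrix in two ways shows that D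
commutes with every generator. -/

noncomputable section

/-! ### Functoriality of Hochschild homology, and its description in degree 0. -/

namespace Hochschild

section Functoriality

set_option linter.unusedSectionVars false

variable {k A B C M N L : Type u} [CommRing k] [Ring A] [Algebra k A] [AddCommGroup M] [Module k M]
  [Module A M] [Module Aᵐᵒᵖ M] [IsScalarTower k A M] [IsScalarTower k Aᵐᵒᵖ M]
  [SMulCommClass A Aᵐᵒᵖ M]
  [Ring B] [Algebra k B] [AddCommGroup N] [Module k N]
  [Module B N] [Module Bᵐᵒᵖ N] [IsScalarTower k B N] [IsScalarTower k Bᵐᵒᵖ N]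
  [SMulCommClass B Bᵐᵒᵖ N]
  [Ring C] [Algebra k C] [AddCommGroup L] [Module k L]
  [Module C L] [Module Cᵐᵒᵖ L] [IsScalarTower k C L] [IsScalarTower k Cᵐᵒᵖ L]
  [SMulCommClass C Cᵐᵒᵖ L]

lemma chainsMap_comp (φ : A →ₐ[k] B) (g : M →ₗ[k] N) (ψ : B →ₐ[k] C) (h : N →ₗ[k] L) (n : ℕ) :
    chainsMap (ψ.comp φ) (h ∘ₗ g) n = chainsMap ψ h n ∘ₗ chainsMap φ g n := by
  induction n with
  | zero => rfl
  | succ n ih =>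
    refine chains_ext fun c a => ?_
    simp only [LinearMap.comp_apply, chainsMap_snoc, ih, AlgHom.comp_apply]

lemma chainsMap_id (n : ℕ) :
    chainsMap (AlgHom.id k A) (LinearMap.id : M →ₗ[k] M) n = LinearMap.id := by
  induction n with
  | zero => rfl
  | succ n ih =>
    refine chains_ext fun c a => ?_
    simp only [chainsMap_snoc, ih, AlgHom.id_apply, LinearMap.id_apply]

lemma chainsMap_zero (φ : A →ₐ[k] B) (n : ℕ) : chainsMap φ (0 : M →ₗ[k] N) n = 0 := by
  induction n with
  | zero => rfl
  | succ n ih =>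
    refine chains_ext fun c a => ?_
    rw [chainsMap_snoc, ih, LinearMap.zero_apply, map_zero]
    rfl

lemma homologyMap_eq_zero (φ : A →ₐ[k] B) (g : M →ₗ[k] N) (hl : ∀ a m, g (a • m) = φ a • g m)
    (hr : ∀ a m, g (MulOpposite.op a • m) = MulOpposite.op (φ a) • g m) (hg : ∀ m, g m = 0)
    (l : ℕ) : homologyMap φ g hl hr l = 0 := by
  obtain rfl : g = 0 := LinearMap.ext hg
  have : complexMap φ (0 : M →ₗ[k] N) hl hr = 0 := by
    ext n : 1
    exact ModuleCat.hom_ext (chainsMap_zero φ n)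
  simp only [homologyMap, this, HomologicalComplex.homologyMap_zero]
  rfl

/-- The composite is a separate pair χ, e, compared pointwise, so that the lemma applies to maps
that equal a composite without being written as one. -/
lemma homologyMap_comp (φ : A →ₐ[k] B) (g : M →ₗ[k] N) (hl : ∀ a m, g (a • m) = φ a • g m)
    (hr : ∀ a m, g (MulOpposite.op a • m) = MulOpposite.op (φ a) • g m)
    (ψ : B →ₐ[k] C) (h : N →ₗ[k] L) (hl' : ∀ a m, h (a • m) = ψ a • h m)
    (hr' : ∀ a m, h (MulOpposite.op a • m) = MulOpposite.op (ψ a) • h m)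
    (χ : A →ₐ[k] C) (e : M →ₗ[k] L) (hl'' : ∀ a m, e (a • m) = χ a • e m)
    (hr'' : ∀ a m, e (MulOpposite.op a • m) = MulOpposite.op (χ a) • e m)
    (hχ : ∀ a, χ a = ψ (φ a)) (he : ∀ m, e m = h (g m)) (l : ℕ) :
    homologyMap χ e hl'' hr'' l = homologyMap ψ h hl' hr' l ∘ₗ homologyMap φ g hl hr l := by
  obtain rfl : χ = ψ.comp φ := AlgHom.ext hχ
  obtain rfl : e = h ∘ₗ g := LinearMap.ext he
  have : complexMap (ψ.comp φ) (h ∘ₗ g) hl'' hr'' = complexMap φ g hl hr ≫ complexMap ψ h hl' hr' := by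
    ext n : 1
    exact ModuleCat.hom_ext (chainsMap_comp φ g ψ h n)
  simp only [homologyMap, this, HomologicalComplex.homologyMap_comp]
  rfl

lemma homologyMap_id (χ : A →ₐ[k] A) (e : M →ₗ[k] M) (hl : ∀ a m, e (a • m) = χ a • e m)
    (hr : ∀ a m, e (MulOpposite.op a • m) = MulOpposite.op (χ a) • e m)
    (hχ : ∀ a, χ a = a) (he : ∀ m, e m = m) (l : ℕ) :
    homologyMap χ e hl hr l = LinearMap.id := by
  obtain rfl : χ = AlgHom.id k A := AlgHom.ext hχ
  obtain rfl : e = LinearMap.id := LinearMap.ext he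
  have : complexMap (AlgHom.id k A) LinearMap.id hl hr = 𝟙 (complex k A M) := by
    ext n : 1
    exact ModuleCat.hom_ext (chainsMap_id n)
  simp only [homologyMap, this, HomologicalComplex.homologyMap_id]
  rfl

lemma homologyMap_bijective_of_bijective (φ : A →ₐ[k] B) (g : M →ₗ[k] N)
    (hl : ∀ a m, g (a • m) = φ a • g m)
    (hr : ∀ a m, g (MulOpposite.op a • m) = MulOpposite.op (φ a) • g m)
    (hφ : Function.Bijective φ) (hg : Function.Bijective g) (l : ℕ) :
    Function.Bijective (homologyMap φ g hl hr l) := by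
  let e := AlgEquiv.ofBijective φ hφ
  let f := LinearEquiv.ofBijective g hg
  have he : ∀ a, φ (e.symm a) = a := e.apply_symm_apply
  have hf : ∀ a, g (f.symm a) = a := f.apply_symm_apply
  have he' : ∀ a, e.symm (φ a) = a := e.symm_apply_apply
  have hf' : ∀ a, f.symm (g a) = a := f.symm_apply_apply
  have hl' : ∀ a m, f.symm (a • m) = e.symm a • f.symm m := fun a m => hg.1 (by
    rw [hl, hf, he, hf])
  have hr' : ∀ a m, f.symm (MulOpposite.op a • m) = MulOpposite.op (e.symm a) • f.symm m :=
    fun a m => hg.1 (by rw [hr, hf, he, hf])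
  have h1 := homologyMap_comp φ g hl hr (e.symm : B →ₐ[k] A) (f.symm : N →ₗ[k] M) hl' hr'
    (AlgHom.id k A) LinearMap.id (fun _ _ => rfl) (fun _ _ => rfl) (fun a => (he' a).symm)
    (fun a => (hf' a).symm) l
  have h2 := homologyMap_comp (e.symm : B →ₐ[k] A) (f.symm : N →ₗ[k] M) hl' hr' φ g hl hr
    (AlgHom.id k B) LinearMap.id (fun _ _ => rfl) (fun _ _ => rfl) (fun a => (he a).symm)
    (fun a => (hf a).symm) l
  replace h1 := h1.symm.trans (homologyMap_id _ _ _ _ (fun _ => rfl) (fun _ => rfl) l)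
  replace h2 := h2.symm.trans (homologyMap_id _ _ _ _ (fun _ => rfl) (fun _ => rfl) l)
  exact ⟨Function.LeftInverse.injective fun x => (LinearMap.congr_fun h1 x),
    Function.RightInverse.surjective fun x => (LinearMap.congr_fun h2 x)⟩

lemma subsingleton_homology_succ (n : ℕ)
    (h : ∀ c, boundary k A M n c = 0 → ∃ d, boundary k A M (n + 1) d = c) :
    Subsingleton (homology k A M (n + 1)) := by
  have : (complex k A M).ExactAt (n + 1) := by
    rw [HomologicalComplex.exactAt_iff' _ (n + 2) (n + 1) n (by simp) (by simp),
      ShortComplex.moduleCat_exact_iff]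
    intro c hc
    have h1 : (complex k A M).d (n + 1) n = boundaryHom k A M n := complex_d n
    have h2 : (complex k A M).d (n + 2) (n + 1) = boundaryHom k A M (n + 1) := complex_d (n + 1)
    have hc' : ((complex k A M).d (n + 1) n).hom c = 0 := hc
    rw [h1] at hc'
    obtain ⟨d, hd⟩ := h c hc'
    refine ⟨d, ?_⟩
    change ((complex k A M).d (n + 2) (n + 1)).hom d = c
    rw [h2]
    exact hd
  rw [HomologicalComplex.exactAt_iff_isZero_homology] at this
  exact ModuleCat.subsingleton_of_isZero this

variable (k A M) in
/-- The projection of the coefficients onto the homology in degree `0`. -/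
def toHomologyZero : M →ₗ[k] homology k A M 0 :=
  ((complex k A M).pOpcycles 0 ≫ (ChainComplex.isoHomologyι₀ (complex k A M)).inv).hom

lemma toHomologyZero_surjective : Function.Surjective (toHomologyZero k A M) := by
  have : Epi ((complex k A M).pOpcycles 0 ≫ (ChainComplex.isoHomologyι₀ (complex k A M)).inv) :=
    inferInstance
  exact (ModuleCat.epi_iff_surjective _).1 this

variable (k A M) in
/-- The span of the commutators `m a - a m`. -/
def commutators : Submodule k M :=
  Submodule.span k {x | ∃ (a : A) (m : M), x = MulOpposite.op a • m - a • m}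

variable (k A M) in
/-- The boundary in degree `1`, with values in the coefficients. -/
def boundaryZero : M ⊗[k] A →ₗ[k] M := boundary k A M 0

lemma boundaryZero_tmul (m : M) (a : A) :
    boundaryZero k A M (m ⊗ₜ a) = MulOpposite.op a • m - a • m := by
  change MulOpposite.op a • m + (-1 : k) ^ (0 + 1) • (a • m) = _
  rw [zero_add, pow_one, neg_smul, one_smul, ← sub_eq_add_neg]

lemma range_boundaryZero : LinearMap.range (boundaryZero k A M) = commutators k A M := by
  apply le_antisymm
  · rintro _ ⟨d, rfl⟩
    induction d using TensorProduct.induction_on with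
    | zero => rw [map_zero]; exact Submodule.zero_mem _
    | tmul m a => exact Submodule.subset_span ⟨a, m, boundaryZero_tmul m a⟩
    | add x y hx hy => rw [map_add]; exact Submodule.add_mem _ hx hy
  · rw [commutators, Submodule.span_le]
    rintro _ ⟨a, m, rfl⟩
    exact ⟨m ⊗ₜ a, boundaryZero_tmul m a⟩

/-- There is no cycle condition in degree 0, so the homology there is the cokernel of the first
boundary, whose image is spanned by the commutators. -/
lemma toHomologyZero_eq_zero_iff (m : M) :
    toHomologyZero k A M m = 0 ↔ m ∈ commutators k A M := by
  have hinj : Function.Injective (ChainComplex.isoHomologyι₀ (complex k A M)).inv :=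
    (ModuleCat.mono_iff_injective _).1 inferInstance
  have hex := ShortComplex.exact_of_g_is_cokernel (.mk _ _ ((complex k A M).d_pOpcycles 1 0))
    ((complex k A M).opcyclesIsCokernel 1 0 (by simp))
  have hd : (complex k A M).d 1 0 = boundaryHom k A M 0 := complex_d 0
  rw [← range_boundaryZero]
  constructor
  · intro h
    have h' : (complex k A M).pOpcycles 0 m = 0 := by
      refine hinj (Eq.trans ?_ (map_zero _).symm)
      exact h
    obtain ⟨d, hd'⟩ := (ShortComplex.moduleCat_exact_iff _).1 hex m h'
    change ((complex k A M).d 1 0).hom d = m at hd'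
    rw [hd] at hd'
    exact ⟨d, hd'⟩
  · rintro ⟨d, rfl⟩
    have := (complex k A M).d_pOpcycles 1 0
    rw [hd] at this
    have h' : (complex k A M).pOpcycles 0 (boundary k A M 0 d) = 0 :=
      LinearMap.congr_fun (congrArg ModuleCat.Hom.hom this) d
    exact (congrArg (ChainComplex.isoHomologyι₀ (complex k A M)).inv h').trans (map_zero _)

lemma homologyMap_toHomologyZero (φ : A →ₐ[k] B) (g : M →ₗ[k] N)
    (hl : ∀ a m, g (a • m) = φ a • g m)
    (hr : ∀ a m, g (MulOpposite.op a • m) = MulOpposite.op (φ a) • g m) (m : M) :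
    homologyMap φ g hl hr 0 (toHomologyZero k A M m) = toHomologyZero k B N (g m) := by
  have h : ((complex k A M).pOpcycles 0 ≫ (ChainComplex.isoHomologyι₀ (complex k A M)).inv) ≫
      HomologicalComplex.homologyMap (complexMap φ g hl hr) 0 = (complexMap φ g hl hr).f 0 ≫
      ((complex k B N).pOpcycles 0 ≫ (ChainComplex.isoHomologyι₀ (complex k B N)).inv) := by
    rw [Category.assoc, ChainComplex.isoHomologyι₀_inv_naturality, ← Category.assoc,
      HomologicalComplex.p_opcyclesMap, Category.assoc]
  exact LinearMap.congr_fun (congrArg ModuleCat.Hom.hom h) m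

end Functoriality

end Hochschild

/-! ### Left modules as bimodules through a character; exact sequences and dimension shifting. -/

namespace Hochschild

section Twist

variable {k A : Type u} [Field k] [Ring A] [Algebra k A]

/-- A left `A`-module `V`, as a bimodule on which `A` acts on the right through the
character `β`. -/
@[nolint unusedArguments]
def Twist (_β : A →ₐ[k] k) (V : Type u) : Type u := V

variable (β : A →ₐ[k] k) (V : Type u) [AddCommGroup V] [Module A V]

instance : AddCommGroup (Twist β V) := inferInstanceAs (AddCommGroup V)

instance : Module A (Twist β V) := inferInstanceAs (Module A V)

/-- Scalars act through A, so that V need only be a left A-module and dimension shifting can run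
over all such modules. -/
instance : Module k (Twist β V) := Module.compHom V (algebraMap k A)

instance : Module Aᵐᵒᵖ (Twist β V) :=
  Module.compHom V ((algebraMap k A).comp
    ((β : A →+* k).fromOpposite fun _ _ => Commute.all _ _))

/-- The identification of the bimodule with the module. -/
def Twist.equiv : Twist β V ≃+ V := AddEquiv.refl V

variable {V}

lemma Twist.equiv_smul (a : A) (m : Twist β V) : equiv β V (a • m) = a • equiv β V m := rfl

lemma Twist.equiv_scalar_smul (c : k) (m : Twist β V) :
    equiv β V (c • m) = algebraMap k A c • equiv β V m := rfl

lemma Twist.equiv_op_smul (a : A) (m : Twist β V) :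
    equiv β V (MulOpposite.op a • m) = algebraMap k A (β a) • equiv β V m := rfl

instance : IsScalarTower k A (Twist β V) :=
  ⟨fun c a m => (Twist.equiv β V).injective <| by
    rw [Twist.equiv_smul, Twist.equiv_scalar_smul, Twist.equiv_smul, smul_smul, Algebra.smul_def]⟩

instance : IsScalarTower k Aᵐᵒᵖ (Twist β V) :=
  ⟨fun c a m => (Twist.equiv β V).injective <| by
    obtain ⟨a, rfl⟩ := MulOpposite.op_surjective a
    rw [← MulOpposite.op_smul, Twist.equiv_op_smul, Twist.equiv_scalar_smul, Twist.equiv_op_smul,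
      smul_smul, map_smul, smul_eq_mul, map_mul]⟩

instance : SMulCommClass A Aᵐᵒᵖ (Twist β V) :=
  ⟨fun a b m => (Twist.equiv β V).injective <| by
    obtain ⟨b, rfl⟩ := MulOpposite.op_surjective b
    simp only [Twist.equiv_op_smul, Twist.equiv_smul, smul_smul, Algebra.commutes]⟩

lemma Twist.op_smul (a : A) (m : Twist β V) : MulOpposite.op a • m = β a • m := rfl

variable (V) in
/-- The Hochschild homology with coefficients in `V`, with right action through `β`. -/
abbrev twistHomology (l : ℕ) : ModuleCat.{u} k := homology k A (Twist β V) l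

end Twist

section TwistMap

variable {k A B : Type u} [Field k] [Ring A] [Algebra k A] [Ring B] [Algebra k B]
  (φ : A →ₐ[k] B) {α : A →ₐ[k] k} {β : B →ₐ[k] k} (hβ : ∀ a, β (φ a) = α a)
  {V W : Type u} [AddCommGroup V] [Module A V] [AddCommGroup W] [Module B W]
  (g : V →+ W) (hg : ∀ a v, g (a • v) = φ a • g v)

variable (α β) in
/-- A semilinear map, as a map of bimodules. -/
def twistMap : Twist α V →ₗ[k] Twist β W where
  toFun v := g v
  map_add' := g.map_add
  map_smul' c v := (hg _ _).trans (congrArg (· • g v) (φ.commutes c))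

/-- The chain map induced by a semilinear map. -/
def twistComplexMap : complex k A (Twist α V) ⟶ complex k B (Twist β W) :=
  complexMap φ (twistMap φ α β g hg) hg fun a v => by
    rw [Twist.op_smul, Twist.op_smul, map_smul, hβ]

/-- The map in homology induced by a semilinear map. -/
def twistHomologyMap (l : ℕ) : twistHomology α V l →ₗ[k] twistHomology β W l :=
  (HomologicalComplex.homologyMap (twistComplexMap φ hβ g hg) l).hom

lemma mono_twist_iff (l : ℕ) :
    Mono (HomologicalComplex.homologyMap (twistComplexMap φ hβ g hg) l) ↔
      Function.Injective (twistHomologyMap φ hβ g hg l) := ModuleCat.mono_iff_injective _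

lemma epi_twist_iff (l : ℕ) :
    Epi (HomologicalComplex.homologyMap (twistComplexMap φ hβ g hg) l) ↔
      Function.Surjective (twistHomologyMap φ hβ g hg l) := ModuleCat.epi_iff_surjective _

variable {C : Type u} [Ring C] [Algebra k C] {U : Type u} [AddCommGroup U] [Module C U]

lemma twistHomologyMap_comp {γ : C →ₐ[k] k} (ψ : B →ₐ[k] C) (hγ : ∀ b, γ (ψ b) = β b)
    (h : W →+ U) (hh : ∀ b w, h (b • w) = ψ b • h w)
    (χ : A →ₐ[k] C) (hχ : ∀ a, γ (χ a) = α a) (e : V →+ U) (he : ∀ a v, e (a • v) = χ a • e v)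
    (h1 : ∀ a, χ a = ψ (φ a)) (h2 : ∀ v, e v = h (g v)) (l : ℕ) :
    twistHomologyMap χ hχ e he l =
      twistHomologyMap ψ hγ h hh l ∘ₗ twistHomologyMap φ hβ g hg l :=
  homologyMap_comp φ (twistMap φ α β g hg) _ _ ψ (twistMap ψ β γ h hh) _ _ χ
    (twistMap χ α γ e he) _ _ h1 h2 l

lemma twistHomologyMap_id (χ : A →ₐ[k] A) (hχ : ∀ a, α (χ a) = α a) (e : V →+ V)
    (he : ∀ a v, e (a • v) = χ a • e v) (h1 : ∀ a, χ a = a) (h2 : ∀ v, e v = v) (l : ℕ) :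
    twistHomologyMap χ hχ e he l = LinearMap.id :=
  homologyMap_id χ (twistMap χ α α e he) _ _ h1 h2 l

lemma twistHomologyMap_eq_zero (hg' : ∀ v, g v = 0) (l : ℕ) :
    twistHomologyMap φ hβ g hg l = 0 :=
  homologyMap_eq_zero φ (twistMap φ α β g hg) _ _ hg' l

variable (α V) in
/-- The span of the elements `α a v - a v`. -/
abbrev twistCommutators : Submodule k (Twist α V) := commutators k A (Twist α V)

lemma sub_mem_twistCommutators (a : A) (v : Twist α V) :
    α a • v - a • v ∈ twistCommutators α V :=
  Submodule.subset_span ⟨a, v, rfl⟩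

lemma twistHomologyMap_toHomologyZero (v : Twist α V) :
    twistHomologyMap φ hβ g hg 0 (toHomologyZero k A (Twist α V) v) =
      toHomologyZero k B (Twist β W) (twistMap φ α β g hg v) :=
  homologyMap_toHomologyZero φ (twistMap φ α β g hg) _ _ v

/-- Since degree 0 is the quotient by commutators, bijectivity there can be tested on elements. This
criterion and the next provide the start of dimension shifting. -/
lemma twistHomologyMap_zero_surjective
    (h : ∀ w : Twist β W, ∃ v : Twist α V, w - twistMap φ α β g hg v ∈ twistCommutators β W) :
    Function.Surjective (twistHomologyMap φ hβ g hg 0) := by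
  intro x
  obtain ⟨w, rfl⟩ := toHomologyZero_surjective x
  obtain ⟨v, hv⟩ := h w
  refine ⟨toHomologyZero k A (Twist α V) v, ?_⟩
  rw [twistHomologyMap_toHomologyZero]
  rw [← toHomologyZero_eq_zero_iff, map_sub, sub_eq_zero] at hv
  exact hv.symm

lemma twistHomologyMap_zero_injective
    (h : ∀ v : Twist α V, twistMap φ α β g hg v ∈ twistCommutators β W → v ∈ twistCommutators α V) :
    Function.Injective (twistHomologyMap φ hβ g hg 0) := by
  rw [injective_iff_map_eq_zero]
  intro x hx
  obtain ⟨v, rfl⟩ := toHomologyZero_surjective x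
  rw [twistHomologyMap_toHomologyZero, toHomologyZero_eq_zero_iff] at hx
  exact (toHomologyZero_eq_zero_iff v).2 (h v hx)

end TwistMap

section ShortExact

variable {k A : Type u} [Field k] [Ring A] [Algebra k A] (β : A →ₐ[k] k)
  {U V W : Type u} [AddCommGroup U] [Module A U] [AddCommGroup V] [Module A V]
  [AddCommGroup W] [Module A W] (f : U →ₗ[A] V) (g : V →ₗ[A] W)

/-- The chain map induced by a linear map. -/
abbrev twistComplexMapOfLinear : complex k A (Twist β U) ⟶ complex k A (Twist β V) :=
  twistComplexMap (AlgHom.id k A) (fun _ => rfl) f.toAddMonoidHom f.map_smul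

/-- The map in homology induced by a linear map. -/
abbrev twistHomologyMapOfLinear (l : ℕ) : twistHomology β U l →ₗ[k] twistHomology β V l :=
  twistHomologyMap (AlgHom.id k A) (fun _ => rfl) f.toAddMonoidHom f.map_smul l

/-- Each further degree tensors with A over the field k, and A is flat over k. -/
lemma chainsMap_exact {M N L : Type u} [AddCommGroup M] [Module k M]
    [AddCommGroup N] [Module k N] [AddCommGroup L] [Module k L]
    (f : M →ₗ[k] N) (g : N →ₗ[k] L)
    (hf : Function.Injective f) (hfg : Function.Exact f g) (hg : Function.Surjective g) (n : ℕ) :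
    Function.Injective (chainsMap (AlgHom.id k A) f n) ∧
    Function.Exact (chainsMap (AlgHom.id k A) f n) (chainsMap (AlgHom.id k A) g n) ∧
    Function.Surjective (chainsMap (AlgHom.id k A) g n) := by
  induction n with
  | zero => exact ⟨hf, hfg, hg⟩
  | succ n ih =>
    obtain ⟨h1, h2, h3⟩ := ih
    have key : ∀ {M N : Type u} [AddCommGroup M] [Module k M] [AddCommGroup N] [Module k N]
        (f : M →ₗ[k] N), chainsMap (AlgHom.id k A) f (n + 1) =
        LinearMap.rTensor A (chainsMap (AlgHom.id k A) f n) := by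
      intro M N _ _ _ _ f
      exact TensorProduct.ext' fun c a => rfl
    rw [key f, key g]
    exact ⟨Module.Flat.rTensor_preserves_injective_linearMap _ h1, rTensor_exact A h2 h3,
      LinearMap.rTensor_surjective A h3⟩

variable {f g}

/-- The short complex of Hochschild complexes of an exact pair of linear maps. -/
def twistShortComplex (hfg : Function.Exact f g) :
    ShortComplex (ChainComplex (ModuleCat.{u} k) ℕ) where
  X₁ := complex k A (Twist β U)
  X₂ := complex k A (Twist β V)
  X₃ := complex k A (Twist β W)
  f := twistComplexMapOfLinear β f
  g := twistComplexMapOfLinear β g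
  zero := by
    ext n : 1
    have h : (twistMap (AlgHom.id k A) β β g.toAddMonoidHom g.map_smul) ∘ₗ
        (twistMap (AlgHom.id k A) β β f.toAddMonoidHom f.map_smul) = 0 :=
      LinearMap.ext fun v => hfg.apply_apply_eq_zero v
    exact ModuleCat.hom_ext ((chainsMap_comp (AlgHom.id k A) _ (AlgHom.id k A) _ n).symm.trans
      ((congrArg (fun e => chainsMap (AlgHom.id k A) e n) h).trans
        (chainsMap_zero _ n)))

lemma twistShortComplex_shortExact (hf : Function.Injective f) (hfg : Function.Exact f g)
    (hg : Function.Surjective g) : (twistShortComplex β hfg).ShortExact := by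
  refine HomologicalComplex.shortExact_of_degreewise_shortExact _ fun n => ?_
  obtain ⟨h1, h2, h3⟩ := chainsMap_exact (A := A)
    (twistMap (AlgHom.id k A) β β f.toAddMonoidHom f.map_smul)
    (twistMap (AlgHom.id k A) β β g.toAddMonoidHom g.map_smul) hf hfg hg n
  exact ModuleCat.shortComplex_shortExact _ h2 h1 h3

end ShortExact

section DimensionShift

variable {k A B : Type u} [Field k] [Ring A] [Algebra k A] [Ring B] [Algebra k B]
  (φ : A →ₐ[k] B) {α : A →ₐ[k] k} {β : B →ₐ[k] k} (hβ : ∀ a, β (φ a) = α a)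

/-- Dimension shifting: a class of semilinear maps which induce bijections in degree `0`, and
which have covers in the class by acyclic modules, with kernels in the class, induces bijections
in every degree. -/
theorem twistHomologyMap_bijective_of_covers
    (P : ∀ (V W : Type u) [AddCommGroup V] [Module A V] [AddCommGroup W] [Module B W],
      (V →+ W) → Prop)
    (hP : ∀ (V W : Type u) [AddCommGroup V] [Module A V] [AddCommGroup W] [Module B W]
      (g : V →+ W), P V W g → ∀ a v, g (a • v) = φ a • g v)
    (hzero : ∀ (V W : Type u) [AddCommGroup V] [Module A V] [AddCommGroup W] [Module B W]
      (g : V →+ W) (h : P V W g),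
      Function.Bijective (twistHomologyMap φ hβ g (hP V W g h) 0))
    (hcov : ∀ (V W : Type u) [AddCommGroup V] [Module A V] [AddCommGroup W] [Module B W]
      (g : V →+ W), P V W g → ∃ (E : ModuleCat.{u} A) (E' : ModuleCat.{u} B)
        (p : E →ₗ[A] V) (p' : E' →ₗ[B] W) (h : E →+ E')
        (h' : LinearMap.ker p →+ LinearMap.ker p'),
        Function.Surjective p ∧ Function.Surjective p' ∧ (∀ e, p' (h e) = g (p e)) ∧
        (∀ e, (h' e : E') = h e) ∧ P E E' h ∧ P _ _ h' ∧
        (∀ l, Subsingleton (twistHomology α E (l + 1))) ∧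
        (∀ l, Subsingleton (twistHomology β E' (l + 1))))
    (l : ℕ) (V W : Type u) [AddCommGroup V] [Module A V] [AddCommGroup W] [Module B W]
    (g : V →+ W) (hg : P V W g) :
    Function.Bijective (twistHomologyMap φ hβ g (hP V W g hg) l) := by
  induction l generalizing V W with
  | zero => exact hzero V W g hg
  | succ l ih =>
    -- By the four lemma, surjectivity for `g` in degree `l + 1` needs only degree `l` for the
    -- kernels and the covers. Injectivity needs surjectivity for the kernels in the same degree `l
    -- + 1`, so surjectivity is first obtained for the whole class.
    have step : ∀ (V W : Type u) [AddCommGroup V] [Module A V] [AddCommGroup W] [Module B W]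
        (g : V →+ W) (hg : P V W g),
        Function.Surjective (twistHomologyMap φ hβ g (hP V W g hg) (l + 1)) ∧
        ((∀ (V W : Type u) [AddCommGroup V] [Module A V] [AddCommGroup W] [Module B W]
          (g : V →+ W) (hg : P V W g),
          Function.Surjective (twistHomologyMap φ hβ g (hP V W g hg) (l + 1))) →
          Function.Injective (twistHomologyMap φ hβ g (hP V W g hg) (l + 1))) := by
      intro V W _ _ _ _ g hg
      obtain ⟨E, E', p, p', h, h', hp, hp', hcomm, hker, hPE, hPK, hE, hE'⟩ := hcov V W g hg
      have hS := twistShortComplex_shortExact α (f := (LinearMap.ker p).subtype) (g := p)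
        Subtype.val_injective (LinearMap.exact_subtype_ker_map p) hp
      have hS' := twistShortComplex_shortExact β (f := (LinearMap.ker p').subtype) (g := p')
        Subtype.val_injective (LinearMap.exact_subtype_ker_map p') hp'
      let Φ : twistShortComplex α (LinearMap.exact_subtype_ker_map p) ⟶
          twistShortComplex β (LinearMap.exact_subtype_ker_map p') :=
        { τ₁ := twistComplexMap φ hβ h' (hP _ _ _ hPK)
          τ₂ := twistComplexMap φ hβ h (hP _ _ _ hPE)
          τ₃ := twistComplexMap φ hβ g (hP _ _ _ hg)
          comm₁₂ := by
            ext n : 1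
            refine ModuleCat.hom_ext ((chainsMap_comp _ _ _ _ n).symm.trans
              (Eq.trans ?_ (chainsMap_comp _ _ _ _ n)))
            congr 1
            exact LinearMap.ext hker
          comm₂₃ := by
            ext n : 1
            refine ModuleCat.hom_ext ((chainsMap_comp _ _ _ _ n).symm.trans
              (Eq.trans ?_ (chainsMap_comp _ _ _ _ n)))
            congr 1
            exact LinearMap.ext hcomm }
      have hrel : ∀ j, (ComplexShape.down ℕ).Rel (l + 1) j → j = l := by
        intro j hj
        simpa using hj
      constructor
      · rw [← epi_twist_iff]
        refine HomologicalComplex.HomologySequence.epi_homologyMap_τ₃ Φ hS hS' (l + 1) ?_ ?_ ?_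
        · refine (epi_twist_iff φ hβ h (hP _ _ _ hPE) _).2 fun x => ⟨0, ?_⟩
          exact (hE' l).elim _ _
        · intro j hj
          obtain rfl := hrel j hj
          exact (epi_twist_iff φ hβ h' (hP _ _ _ hPK) _).2 (ih _ _ _ hPK).2
        · intro j hj
          obtain rfl := hrel j hj
          exact (mono_twist_iff φ hβ h (hP _ _ _ hPE) _).2 (ih _ _ _ hPE).1
      · intro hsurj
        rw [← mono_twist_iff]
        refine HomologicalComplex.HomologySequence.mono_homologyMap_τ₃ Φ hS hS' (l + 1) ?_ ?_ ?_
        · exact (epi_twist_iff φ hβ h' (hP _ _ _ hPK) _).2 (hsurj _ _ _ hPK)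
        · exact (mono_twist_iff φ hβ h (hP _ _ _ hPE) _).2 fun x y _ => (hE l).elim _ _
        · intro j hj
          obtain rfl := hrel j hj
          exact (mono_twist_iff φ hβ h' (hP _ _ _ hPK) _).2 (ih _ _ _ hPK).1
    have hsurj := fun (V W : Type u) [AddCommGroup V] [Module A V] [AddCommGroup W] [Module B W]
      (g : V →+ W) (hg : P V W g) => (step V W g hg).1
    exact ⟨(step V W g hg).2 hsurj, hsurj V W g hg⟩

end DimensionShift

end Hochschild

/-! ### A contraction of the Hochschild complex, and acyclicity of free modules. -/

namespace Hochschild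

section Contraction

set_option linter.unusedSectionVars false

variable {k A M : Type u} [CommRing k] [Ring A] [Algebra k A] [AddCommGroup M] [Module k M]
  [Module A M] [Module Aᵐᵒᵖ M] [IsScalarTower k A M] [IsScalarTower k Aᵐᵒᵖ M]
  [SMulCommClass A Aᵐᵒᵖ M]

/-- A map of chains, extended by the identity on a further factor. -/
def mapInit {m n : ℕ} (f : chains k A M m →ₗ[k] chains k A M n) :
    chains k A M (m + 1) →ₗ[k] chains k A M (n + 1) :=
  unsnoc (snoc k A M n ∘ₗ f)

/-- A map of `A`, applied to the last factor. -/
def mapLast (n : ℕ) (f : A →ₗ[k] A) : chains k A M (n + 1) →ₗ[k] chains k A M (n + 1) :=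
  unsnoc ((snoc k A M n).compl₂ f)

/-- The last, cyclic face without its sign. -/
def cyclicFace (n : ℕ) : chains k A M (n + 1) →ₗ[k] chains k A M n :=
  unsnoc (leftAct k A M n).flip

lemma mapInit_snoc {m n : ℕ} (f : chains k A M m →ₗ[k] chains k A M n) (c : chains k A M m)
    (a : A) : mapInit f (snoc k A M m c a) = snoc k A M n (f c) a := rfl

lemma cyclicFace_snoc (n : ℕ) (c : chains k A M n) (a : A) :
    cyclicFace n (snoc k A M n c a) = leftAct k A M n a c := rfl

lemma boundary_apply (n : ℕ) (c : chains k A M (n + 1)) :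
    boundary k A M n c = innerFaces k A M n c + (-1 : k) ^ (n + 1) • cyclicFace n c := rfl

variable (s : chains k A M 0 →ₗ[k] chains k A M 1)

/-- A map `s` from the coefficients `M` to `M ⊗ A`, extended to chains: if `s m = ∑ u ⊗ b` then
`m ⊗ a₁ ⊗ ⋯ ⊗ aₙ` is sent to `∑ u ⊗ a₁ ⊗ ⋯ ⊗ aₙ ⊗ b`. -/
def extendSection : (n : ℕ) → (chains k A M n →ₗ[k] chains k A M (n + 1))
  | 0 => s
  | n + 1 => unsnoc (LinearMap.flip
      { toFun := fun a => mapInit ((snoc k A M n).flip a) ∘ₗ extendSection n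
        map_add' := fun a b => by
          ext c
          have : ∀ y : chains k A M (n + 1), mapInit ((snoc k A M n).flip (a + b)) y =
              mapInit ((snoc k A M n).flip a) y + mapInit ((snoc k A M n).flip b) y := by
            intro y
            refine LinearMap.congr_fun (g := mapInit ((snoc k A M n).flip a) +
              mapInit ((snoc k A M n).flip b)) (chains_ext fun c d => ?_) y
            simp only [LinearMap.add_apply, mapInit_snoc, map_add]
          exact this _
        map_smul' := fun r a => by
          ext c
          have : ∀ y : chains k A M (n + 1), mapInit ((snoc k A M n).flip (r • a)) y =
              r • mapInit ((snoc k A M n).flip a) y := by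
            intro y
            refine LinearMap.congr_fun (g := r • mapInit ((snoc k A M n).flip a))
              (chains_ext fun c d => ?_) y
            simp only [LinearMap.smul_apply, mapInit_snoc, map_smul]
          exact this _ })

lemma extendSection_snoc (n : ℕ) (c : chains k A M n) (a : A) :
    extendSection s (n + 1) (snoc k A M n c a) =
      mapInit ((snoc k A M n).flip a) (extendSection s n c) := rfl

variable {s}

/-- The cyclic face makes the appended factor b act on u, and ∑ b u = m is the section property. -/
lemma cyclicFace_extendSection (hs : ∀ m, cyclicFace 0 (s m) = m) (n : ℕ) (c : chains k A M n) :
    cyclicFace n (extendSection s n c) = c := by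
  induction n with
  | zero => exact hs c
  | succ n ih =>
    refine LinearMap.congr_fun (f := cyclicFace (n + 1) ∘ₗ extendSection s (n + 1))
      (g := LinearMap.id) (chains_ext fun c a => ?_) c
    have key : cyclicFace (n + 1) ∘ₗ mapInit ((snoc k A M n).flip a) =
        (snoc k A M n).flip a ∘ₗ cyclicFace n := chains_ext fun c b => rfl
    have h := LinearMap.congr_fun key (extendSection s n c)
    rw [LinearMap.comp_apply, LinearMap.comp_apply, ih] at h
    exact h

lemma extendSection_leftAct
    (hs : ∀ a m, s (leftAct k A M 0 a m) = mapLast 0 (LinearMap.mulLeft k a) (s m)) (n : ℕ) (a : A)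
    (c : chains k A M n) : extendSection s n (leftAct k A M n a c) =
      mapLast n (LinearMap.mulLeft k a) (extendSection s n c) := by
  induction n with
  | zero => exact hs a c
  | succ n ih =>
    refine LinearMap.congr_fun (f := extendSection s (n + 1) ∘ₗ leftAct k A M (n + 1) a)
      (g := mapLast (n + 1) (LinearMap.mulLeft k a) ∘ₗ extendSection s (n + 1))
      (chains_ext fun c d => ?_) c
    have key : mapInit ((snoc k A M n).flip d) ∘ₗ mapLast n (LinearMap.mulLeft k a) =
        mapLast (n + 1) (LinearMap.mulLeft k a) ∘ₗ mapInit ((snoc k A M n).flip d) :=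
      chains_ext fun c b => rfl
    rw [LinearMap.comp_apply, LinearMap.comp_apply, leftAct_snoc, extendSection_snoc, ih,
      extendSection_snoc]
    exact LinearMap.congr_fun key _

lemma extendSection_rightAct
    (hs : ∀ a m, s (rightAct k A M 0 a m) = mapInit (rightAct k A M 0 a) (s m)) (n : ℕ) (a : A)
    (c : chains k A M n) : extendSection s n (rightAct k A M n a c) =
      mapInit (rightAct k A M n a) (extendSection s n c) := by
  cases n with
  | zero => exact hs a c
  | succ n =>
    refine LinearMap.congr_fun (f := extendSection s (n + 1) ∘ₗ rightAct k A M (n + 1) a)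
      (g := mapInit (rightAct k A M (n + 1) a) ∘ₗ extendSection s (n + 1))
      (chains_ext fun c d => ?_) c
    have key : mapInit ((snoc k A M n).flip (d * a)) =
        mapInit (rightAct k A M (n + 1) a) ∘ₗ mapInit ((snoc k A M n).flip d) :=
      chains_ext fun c b => rfl
    rw [LinearMap.comp_apply, LinearMap.comp_apply, rightAct_snoc, extendSection_snoc,
      extendSection_snoc]
    exact LinearMap.congr_fun key _

/-- These faces leave the appended factor alone. Only the face m a₁ touches the coefficients, where
compatibility of s with the right action is needed. -/
lemma mapInit_innerFaces_extendSection
    (hs : ∀ a m, s (rightAct k A M 0 a m) = mapInit (rightAct k A M 0 a) (s m)) (n : ℕ)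
    (c : chains k A M (n + 1)) : mapInit (innerFaces k A M n) (extendSection s (n + 1) c) =
      extendSection s n (innerFaces k A M n c) := by
  induction n with
  | zero =>
    refine LinearMap.congr_fun (f := mapInit (innerFaces k A M 0) ∘ₗ extendSection s 1)
      (g := extendSection s 0 ∘ₗ innerFaces k A M 0) (chains_ext fun c a => ?_) c
    have key : mapInit (innerFaces k A M 0) ∘ₗ mapInit ((snoc k A M 0).flip a) =
        mapInit (rightAct k A M 0 a) := chains_ext fun c b => rfl
    rw [LinearMap.comp_apply, LinearMap.comp_apply, extendSection_snoc, innerFaces_zero]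
    exact (LinearMap.congr_fun key _).trans (hs a c).symm
  | succ n ih =>
    refine LinearMap.congr_fun (f := mapInit (innerFaces k A M (n + 1)) ∘ₗ
      extendSection s (n + 2)) (g := extendSection s (n + 1) ∘ₗ innerFaces k A M (n + 1))
      (chains_ext fun c a => ?_) c
    have key : mapInit (innerFaces k A M (n + 1)) ∘ₗ mapInit ((snoc k A M (n + 1)).flip a) =
        mapInit ((snoc k A M n).flip a) ∘ₗ mapInit (innerFaces k A M n) +
          (-1 : k) ^ (n + 1) • mapInit (rightAct k A M (n + 1) a) := by
      refine chains_ext fun c b => ?_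
      simp only [LinearMap.comp_apply, LinearMap.add_apply, LinearMap.smul_apply, mapInit_snoc,
        LinearMap.flip_apply, innerFaces_succ, map_add, map_smul]
    have h := LinearMap.congr_fun key (extendSection s (n + 1) c)
    simp only [LinearMap.comp_apply, LinearMap.add_apply, LinearMap.smul_apply, ih] at h
    rw [LinearMap.comp_apply, LinearMap.comp_apply, extendSection_snoc, innerFaces_succ, map_add,
      map_smul, extendSection_snoc, extendSection_rightAct hs]
    exact h

/-- A section `s` of the left action of `A` on `M` which is compatible with both actions
contracts the Hochschild complex in positive degrees. -/
lemma boundary_extendSection (h1 : ∀ m, cyclicFace 0 (s m) = m)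
    (h2 : ∀ a m, s (leftAct k A M 0 a m) = mapLast 0 (LinearMap.mulLeft k a) (s m))
    (h3 : ∀ a m, s (rightAct k A M 0 a m) = mapInit (rightAct k A M 0 a) (s m)) (n : ℕ)
    (c : chains k A M (n + 1)) : boundary k A M (n + 1) (extendSection s (n + 1) c) =
      extendSection s n (boundary k A M n c) + (-1 : k) ^ n • c := by
  -- One inner face is new: it multiplies the last entry into the appended factor b. Left linearity
  -- of s through b turns it into the extension of the cyclic face of c, which completes the
  -- boundary of c; the cyclic face of the extended chain returns c itself.
  have key : innerFaces k A M (n + 1) (extendSection s (n + 1) c) =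
      mapInit (innerFaces k A M n) (extendSection s (n + 1) c) +
        (-1 : k) ^ (n + 1) • extendSection s n (cyclicFace n c) := by
    refine LinearMap.congr_fun (f := innerFaces k A M (n + 1) ∘ₗ extendSection s (n + 1))
      (g := mapInit (innerFaces k A M n) ∘ₗ extendSection s (n + 1) +
        (-1 : k) ^ (n + 1) • (extendSection s n ∘ₗ cyclicFace n)) (chains_ext fun c a => ?_) c
    have key : innerFaces k A M (n + 1) ∘ₗ mapInit ((snoc k A M n).flip a) =
        mapInit (innerFaces k A M n) ∘ₗ mapInit ((snoc k A M n).flip a) +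
          (-1 : k) ^ (n + 1) • mapLast n (LinearMap.mulLeft k a) := chains_ext fun c b => rfl
    have h := LinearMap.congr_fun key (extendSection s n c)
    simp only [LinearMap.comp_apply, LinearMap.add_apply, LinearMap.smul_apply] at h ⊢
    rw [extendSection_snoc, cyclicFace_snoc, extendSection_leftAct h2, h]
  rw [boundary_apply, key, cyclicFace_extendSection h1, mapInit_innerFaces_extendSection h3,
    boundary_apply, map_add, map_smul]
  module

lemma subsingleton_homology_of_section (h1 : ∀ m, cyclicFace 0 (s m) = m)
    (h2 : ∀ a m, s (leftAct k A M 0 a m) = mapLast 0 (LinearMap.mulLeft k a) (s m))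
    (h3 : ∀ a m, s (rightAct k A M 0 a m) = mapInit (rightAct k A M 0 a) (s m)) (n : ℕ) :
    Subsingleton (homology k A M (n + 1)) := by
  refine subsingleton_homology_succ n fun c hc => ⟨(-1 : k) ^ n • extendSection s (n + 1) c, ?_⟩
  rw [map_smul, boundary_extendSection h1 h2 h3, hc, map_zero, zero_add, smul_smul, ← mul_pow]
  simp

end Contraction

section Free

variable {k A : Type u} [Field k] [Ring A] [Algebra k A] (β : A →ₐ[k] k)
  (V : Type u) [AddCommGroup V] [Module A V]

/-- The Hochschild homology of a free module vanishes in positive degrees. -/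
theorem subsingleton_twistHomology_of_free [Module.Free A V] (n : ℕ) :
    Subsingleton (twistHomology β V (n + 1)) := by
  obtain ⟨ι, b⟩ := Module.Free.exists_basis (R := A) (M := V)
  let u : ι → Twist β V := fun i => b i
  have hz : ∀ i, u i ⊗ₜ[k] (0 : A) = 0 := fun i => tmul_zero _ _
  have hadd : ∀ i (x y : A), u i ⊗ₜ[k] (x + y) =
    u i ⊗ₜ[k] x + u i ⊗ₜ[k] y := fun i x y => tmul_add _ _ _
  -- For a basis b the section is ∑ aᵢ bᵢ ↦ ∑ bᵢ ⊗ aᵢ. It is left linear in the second factor, and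
  -- the right action, being by scalars, can be moved to bᵢ.
  let s : Twist β V →ₗ[k] Twist β V ⊗[k] A :=
    { toFun := fun m => (b.repr (Twist.equiv β V m)).sum fun i a => u i ⊗ₜ[k] a
      map_add' := fun x y => by
        rw [map_add, map_add, Finsupp.sum_add_index' hz hadd]
      map_smul' := fun c x => by
        rw [Twist.equiv_scalar_smul, map_smul, Finsupp.sum_smul_index' hz, RingHom.id_apply,
          Finsupp.smul_sum]
        refine Finsupp.sum_congr fun i _ => ?_
        rw [← tmul_smul, Algebra.smul_def, smul_eq_mul] }
  have hs : ∀ m, s m = (b.repr (Twist.equiv β V m)).sum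
    fun i a => u i ⊗ₜ[k] a := fun _ => rfl
  have key : ∀ {N : Type u} [AddCommGroup N] [Module k N] (f : Twist β V ⊗[k] A →ₗ[k] N) (m),
      f (s m) = (b.repr (Twist.equiv β V m)).sum fun i a => f (u i ⊗ₜ[k] a) := by
    intro N _ _ f m
    rw [hs, map_finsuppSum]
  refine subsingleton_homology_of_section (M := Twist β V) (s := s) ?_ ?_ ?_ n
  · intro (m : Twist β V)
    exact (key (cyclicFace (k := k) (A := A) (M := Twist β V) 0) m).trans
      (b.linearCombination_repr m)
  · intro a (m : Twist β V)
    refine Eq.trans ?_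
      (key (mapLast (k := k) (A := A) (M := Twist β V) 0 (LinearMap.mulLeft k a)) m).symm
    refine (hs (a • m)).trans ?_
    rw [Twist.equiv_smul, map_smul, Finsupp.sum_smul_index' hz]
    rfl
  · intro a (m : Twist β V)
    refine Eq.trans ?_
      (key (mapInit (k := k) (A := A) (M := Twist β V) (rightAct k A (Twist β V) 0 a)) m).symm
    refine (congrArg s (Twist.op_smul β a m)).trans ?_
    rw [map_smul, hs, Finsupp.smul_sum]
    rfl

end Free

end Hochschild

/-! ### Laurent extensions of modules preserve the homology. -/

namespace Hochschild

section SplitLongExact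

lemma nonempty_equiv_prod_of_exact {k M N P : Type*} [Field k] [AddCommGroup M] [Module k M]
    [AddCommGroup N] [Module k N] [AddCommGroup P] [Module k P] {f : M →ₗ[k] N} {g : N →ₗ[k] P}
    (hf : Function.Injective f) (h : Function.Exact f g) (hg : Function.Surjective g) :
    Nonempty (N ≃ₗ[k] M × P) := by
  obtain ⟨s, hs⟩ := g.exists_rightInverse_of_surjective (LinearMap.range_eq_top.2 hg)
  exact ⟨(h.splitSurjectiveEquiv hf ⟨s, hs⟩).1⟩

variable {k : Type u} [Field k] {S : ShortComplex (ChainComplex (ModuleCat.{u} k) ℕ)}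

/-- When the first map vanishes on homology, the long exact sequence falls apart into 0 → H(X₂) →
H(X₃) → H(X₁) → 0, with the degree of the last term lowered by one; over a field these sequences
split. In degree 0 nothing follows H₀(X₃), so the second map is an isomorphism. -/
lemma homology_equiv_of_map_eq_zero (hS : S.ShortExact)
    (h : ∀ l, HomologicalComplex.homologyMap S.f l = 0) :
    Nonempty (S.X₃.homology 0 ≃ₗ[k] S.X₂.homology 0) ∧
    ∀ l, Nonempty (S.X₃.homology (l + 1) ≃ₗ[k] S.X₂.homology (l + 1) × S.X₁.homology l) := by
  have hinj : ∀ l, Function.Injective (HomologicalComplex.homologyMap S.g l).hom := by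
    intro l
    have := (hS.homology_exact₂ l).mono_g (h l)
    exact (ModuleCat.mono_iff_injective _).1 this
  constructor
  · have hsurj : Function.Surjective (HomologicalComplex.homologyMap S.g 0).hom := by
      have := hS.epi_g
      have := HomologicalComplex.epi_homologyMap_of_epi_of_not_rel S.g 0 (by simp)
      exact (ModuleCat.epi_iff_surjective _).1 this
    exact ⟨(LinearEquiv.ofBijective _ ⟨hinj 0, hsurj⟩).symm⟩
  · intro l
    have hr : (ComplexShape.down ℕ).Rel (l + 1) l := by simp
    have hex := (ShortComplex.ShortExact.moduleCat_exact_iff_function_exact _).1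
      (hS.homology_exact₃ (l + 1) l hr)
    have hsurj : Function.Surjective (hS.δ (l + 1) l hr).hom := by
      have := (hS.homology_exact₁ (l + 1) l hr).epi_f (h l)
      exact (ModuleCat.epi_iff_surjective _).1 this
    exact nonempty_equiv_prod_of_exact (hinj (l + 1)) hex hsurj

end SplitLongExact

section Laurent

open LaurentPolynomial

variable {k A : Type u} [Field k] [Ring A] [Algebra k A]

variable (k A) in
/-- The inclusion of the coefficients into the Laurent polynomials. -/
def laurentC : A →ₐ[k] A[T;T⁻¹] := AddMonoidAlgebra.singleZeroAlgHom

lemma laurentC_apply (a : A) : laurentC k A a = C a := rfl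

variable (k A) in
/-- The map of Laurent polynomials to the coefficients with `T ↦ 1`. -/
def laurentAug : A[T;T⁻¹] →ₐ[k] A :=
  AddMonoidAlgebra.liftNCAlgHom (AlgHom.id k A) 1 fun _ _ => Commute.one_right _

lemma laurentAug_C_mul_T (a : A) (i : ℤ) : laurentAug k A (C a * T i) = a := by
  rw [← single_eq_C_mul_T]
  exact (AddMonoidAlgebra.liftNC_single _ _ _ _).trans (mul_one a)

section Assemble

set_option linter.unusedSectionVars false

variable {V W : Type u} [AddCommGroup V] [Module A V] [AddCommGroup W] [Module A[T;T⁻¹] W]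
  (g : V →+ W)

/-- The map `∑ vᵢ ↦ ∑ T ^ i g(vᵢ)`. -/
def laurentAssemble : (ℤ →₀ V) →+ W :=
  Finsupp.liftAddHom fun i => (DistribSMul.toAddMonoidHom W (T i : A[T;T⁻¹])).comp g

lemma laurentAssemble_single (i : ℤ) (v : V) :
    laurentAssemble (A := A) g (Finsupp.single i v) = (T i : A[T;T⁻¹]) • g v :=
  Finsupp.liftAddHom_apply_single _ _ _

/-- The sum of the coefficients. -/
def sumCoeff (V : Type u) [AddCommGroup V] : (ℤ →₀ V) →+ V :=
  Finsupp.liftAddHom fun _ => AddMonoidHom.id V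

lemma sumCoeff_single (i : ℤ) (v : V) : sumCoeff V (Finsupp.single i v) = v :=
  Finsupp.liftAddHom_apply_single _ _ _

variable (k A) in
/-- The map `g` is semilinear and exhibits `W` as the Laurent polynomials with coefficients
in `V`. -/
def IsLaurentExtension (V W : Type u) [AddCommGroup V] [Module A V] [AddCommGroup W]
    [Module A[T;T⁻¹] W] (g : V →+ W) : Prop :=
  (∀ a v, g (a • v) = laurentC k A a • g v) ∧ Function.Bijective (laurentAssemble (A := A) g)

variable {g}

/-- Setting T = 1, that is, adding up the coefficients, is semilinear over the algebra map T ↦ 1. -/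
lemma IsLaurentExtension.exists_retraction (h : IsLaurentExtension k A V W g) :
    ∃ r : W →+ V, (∀ b w, r (b • w) = laurentAug k A b • r w) ∧ ∀ (i : ℤ) v,
      r ((T i : A[T;T⁻¹]) • g v) = v := by
  let e := AddEquiv.ofBijective (laurentAssemble (A := A) g) h.2
  have he : ∀ f, e.symm (laurentAssemble (A := A) g f) = f := e.symm_apply_apply
  have hr : ∀ (i : ℤ) v, ((sumCoeff V).comp e.symm.toAddMonoidHom) ((T i : A[T;T⁻¹]) • g v) = v := by
    intro i v
    rw [← laurentAssemble_single]
    change sumCoeff V (e.symm _) = v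
    rw [he, sumCoeff_single]
  refine ⟨(sumCoeff V).comp e.symm.toAddMonoidHom, fun b w => ?_, hr⟩
  obtain ⟨f, rfl⟩ := h.2.2 w
  induction f using Finsupp.induction_linear with
  | zero => simp only [map_zero, smul_zero]
  | add x y hx hy => simp only [map_add, smul_add, hx, hy]
  | single j v =>
    induction b using AddMonoidAlgebra.induction_linear with
    | zero => simp only [map_zero, zero_smul]
    | add x y hx hy => simp only [map_add, add_smul, hx, hy]
    | single i a =>
      rw [single_eq_C_mul_T, laurentAug_C_mul_T, laurentAssemble_single, hr, smul_smul, mul_assoc,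
        ← T_add, ← T_mul, mul_smul, ← laurentC_apply (k := k), ← h.1, hr]

variable {β : A[T;T⁻¹] →ₐ[k] k} (hβ : ∀ i : ℤ, β (T i) = 1)

include hβ in
lemma character_laurentC_laurentAug (b : A[T;T⁻¹]) : β (laurentC k A (laurentAug k A b)) = β b := by
  induction b using AddMonoidAlgebra.induction_linear with
  | zero => simp only [map_zero]
  | add x y hx hy => simp only [map_add, hx, hy]
  | single i a =>
    rw [single_eq_C_mul_T, laurentAug_C_mul_T, map_mul, hβ, mul_one, laurentC_apply]

include hβ in
-- As β(T ^ i) = 1, the element T ^ i g(v) differs from g(v) by a commutator, so every class comes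
-- from V.
lemma IsLaurentExtension.surjective_zero (h : IsLaurentExtension k A V W g) :
    Function.Surjective (twistHomologyMap (laurentC k A) (α := β.comp (laurentC k A)) (β := β)
      (fun _ => rfl) g h.1 0) := by
  let t : W →+ Twist β W := (Twist.equiv β W).symm.toAddMonoidHom
  have key : ∀ f, t (laurentAssemble (A := A) g f) - t (g (sumCoeff V f)) ∈
      twistCommutators β W := by
    intro f
    induction f using Finsupp.induction_linear with
    | zero => simp only [map_zero, sub_zero, Submodule.zero_mem]
    | add x y hx hy =>
      have := Submodule.add_mem _ hx hy
      rw [sub_add_sub_comm] at this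
      simp only [map_add]
      exact this
    | single i v =>
      rw [laurentAssemble_single, sumCoeff_single]
      have := Submodule.neg_mem _ (sub_mem_twistCommutators (α := β) (T i : A[T;T⁻¹]) (t (g v)))
      rw [hβ, one_smul, neg_sub] at this
      exact this
  refine twistHomologyMap_zero_surjective _ _ _ _ fun w => ?_
  obtain ⟨f, rfl⟩ := h.2.2 w
  exact ⟨sumCoeff V f, key f⟩

/-- Take the free modules on the set V, over A and over A[T, T⁻¹]; the second maps onto W because
g(V) generates W. Forming Laurent polynomials is exact, so the kernels are again a Laurent
extension. -/
lemma IsLaurentExtension.covers (h : IsLaurentExtension k A V W g) :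
    ∃ (E : ModuleCat.{u} A) (E' : ModuleCat.{u} A[T;T⁻¹])
        (p : E →ₗ[A] V) (p' : E' →ₗ[A[T;T⁻¹]] W) (h : E →+ E')
        (h' : LinearMap.ker p →+ LinearMap.ker p'),
        Function.Surjective p ∧ Function.Surjective p' ∧ (∀ e, p' (h e) = g (p e)) ∧
        (∀ e, (h' e : E') = h e) ∧ IsLaurentExtension k A E E' h ∧ IsLaurentExtension k A _ _ h' ∧
        (∀ l, Subsingleton (twistHomology (β.comp (laurentC k A)) E (l + 1))) ∧
        (∀ l, Subsingleton (twistHomology β E' (l + 1))) := by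
  let p : (V →₀ A) →ₗ[A] V := Finsupp.linearCombination A id
  let p' : (V →₀ A[T;T⁻¹]) →ₗ[A[T;T⁻¹]] W := Finsupp.linearCombination _ g
  let j : (V →₀ A) →+ (V →₀ A[T;T⁻¹]) :=
    Finsupp.mapRange.addMonoidHom (laurentC k A : A →+ A[T;T⁻¹])
  have hj : ∀ v a, j (Finsupp.single v a) = Finsupp.single v (C a) := fun v a =>
    Finsupp.mapRange_single (hf := map_zero (laurentC k A))
  have hpj : ∀ e, p' (j e) = g (p e) := by
    intro e
    induction e using Finsupp.induction_linear with
    | zero => simp only [map_zero]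
    | add x y hx hy => simp only [map_add, hx, hy]
    | single v a =>
      rw [hj]
      simp only [p, p', Finsupp.linearCombination_single, id, h.1]
      rfl
  have hp : Function.Surjective p := fun v => ⟨Finsupp.single v 1, by
    simp only [p, Finsupp.linearCombination_single, id, one_smul]⟩
  have hp' : Function.Surjective p' := by
    intro w
    obtain ⟨f, rfl⟩ := h.2.2 w
    change _ ∈ LinearMap.range p'
    induction f using Finsupp.induction_linear with
    | zero => rw [map_zero]; exact Submodule.zero_mem _
    | add x y hx hy => rw [map_add]; exact Submodule.add_mem _ hx hy
    | single i v =>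
      refine ⟨Finsupp.single v (T i), ?_⟩
      rw [laurentAssemble_single, Finsupp.linearCombination_single]
  have hjs : ∀ a e, j (a • e) = laurentC k A a • j e := by
    intro a e
    ext v : 1
    exact map_mul (laurentC k A) a (e v)
  -- Assembling families only exchanges the roles of the exponent and of the basis index, so the
  -- coefficients can be read off.
  have hcoeff : ∀ (f : ℤ →₀ V →₀ A) i v,
      ((laurentAssemble (A := A) j f) v).coeff i = f i v := by
    intro f i v
    induction f using Finsupp.induction_linear with
    | zero => simp
    | add x y hx hy => simp only [map_add, Finsupp.add_apply, AddMonoidAlgebra.coeff_add, hx, hy]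
    | single m e =>
      rw [laurentAssemble_single, Finsupp.smul_apply, smul_eq_mul, T_mul]
      change (C (e v) * T m).coeff i = _
      rw [← single_eq_C_mul_T, AddMonoidAlgebra.coeff_single, Finsupp.single_apply,
        Finsupp.single_apply]
      split_ifs <;> rfl
  have hjb : Function.Bijective (laurentAssemble (A := A) j) := by
    constructor
    · intro f f' hff
      ext i v
      rw [← hcoeff, ← hcoeff, hff]
    · intro e
      change e ∈ AddMonoidHom.range _
      induction e using Finsupp.induction_linear with
      | zero => exact zero_mem _
      | add x y hx hy => exact add_mem hx hy
      | single v b =>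
        induction b using AddMonoidAlgebra.induction_linear with
        | zero => rw [Finsupp.single_zero]; exact zero_mem _
        | add x y hx hy => rw [Finsupp.single_add]; exact add_mem hx hy
        | single i a =>
          refine ⟨Finsupp.single i (Finsupp.single v a), ?_⟩
          rw [laurentAssemble_single, hj, Finsupp.smul_single, smul_eq_mul, T_mul,
            single_eq_C_mul_T]
  let j' : LinearMap.ker p →+ LinearMap.ker p' :=
    { toFun := fun e => ⟨j e.1, by rw [LinearMap.mem_ker, hpj, e.2, map_zero]⟩
      map_zero' := Subtype.ext (map_zero j)
      map_add' := fun x y => Subtype.ext (map_add j x.1 y.1) }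
  have hassj : ∀ f : ℤ →₀ LinearMap.ker p, (laurentAssemble (A := A) j' f : V →₀ A[T;T⁻¹]) =
      laurentAssemble (A := A) j (Finsupp.mapRange.addMonoidHom
        (LinearMap.ker p).subtype.toAddMonoidHom f) := by
    intro f
    induction f using Finsupp.induction_linear with
    | zero => simp only [map_zero, Submodule.coe_zero]
    | add x y hx hy => simp only [map_add, Submodule.coe_add, hx, hy]
    | single i e =>
      rw [laurentAssemble_single]
      simp only [Finsupp.mapRange.addMonoidHom_apply, Finsupp.mapRange_single]
      rw [laurentAssemble_single]
      rfl
  have hassp : ∀ f : ℤ →₀ V →₀ A, p' (laurentAssemble (A := A) j f) =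
      laurentAssemble (A := A) g (Finsupp.mapRange.addMonoidHom p.toAddMonoidHom f) := by
    intro f
    induction f using Finsupp.induction_linear with
    | zero => simp only [map_zero]
    | add x y hx hy => simp only [map_add, hx, hy]
    | single i e =>
      rw [laurentAssemble_single]
      simp only [Finsupp.mapRange.addMonoidHom_apply, Finsupp.mapRange_single]
      rw [laurentAssemble_single, map_smul, hpj]
      rfl
  refine ⟨ModuleCat.of A (V →₀ A), ModuleCat.of _ (V →₀ A[T;T⁻¹]), p, p', j, j', hp, hp', hpj,
    fun e => rfl, ⟨hjs, hjb⟩, ⟨fun a e => Subtype.ext (hjs a e), ?_, ?_⟩,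
    fun l => subsingleton_twistHomology_of_free _ _ l,
    fun l => subsingleton_twistHomology_of_free _ _ l⟩
  · intro f f' hff
    have h1 := congrArg Subtype.val hff
    rw [hassj, hassj] at h1
    exact Finsupp.mapRange_injective _ (map_zero _) Subtype.val_injective (hjb.1 h1)
  · rintro ⟨e, he⟩
    obtain ⟨f, rfl⟩ := hjb.2 e
    -- An element of the kernel of `p'` has all its coefficients in the kernel of `p`, because
    -- assembling is injective for g.
    have h0 : Finsupp.mapRange.addMonoidHom p.toAddMonoidHom f = 0 := h.2.1 (by
      rw [← hassp, map_zero]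
      exact he)
    have hf : ∀ i, f i ∈ LinearMap.ker p := fun i => DFunLike.congr_fun h0 i
    refine ⟨Finsupp.onFinset f.support (fun i => ⟨f i, hf i⟩) fun i hi => ?_, ?_⟩
    · rw [Finsupp.mem_support_iff]
      exact fun h => hi (Subtype.ext h)
    · refine Subtype.ext ((hassj _).trans (congrArg _ ?_))
      ext i : 1
      rfl

include hβ in
-- This is base change for Tor: W is V extended along the free extension A → A[T, T⁻¹]. Dimension
-- shifting reduces it to degree 0, where the retraction T ↦ 1 gives injectivity.
lemma IsLaurentExtension.bijective (h : IsLaurentExtension k A V W g) (l : ℕ) :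
    Function.Bijective (twistHomologyMap (laurentC k A) (α := β.comp (laurentC k A)) (β := β)
      (fun _ => rfl) g h.1 l) := by
  refine twistHomologyMap_bijective_of_covers (laurentC k A) (α := β.comp (laurentC k A)) (β := β)
    (fun _ => rfl) (fun V W _ _ _ _ g => IsLaurentExtension k A V W g)
    (fun V W _ _ _ _ g h => h.1) ?_ (fun V W _ _ _ _ g h => h.covers) l V W g h
  intro V W _ _ _ _ g h
  refine ⟨?_, h.surjective_zero hβ⟩
  obtain ⟨r, hr, hrg⟩ := h.exists_retraction
  have h1 := twistHomologyMap_comp (laurentC k A) (α := β.comp (laurentC k A)) (β := β)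
    (fun _ => rfl) g h.1 (laurentAug k A) (character_laurentC_laurentAug hβ) r hr
    (AlgHom.id k A) (fun _ => rfl) (AddMonoidHom.id V) (fun _ _ => rfl)
    (fun a => by
      have := laurentAug_C_mul_T (k := k) a 0
      rw [T_zero, mul_one] at this
      exact this.symm)
    (fun v => by
      have := hrg 0 v
      rw [T_zero, one_smul] at this
      exact this.symm) 0
  replace h1 := h1.symm.trans (twistHomologyMap_id _ _ _ _ (fun _ => rfl) (fun _ => rfl) 0)
  exact Function.LeftInverse.injective fun x => LinearMap.congr_fun h1 x

end Assemble

end Laurent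

end Hochschild

/-! ### One-dimensional coefficients over Laurent polynomials. -/

namespace Hochschild

section CharBimoduleTwist

variable {k A : Type u} [Field k] [Ring A] [Algebra k A] (α β : A →ₐ[k] k)

/-- The identification of a one-dimensional bimodule with its underlying left module. -/
def CharBimodule.toTwist : CharBimodule α β →ₗ[k] Twist β (CharBimodule α β) where
  toFun v := (Twist.equiv β (CharBimodule α β)).symm v
  map_add' x y := rfl
  map_smul' c v := by
    change (c * equiv α β v : k) = α (algebraMap k A c) * equiv α β v
    rw [AlgHom.commutes]
    rfl

lemma CharBimodule.toTwist_bijective : Function.Bijective (toTwist α β) :=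
  Function.bijective_id

lemma CharBimodule.toTwist_op_smul (a : A) (m : CharBimodule α β) :
    toTwist α β (MulOpposite.op a • m) = MulOpposite.op a • toTwist α β m := by
  rw [Twist.op_smul, ← map_smul]
  rfl

/-- The map `H(A, M) → H(A, M)` given by the identification of `M` with a twisted module. -/
def charHomologyToTwist (l : ℕ) :
    homology k A (CharBimodule α β) l →ₗ[k] twistHomology β (CharBimodule α β) l :=
  homologyMap (AlgHom.id k A) (CharBimodule.toTwist α β) (fun _ _ => rfl)
    (CharBimodule.toTwist_op_smul α β) l

lemma charHomologyToTwist_bijective (l : ℕ) : Function.Bijective (charHomologyToTwist α β l) :=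
  homologyMap_bijective_of_bijective _ _ _ _ Function.bijective_id
    (CharBimodule.toTwist_bijective α β) l

/-- The identification of Hochschild homology with coefficients in a one-dimensional bimodule. -/
def charHomologyEquiv (l : ℕ) :
    homology k A (CharBimodule α β) l ≃ₗ[k] twistHomology β (CharBimodule α β) l :=
  LinearEquiv.ofBijective _ (charHomologyToTwist_bijective α β l)

end CharBimoduleTwist

section Laurent

open LaurentPolynomial

variable {k A : Type u} [Field k] [Ring A] [Algebra k A] (α β : A[T;T⁻¹] →ₐ[k] k)

/-- The Laurent polynomials over `k`, on which `A` acts through the character `α`. -/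
@[nolint unusedArguments]
def LaurentModule (_α : A[T;T⁻¹] →ₐ[k] k) : Type u := k[T;T⁻¹]

/-- The map of Laurent polynomials which applies a character to the coefficients. -/
def laurentMap : A[T;T⁻¹] →+* k[T;T⁻¹] :=
  AddMonoidAlgebra.mapRingHom ℤ (α.comp (laurentC k A) : A →+* k)

lemma laurentMap_C_mul_T (a : A) (i : ℤ) :
    laurentMap α (C a * T i) = C (α (C a)) * T i := by
  rw [← single_eq_C_mul_T, ← single_eq_C_mul_T]
  exact AddMonoidAlgebra.mapRingHom_single ..

lemma laurentMap_T (i : ℤ) : laurentMap α (T i) = T i := by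
  have := laurentMap_C_mul_T α 1 i
  simpa only [map_one, one_mul] using this

lemma laurentMap_C (a : A) : laurentMap α (C a) = C (α (C a)) := by
  have := laurentMap_C_mul_T α a 0
  simpa only [T_zero, mul_one] using this

instance : AddCommGroup (LaurentModule α) := inferInstanceAs (AddCommGroup k[T;T⁻¹])

instance : Module A[T;T⁻¹] (LaurentModule α) := Module.compHom k[T;T⁻¹] (laurentMap α)

/-- The inclusion of the constants in the Laurent polynomials. -/
def LaurentModule.const :
    CharBimodule (α.comp (laurentC k A)) (β.comp (laurentC k A)) →+ LaurentModule α :=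
  ((C : k →+* k[T;T⁻¹]) : k →+ k[T;T⁻¹])

/-- The assembling map is the identification of a finitely supported family of scalars with the
Laurent polynomial having these coefficients. -/
lemma LaurentModule.const_isLaurentExtension :
    IsLaurentExtension k A _ _ (LaurentModule.const α β) := by
  constructor
  · intro a v
    change C (α (C a) * CharBimodule.equiv _ _ v) = laurentMap α (C a) * C _
    rw [laurentMap_C, map_mul]
    rfl
  · have : ∀ f : ℤ →₀ k, laurentAssemble (A := A) (LaurentModule.const α β) f =
        AddMonoidAlgebra.ofCoeff f := by
      intro f
      induction f using Finsupp.induction_linear with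
      | zero => exact map_zero (laurentAssemble (A := A) (LaurentModule.const α β))
      | add x y hx hy =>
        refine (map_add (laurentAssemble (A := A) (LaurentModule.const α β)) _ _).trans ?_
        rw [hx, hy]
        rfl
      | single i c =>
        refine (laurentAssemble_single _ _ _).trans ?_
        change laurentMap α (T i) * C c = AddMonoidAlgebra.single i c
        rw [laurentMap_T, single_eq_C_mul_T, T_mul]
    exact Function.bijective_iff_has_inverse.2 ⟨AddMonoidAlgebra.coeff,
      fun f => congrArg AddMonoidAlgebra.coeff (this f), fun f => this _⟩

/-- Multiplication by `T - 1`. -/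
def LaurentModule.mulSubOne : LaurentModule α →ₗ[A[T;T⁻¹]] LaurentModule α where
  toFun := (fun w => (T 1 - 1) * w : k[T;T⁻¹] → k[T;T⁻¹])
  map_add' := mul_add (R := k[T;T⁻¹]) (T 1 - 1)
  map_smul' b := mul_left_comm (G := k[T;T⁻¹]) (T 1 - 1) (laurentMap α b)

lemma LaurentModule.mulSubOne_apply (w : LaurentModule α) :
    mulSubOne α w = (T 1 : A[T;T⁻¹]) • w - w := by
  have key : ∀ w : k[T;T⁻¹], (T 1 - 1) * w = laurentMap α (T 1) * w - w := by
    intro w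
    rw [laurentMap_T, sub_mul, one_mul]
  exact key w

lemma LaurentModule.mulSubOne_injective : Function.Injective (mulSubOne α) := by
  have h : (T 1 - 1 : k[T;T⁻¹]) ≠ 0 := by
    intro h
    have h' : (T 1 : k[T;T⁻¹]) = T 0 := by rw [T_zero, sub_eq_zero.1 h]
    have := congrArg (fun f => f.coeff 1) h'
    simp only [T_apply] at this
    norm_num at this
  intro x y hxy
  exact mul_right_injective₀ (M₀ := k[T;T⁻¹]) h hxy

variable (hα : ∀ i : ℤ, α (T i) = 1) (hβ : ∀ i : ℤ, β (T i) = 1)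

include hα in
lemma laurentAug_laurentMap (b : A[T;T⁻¹]) : laurentAug k k (laurentMap α b) = α b := by
  induction b using AddMonoidAlgebra.induction_linear with
  | zero => simp only [map_zero]
  | add x y hx hy => simp only [map_add, hx, hy]
  | single i a =>
    rw [single_eq_C_mul_T, laurentMap_C_mul_T, laurentAug_C_mul_T, map_mul, hα, mul_one]

/-- The evaluation of Laurent polynomials at `T = 1`. -/
def LaurentModule.aug : LaurentModule α →ₗ[A[T;T⁻¹]] CharBimodule α β where
  toFun w := laurentAug k k w
  map_add' x y := map_add (laurentAug k k) x y
  map_smul' b w := by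
    refine (map_mul (laurentAug k k) (laurentMap α b) w).trans ?_
    rw [laurentAug_laurentMap α hα]
    rfl

lemma LaurentModule.aug_surjective : Function.Surjective (aug α β hα) := fun c =>
  ⟨(C (show k from c) : k[T;T⁻¹]), by
    have := laurentAug_C_mul_T (k := k) (A := k) (show k from c) 0
    rw [T_zero, mul_one] at this
    exact this⟩

lemma T_sub_one_dvd_T_sub_one (i : ℤ) : (T 1 - 1 : k[T;T⁻¹]) ∣ T i - 1 := by
  have hnat : ∀ n : ℕ, (T 1 - 1 : k[T;T⁻¹]) ∣ T n - 1 := by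
    intro n
    have := sub_one_dvd_pow_sub_one (T 1 : k[T;T⁻¹]) n
    simpa only [T_pow, mul_one] using this
  obtain ⟨n, rfl | rfl⟩ := i.eq_nat_or_neg
  · exact hnat n
  · have h : (T (-n) - 1 : k[T;T⁻¹]) = (T n - 1) * -T (-n) := by
      rw [mul_neg, sub_mul, ← T_add, add_neg_cancel, T_zero, one_mul, neg_sub]
    rw [h]
    exact (hnat n).mul_right _

lemma LaurentModule.exact_mulSubOne_aug : Function.Exact (mulSubOne α) (aug α β hα) := by
  intro w
  constructor
  · intro hw
    -- The remainder theorem at T = 1: every f is congruent to f(1) modulo T − 1.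
    have key : ∀ f : k[T;T⁻¹], (T 1 - 1 : k[T;T⁻¹]) ∣ f - C (laurentAug k k f) := by
      intro f
      induction f using AddMonoidAlgebra.induction_linear with
      | zero => simp only [map_zero, sub_zero, dvd_zero]
      | add x y hx hy =>
        rw [map_add, map_add, add_sub_add_comm]
        exact dvd_add hx hy
      | single i c =>
        rw [single_eq_C_mul_T, laurentAug_C_mul_T, ← mul_sub_one]
        exact (T_sub_one_dvd_T_sub_one i).mul_left _
    have key' : ∀ f : k[T;T⁻¹], laurentAug k k f = 0 → (T 1 - 1 : k[T;T⁻¹]) ∣ f := by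
      intro f hf
      have := key f
      rwa [hf, map_zero, sub_zero] at this
    obtain ⟨v, hv⟩ := key' w hw
    exact ⟨v, hv.symm⟩
  · rintro ⟨v, rfl⟩
    refine (map_mul (laurentAug k k) (T 1 - 1) (id v : k[T;T⁻¹])).trans ?_
    have h1 := laurentAug_C_mul_T (k := k) (A := k) 1 1
    rw [map_one, one_mul] at h1
    rw [map_sub, map_one, h1, sub_self, zero_mul]
    rfl

include hβ in
-- The retraction r, which sets T = 1, kills every multiple of T − 1. On homology r is injective,
-- because the inclusion of the constants is bijective there and r is a left inverse of it. So T − 1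
-- is already zero before r is applied.
lemma LaurentModule.homologyMap_mulSubOne (l : ℕ) :
    twistHomologyMapOfLinear β (mulSubOne α) l = 0 := by
  have hext := LaurentModule.const_isLaurentExtension α β
  have hbij := hext.bijective hβ l
  obtain ⟨r, hr, hrg⟩ := hext.exists_retraction
  have hrT : ∀ w, r (mulSubOne α w) = 0 := by
    intro w
    rw [mulSubOne_apply, map_sub, hr]
    have := laurentAug_C_mul_T (k := k) (A := A) 1 1
    rw [map_one, one_mul] at this
    rw [this, one_smul, sub_self]
  have h1 := twistHomologyMap_comp (laurentC k A) (α := β.comp (laurentC k A)) (β := β)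
    (fun _ => rfl) _ hext.1 (laurentAug k A) (character_laurentC_laurentAug hβ) r hr
    (AlgHom.id k A) (fun _ => rfl) (AddMonoidHom.id _) (fun _ _ => rfl)
    (fun a => by
      have := laurentAug_C_mul_T (k := k) a 0
      rw [T_zero, mul_one] at this
      exact this.symm)
    (fun v => by
      have := hrg 0 v
      rw [T_zero, one_smul] at this
      exact this.symm) l
  replace h1 := h1.symm.trans (twistHomologyMap_id _ _ _ _ (fun _ => rfl) (fun _ => rfl) l)
  have hinj : Function.Injective
      (twistHomologyMap (laurentAug k A) (α := β) (β := β.comp (laurentC k A)) (character_laurentC_laurentAug hβ) r hr l) := by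
    intro x y hxy
    obtain ⟨x, rfl⟩ := hbij.2 x
    obtain ⟨y, rfl⟩ := hbij.2 y
    have hx := LinearMap.congr_fun h1 x
    have hy := LinearMap.congr_fun h1 y
    rw [LinearMap.comp_apply, LinearMap.id_apply] at hx hy
    rw [← hx, ← hy, hxy]
  have hrs : ∀ b w, (r.comp (mulSubOne α).toAddMonoidHom) (b • w) =
      laurentAug k A b • (r.comp (mulSubOne α).toAddMonoidHom) w := by
    intro b w
    change r (mulSubOne α (b • w)) = _ • r (mulSubOne α w)
    rw [map_smul, hr]
  have h2 := twistHomologyMap_comp (AlgHom.id k A[T;T⁻¹]) (α := β) (β := β)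
    (γ := β.comp (laurentC k A)) (fun _ => rfl)
    (mulSubOne α).toAddMonoidHom (mulSubOne α).map_smul (laurentAug k A)
    (character_laurentC_laurentAug hβ) r hr
    (laurentAug k A) (character_laurentC_laurentAug hβ)
    (r.comp (mulSubOne α).toAddMonoidHom) hrs (fun _ => rfl) (fun _ => rfl) l
  have h3 := twistHomologyMap_eq_zero (laurentAug k A) (α := β) (β := β.comp (laurentC k A))
    (character_laurentC_laurentAug hβ) (r.comp (mulSubOne α).toAddMonoidHom) hrs hrT l
  ext x
  refine hinj ?_
  have h4 := LinearMap.congr_fun (h2.symm.trans h3) x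
  rw [LinearMap.zero_apply, map_zero]
  exact h4

include hα hβ in
/-- The Hochschild homology of Laurent polynomials with coefficients in a one-dimensional
bimodule on which `T` acts by the identity. -/
theorem laurent_charHomology :
    Nonempty (homology k A[T;T⁻¹] (CharBimodule α β) 0 ≃ₗ[k]
      homology k A (CharBimodule (α.comp (laurentC k A)) (β.comp (laurentC k A))) 0) ∧
    ∀ l, Nonempty (homology k A[T;T⁻¹] (CharBimodule α β) (l + 1) ≃ₗ[k]
      homology k A (CharBimodule (α.comp (laurentC k A)) (β.comp (laurentC k A))) (l + 1) ×
      homology k A (CharBimodule (α.comp (laurentC k A)) (β.comp (laurentC k A))) l) := by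
  have hS := twistShortComplex_shortExact β (LaurentModule.mulSubOne_injective α)
    (LaurentModule.exact_mulSubOne_aug α β hα) (LaurentModule.aug_surjective α β hα)
  -- The long exact sequence of multiplication by T − 1 splits; both outer terms have coefficients
  -- k[T, T⁻¹], and `f` below replaces them by the homology of A in k.
  obtain ⟨⟨e₀⟩, he⟩ := homology_equiv_of_map_eq_zero hS fun l =>
    ModuleCat.hom_ext (LaurentModule.homologyMap_mulSubOne α β hβ l)
  have f : ∀ l, homology k A (CharBimodule (α.comp (laurentC k A)) (β.comp (laurentC k A))) l
      ≃ₗ[k] twistHomology β (LaurentModule α) l := fun l =>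
    (charHomologyEquiv _ _ l).trans (LinearEquiv.ofBijective _
      ((LaurentModule.const_isLaurentExtension α β).bijective hβ l))
  refine ⟨⟨(charHomologyEquiv α β 0).trans (e₀.trans (f 0).symm)⟩, fun l => ?_⟩
  obtain ⟨e⟩ := he l
  exact ⟨(charHomologyEquiv α β (l + 1)).trans
    (e.trans (LinearEquiv.prodCongr (f (l + 1)) (f l)).symm)⟩

end Laurent

end Hochschild

/-! ### Inverting a central element that the right character sends to 1. -/

namespace Hochschild

section Localization

open Polynomial

variable {k A B : Type u} [Field k] [Ring A] [Algebra k A] [Ring B] [Algebra k B]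

section FreePolynomial

variable (α : A →ₐ[k] k) (X' : Type u)

/-- Coefficientwise application of a character to a family of polynomials. -/
def polyChar : (X' →₀ A[X]) →+ (X' →₀ k[X]) :=
  Finsupp.mapRange.addMonoidHom (Polynomial.mapRingHom (α : A →+* k) : A[X] →+ k[X])

lemma polyChar_apply (v : X' →₀ A[X]) (x : X') :
    polyChar α X' v x = (v x).map (α : A →+* k) := rfl

lemma polyChar_smul (a : A) (v : X' →₀ A[X]) :
    polyChar α X' (a • v) = α a • polyChar α X' v := by
  ext x : 1
  rw [polyChar_apply, Finsupp.smul_apply, Finsupp.smul_apply, polyChar_apply,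
    Polynomial.smul_eq_C_mul, Polynomial.map_mul, Polynomial.map_C, Polynomial.smul_eq_C_mul]
  rfl

/-- Degree 0 of a sum of copies of A[X] is the sum of copies of k[X]: modulo commutators, a
coefficient a may be replaced by α(a). -/
lemma mem_twistCommutators_iff_polyChar (v : Twist α (X' →₀ A[X])) :
    v ∈ twistCommutators α (X' →₀ A[X]) ↔ polyChar α X' (Twist.equiv α _ v) = 0 := by
  constructor
  · intro hv
    induction hv using Submodule.span_induction with
    | mem x hx =>
      obtain ⟨a, m, rfl⟩ := hx
      rw [map_sub, map_sub, Twist.equiv_op_smul, Twist.equiv_smul, polyChar_smul, polyChar_smul,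
        AlgHom.commutes, Algebra.algebraMap_self_apply, sub_self]
    | zero => rw [map_zero, map_zero]
    | add x y _ _ hx hy => rw [map_add, map_add, hx, hy, add_zero]
    | smul c x _ hx => rw [Twist.equiv_scalar_smul, polyChar_smul, hx, smul_zero]
  · intro hv
    let ι : (X' →₀ k[X]) →+ (X' →₀ A[X]) :=
      Finsupp.mapRange.addMonoidHom (Polynomial.mapRingHom (algebraMap k A) : k[X] →+ A[X])
    have key : ∀ v : X' →₀ A[X], (Twist.equiv α _).symm v -
        (Twist.equiv α _).symm (ι (polyChar α X' v)) ∈ twistCommutators α (X' →₀ A[X]) := by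
      intro v
      induction v using Finsupp.induction_linear with
      | zero => simp only [map_zero, sub_zero, Submodule.zero_mem]
      | add x y hx hy =>
        have := Submodule.add_mem _ hx hy
        rw [sub_add_sub_comm] at this
        simp only [map_add]
        exact this
      | single x p =>
        induction p using Polynomial.induction_on' with
        | add p q hp hq =>
          have := Submodule.add_mem _ hp hq
          rw [sub_add_sub_comm] at this
          simp only [Finsupp.single_add, map_add]
          exact this
        | monomial n a =>
          have := Submodule.neg_mem _ (sub_mem_twistCommutators (α := α) a
            ((Twist.equiv α (X' →₀ A[X])).symm (Finsupp.single x (monomial n 1))))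
          rw [neg_sub] at this
          have h1 : Finsupp.single x (monomial n a) = a • Finsupp.single x (monomial n (1 : A)) := by
            rw [Finsupp.smul_single, smul_monomial, smul_eq_mul, mul_one]
          have h2 : ι (polyChar α X' (Finsupp.single x (monomial n a))) =
              algebraMap k A (α a) • Finsupp.single x (monomial n (1 : A)) := by
            rw [Finsupp.smul_single, smul_monomial, smul_eq_mul, mul_one]
            simp [ι, polyChar]
          rw [h2, h1]
          exact this
    have := key (Twist.equiv α _ v)
    rw [hv, map_zero, map_zero, sub_zero] at this
    exact this

end FreePolynomial

variable {D : A} (hD : ∀ a, Commute D a) {ψ : A[X] →ₐ[k] B}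

/-- Multiplication of polynomials by `X D - 1`. -/
def mulXSubOne (hD : ∀ a, Commute D a) : A[X] →ₗ[A] A[X] where
  toFun p := (X * C D - 1) * p
  map_add' := mul_add _
  map_smul' a p := by
    rw [RingHom.id_apply, smul_eq_C_mul, smul_eq_C_mul, ← mul_assoc, ← mul_assoc]
    congr 1
    rw [sub_mul, mul_sub, mul_assoc, ← C_mul, (hD a).eq, C_mul, ← mul_assoc, X_mul_C, mul_assoc,
      one_mul, mul_one]

/-- If p = X D p then the constant coefficient vanishes and each coefficient is D times the previous
one, so all vanish, even when D is a zero divisor. -/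
lemma mulXSubOne_injective : Function.Injective (mulXSubOne hD) := by
  rw [injective_iff_map_eq_zero]
  intro p hp
  have hp' : p = X * C D * p := by
    have : (X * C D - 1) * p = 0 := hp
    rw [sub_mul, one_mul, sub_eq_zero] at this
    exact this.symm
  have h : ∀ n, p.coeff n = 0 := by
    intro n
    induction n with
    | zero => rw [hp', mul_assoc, coeff_X_mul_zero]
    | succ n ih => rw [hp', mul_assoc, coeff_X_mul, coeff_C_mul, ih, mul_zero]
  ext n
  rw [h, coeff_zero]

/-- A module with scalars restricted along an algebra homomorphism. -/
abbrev restrict (φ : A →ₐ[k] B) (W : Type u) [AddCommGroup W] [Module B W] : ModuleCat.{u} A :=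
  (ModuleCat.restrictScalars (φ : A →+* B)).obj (ModuleCat.of B W)

variable (hψ : ψ (X * C D) = 1) (hker : ∀ p, ψ p = 0 → ∃ r, p = (X * C D - 1) * r)
  (hsurj : Function.Surjective ψ)

include hD hψ hker hsurj in
-- Multiplication by X D − 1 on copies of the free A-module A[X] resolves the free B-module in two
-- steps. On degree 0 homology it becomes multiplication by X − 1 on copies of k[X], as α(D) = 1.
-- This is injective, so no homology is left in positive degrees.
lemma subsingleton_twistHomology_restrict {α : A →ₐ[k] k} (hα : α D = 1) (X' : Type u) (l : ℕ) :
    Subsingleton (twistHomology α (restrict (ψ.comp CAlgHom) (X' →₀ B)) (l + 1)) := by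
  let f : (X' →₀ A[X]) →ₗ[A] (X' →₀ A[X]) := Finsupp.mapRange.linearMap (mulXSubOne hD)
  let g : (X' →₀ A[X]) →ₗ[A] restrict (ψ.comp CAlgHom) (X' →₀ B) :=
    { toFun := Finsupp.mapRange.addMonoidHom (ψ : A[X] →+ B)
      map_add' := map_add _
      map_smul' := fun a v => by
        change _ = (ψ (C a)) • (Finsupp.mapRange.addMonoidHom (ψ : A[X] →+ B) v : X' →₀ B)
        ext x
        change ψ ((a • v) x) = ψ (C a) * ψ (v x)
        rw [Finsupp.smul_apply, smul_eq_C_mul, map_mul] }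
  have hf : Function.Injective f := Finsupp.mapRange_injective _ (map_zero _)
    (mulXSubOne_injective hD)
  have hg : Function.Surjective g := Finsupp.mapRange_surjective _ (map_zero _) hsurj
  have hfg : Function.Exact f g := by
    intro v
    constructor
    · intro hv
      classical
      have hv0 : Finsupp.mapRange.addMonoidHom (ψ : A[X] →+ B) v = 0 := hv
      have hv' : ∀ x, ∃ r, v x = (X * C D - 1) * r := fun x =>
        hker _ (DFunLike.congr_fun hv0 x)
      choose r hr using hv'
      -- The chosen quotient `r x` need not vanish where `v x` does; the value 0 there keeps the
      -- support finite.
      refine ⟨Finsupp.onFinset v.support (fun x => if v x = 0 then 0 else r x)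
        (fun x hx => ?_), ?_⟩
      · rw [Finsupp.mem_support_iff]
        exact fun h => hx (if_pos h)
      · ext x : 1
        change (X * C D - 1) * (if v x = 0 then 0 else r x) = v x
        split_ifs with h
        · rw [mul_zero, h]
        · exact (hr x).symm
    · rintro ⟨v, rfl⟩
      refine Finsupp.ext fun x => ?_
      change ψ ((X * C D - 1) * v x) = 0
      rw [map_mul, map_sub, hψ, map_one, sub_self, zero_mul]
  have hS := twistShortComplex_shortExact α hf hfg hg
  have hfree := subsingleton_twistHomology_of_free α (X' →₀ A[X])
  have hinj : ∀ l, Function.Injective (twistHomologyMapOfLinear α f l) := by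
    intro l
    cases l with
    | zero =>
      refine twistHomologyMap_zero_injective _ _ _ _ fun v hv => ?_
      rw [mem_twistCommutators_iff_polyChar] at hv ⊢
      ext x : 1
      have h := DFunLike.congr_fun hv x
      have h' : ((X * C D - 1) * (Twist.equiv α _ v) x).map (α : A →+* k) = 0 := h
      rw [Polynomial.map_mul, Polynomial.map_sub, Polynomial.map_mul, map_X, map_C,
        Polynomial.map_one] at h'
      have hα' : (α : A →+* k) D = 1 := hα
      rw [hα', C_1, mul_one, mul_eq_zero] at h'
      exact h'.resolve_left (X_sub_C_ne_zero 1)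
    | succ l => exact fun x y _ => (hfree l).elim x y
  have hex := hS.exactAt_X₃ (l + 1)
    ((epi_twist_iff (α := α) (β := α) _ (fun _ => rfl) _ f.map_smul _).2
      fun x => ⟨0, (hfree l).elim _ _⟩)
    (fun j hj => (mono_twist_iff (α := α) (β := α) _ (fun _ => rfl) _ f.map_smul _).2 (hinj j))
  rw [HomologicalComplex.exactAt_iff_isZero_homology] at hex
  exact ModuleCat.subsingleton_of_isZero hex

include hψ hsurj in
-- V and W have the same elements, so the point is that B has no more commutators than A. The b in B
-- whose commutators lie in the image of those of A are closed under sums and products, contain the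
-- image of A, and contain the inverse of D.
lemma twistHomologyMap_localization_zero {α : A →ₐ[k] k} {β : B →ₐ[k] k}
    (hβ : ∀ a, β (ψ.comp CAlgHom a) = α a) (hα : α D = 1)
    {V W : Type u} [AddCommGroup V] [Module A V] [AddCommGroup W] [Module B W]
    (g : V →+ W) (hg : ∀ a v, g (a • v) = ψ.comp CAlgHom a • g v) (hg' : Function.Bijective g) :
    Function.Bijective (twistHomologyMap (ψ.comp CAlgHom) hβ g hg 0) := by
  constructor
  · let N : Submodule k (Twist β W) :=
      (twistCommutators α V).map (twistMap (ψ.comp CAlgHom) α β g hg)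
    have hC : ∀ a (w : Twist β W), β (ψ (C a)) • w - ψ (C a) • w ∈ N := by
      intro a w
      obtain ⟨v, rfl⟩ : ∃ v, twistMap (ψ.comp CAlgHom) α β g hg v = w := hg'.2 w
      refine ⟨_, sub_mem_twistCommutators (α := α) a v, ?_⟩
      rw [map_sub, map_smul, ← hβ]
      congr 1
      exact hg a v
    have hβX : β (ψ X) = 1 := by
      have := congrArg β hψ
      rw [map_mul, map_mul, map_one] at this
      have h : β (ψ (C D)) = 1 := (hβ D).trans hα
      rwa [h, mul_one] at this
    -- For t inverse to D, the commutator of t at w is minus that of D at t w, since both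
    -- characters' values are 1.
    have hX : ∀ w : Twist β W, β (ψ X) • w - ψ X • w ∈ N := by
      intro w
      have := Submodule.neg_mem _ (hC D (ψ X • w))
      have h : β (ψ (C D)) = 1 := (hβ D).trans hα
      rw [h, one_smul, smul_smul, ← map_mul, ← X_mul_C, hψ, one_smul, neg_sub] at this
      rwa [hβX, one_smul]
    have hmul : ∀ b c : B, (∀ w : Twist β W, β b • w - b • w ∈ N) →
        (∀ w : Twist β W, β c • w - c • w ∈ N) → ∀ w : Twist β W,
        β (b * c) • w - (b * c) • w ∈ N := by
      intro b c hb hc w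
      have := Submodule.add_mem _ (hb (c • w)) (Submodule.smul_mem _ (β b) (hc w))
      rw [smul_sub, smul_smul, smul_smul, ← map_mul, sub_add_sub_comm, add_comm, sub_eq_add_neg]
        at this
      convert this using 1
      abel
    have hall : ∀ (p : A[X]) (w : Twist β W), β (ψ p) • w - ψ p • w ∈ N := by
      intro p
      induction p using Polynomial.induction_on with
      | C a => exact hC a
      | add p q hp hq =>
        intro w
        have := Submodule.add_mem _ (hp w) (hq w)
        rwa [sub_add_sub_comm, ← add_smul, ← add_smul, ← map_add, ← map_add] at this
      | monomial n a h =>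
        rw [pow_succ, ← mul_assoc, map_mul]
        exact hmul _ _ h hX
    refine twistHomologyMap_zero_injective _ _ _ _ fun v hv => ?_
    have hle : twistCommutators β W ≤ N := by
      rw [twistCommutators, commutators, Submodule.span_le]
      rintro _ ⟨b, w, rfl⟩
      obtain ⟨p, rfl⟩ := hsurj b
      exact hall p w
    obtain ⟨v', hv', h⟩ := hle hv
    have : v' = v := hg'.1 h
    rwa [← this]
  · refine twistHomologyMap_zero_surjective _ _ _ _ fun w => ?_
    obtain ⟨v, hv⟩ : ∃ v, twistMap (ψ.comp CAlgHom) α β g hg v = w := hg'.2 w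
    exact ⟨v, by rw [hv, sub_self]; exact Submodule.zero_mem _⟩

include hD hψ hker hsurj in
/-- The Hochschild homology with twisted coefficients is invariant under central localization. -/
theorem twistHomologyMap_localization {α : A →ₐ[k] k} {β : B →ₐ[k] k}
    (hβ : ∀ a, β (ψ.comp CAlgHom a) = α a) (hα : α D = 1) (l : ℕ)
    {V W : Type u} [AddCommGroup V] [Module A V] [AddCommGroup W] [Module B W]
    (g : V →+ W) (hg : ∀ a v, g (a • v) = ψ.comp CAlgHom a • g v) (hg' : Function.Bijective g) :
    Function.Bijective (twistHomologyMap (ψ.comp CAlgHom) hβ g hg l) := by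
  refine twistHomologyMap_bijective_of_covers (ψ.comp CAlgHom) hβ
    (fun V W _ _ _ _ g => (∀ a v, g (a • v) = ψ.comp CAlgHom a • g v) ∧ Function.Bijective g)
    (fun V W _ _ _ _ g h => h.1)
    (fun V W _ _ _ _ g h => twistHomologyMap_localization_zero hψ hsurj hβ hα g h.1 h.2)
    ?_ l V W g ⟨hg, hg'⟩
  intro V W _ _ _ _ g ⟨hg, hg'⟩
  -- The same free B-module covers both sides, being also acyclic over A; the maps of covers and of
  -- kernels are then identities on elements.
  let p' : (W →₀ B) →ₗ[B] W := Finsupp.linearCombination B id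
  let e := AddEquiv.ofBijective g hg'
  have he : ∀ w, g (e.symm w) = w := e.apply_symm_apply
  have hes : ∀ a w, e.symm (ψ.comp CAlgHom a • w) = a • e.symm w := by
    intro a w
    apply hg'.1
    rw [he, hg, he]
  have hp' : Function.Surjective p' := fun w => ⟨Finsupp.single w 1, by
    simp only [p', Finsupp.linearCombination_single, id, one_smul]⟩
  let p : restrict (ψ.comp CAlgHom) (W →₀ B) →ₗ[A] V :=
    { toFun := fun m => e.symm (p' m)
      map_add' := fun x y => (congrArg e.symm (p'.map_add x y)).trans (map_add e.symm _ _)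
      map_smul' := fun a m => (congrArg e.symm (p'.map_smul (ψ.comp CAlgHom a) m)).trans
        (hes a (p' m)) }
  let j : restrict (ψ.comp CAlgHom) (W →₀ B) →+ (W →₀ B) := AddMonoidHom.id (W →₀ B)
  have hpj : ∀ m, p' (j m) = g (p m) := fun m => (he _).symm
  let j' : LinearMap.ker p →+ LinearMap.ker p' :=
    { toFun := fun m => ⟨j m.1, by rw [LinearMap.mem_ker, hpj, m.2, map_zero]⟩
      map_zero' := rfl
      map_add' := fun x y => rfl }
  refine ⟨restrict (ψ.comp CAlgHom) (W →₀ B), ModuleCat.of B (W →₀ B), p, p', j, j',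
    e.symm.surjective.comp hp', hp', hpj, fun m => rfl, ⟨fun a m => rfl, Function.bijective_id⟩,
    ⟨fun a m => rfl, ?_, ?_⟩,
    fun l => subsingleton_twistHomology_restrict hD hψ hker hsurj hα W l,
    fun l => subsingleton_twistHomology_of_free _ _ l⟩
  · intro x y hxy
    exact Subtype.ext (congrArg (fun z : LinearMap.ker p' => z.1) hxy)
  · rintro ⟨m, hm⟩
    refine ⟨⟨m, ?_⟩, rfl⟩
    exact (congrArg e.symm hm).trans (map_zero e.symm)

include hD hψ hker hsurj in
/-- The Hochschild homology with one-dimensional coefficients is invariant under central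
localization. -/
theorem homologyMap_localization {α₀ β₀ : A →ₐ[k] k} {α β : B →ₐ[k] k}
    (hβ : ∀ a, β (ψ.comp CAlgHom a) = β₀ a) (hβ₀ : β₀ D = 1)
    (g : CharBimodule α₀ β₀ →ₗ[k] CharBimodule α β) (hg : Function.Bijective g)
    (hl : ∀ a m, g (a • m) = ψ.comp CAlgHom a • g m)
    (hr : ∀ a m, g (MulOpposite.op a • m) = MulOpposite.op (ψ.comp CAlgHom a) • g m) (l : ℕ) :
    Function.Bijective (homologyMap (ψ.comp CAlgHom) g hl hr l) := by
  have h := twistHomologyMap_localization hD hψ hker hsurj hβ hβ₀ l g.toAddMonoidHom hl hg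
  have h1 := homologyMap_comp (ψ.comp CAlgHom) g hl hr (AlgHom.id k B)
    (CharBimodule.toTwist α β) (fun _ _ => rfl) (CharBimodule.toTwist_op_smul α β)
    (ψ.comp CAlgHom) (CharBimodule.toTwist α β ∘ₗ g) hl
    (fun a m => by
      rw [LinearMap.comp_apply, hr, CharBimodule.toTwist_op_smul]
      rfl) (fun _ => rfl) (fun _ => rfl) l
  have h2 := homologyMap_comp (AlgHom.id k A) (CharBimodule.toTwist α₀ β₀) (fun _ _ => rfl)
    (CharBimodule.toTwist_op_smul α₀ β₀) (ψ.comp CAlgHom)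
    (twistMap (ψ.comp CAlgHom) β₀ β g.toAddMonoidHom hl) hl
    (fun a v => by rw [Twist.op_smul, Twist.op_smul, map_smul, hβ])
    (ψ.comp CAlgHom) (CharBimodule.toTwist α β ∘ₗ g) hl
    (fun a m => by
      rw [LinearMap.comp_apply, hr, CharBimodule.toTwist_op_smul]
      rfl) (fun _ => rfl) (fun _ => rfl) l
  have h3 : ⇑(charHomologyToTwist α β l) ∘ homologyMap (ψ.comp CAlgHom) g hl hr l =
      twistHomologyMap (ψ.comp CAlgHom) hβ g.toAddMonoidHom hl l ∘ charHomologyToTwist α₀ β₀ l :=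
    congrArg DFunLike.coe (h1.symm.trans h2)
  refine (Function.Bijective.of_comp_iff' (charHomologyToTwist_bijective α β l) _).1 ?_
  rw [h3]
  exact h.comp (charHomologyToTwist_bijective α₀ β₀ l)

end Localization

end Hochschild

/-! ### Quantum matrices, the isomorphism of GL_q(n) with SL_q(n)[T, T⁻¹], and the localization
M_q(n) → GL_q(n). -/

namespace Quantum

section QuantumMatrices

variable {k : Type u} [Field k] (q : kˣ) {R : Type u} [Ring R] [Algebra k R]

/-- The relations of quantum matrices, for a rectangular matrix. -/
structure IsQMatrix {m n : ℕ} (y : Fin m → Fin n → R) : Prop where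
  col : ∀ (i j : Fin m) (l : Fin n), i < j → y j l * y i l = (q : k) • (y i l * y j l)
  row : ∀ (l : Fin m) (i j : Fin n), i < j → y l j * y l i = (q : k) • (y l i * y l j)
  anti : ∀ (r l : Fin m) (i j : Fin n), r < l → i < j → y l i * y r j = y r j * y l i
  diag : ∀ (r l : Fin m) (i j : Fin n), r < l → i < j →
    y r i * y l j - y l j * y r i = ((q⁻¹ : kˣ) - (q : k) : k) • (y r j * y l i)

variable {q}

lemma IsQMatrix.map {m n : ℕ} {y : Fin m → Fin n → R} (h : IsQMatrix q y) {S : Type u} [Ring S]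
    [Algebra k S] (f : R →ₐ[k] S) : IsQMatrix q fun i j => f (y i j) where
  col i j l hij := by rw [← map_mul, ← map_mul, ← map_smul, h.col i j l hij]
  row l i j hij := by rw [← map_mul, ← map_mul, ← map_smul, h.row l i j hij]
  anti r l i j hrl hij := by rw [← map_mul, ← map_mul, h.anti r l i j hrl hij]
  diag r l i j hrl hij := by
    rw [← map_mul, ← map_mul, ← map_mul, ← map_sub, ← map_smul, h.diag r l i j hrl hij]

/-- Multiplication of the rows by central elements preserves the relations. -/
lemma IsQMatrix.mul_rows {m n : ℕ} {y : Fin m → Fin n → R} (h : IsQMatrix q y) (z : Fin m → R)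
    (hz : ∀ i a, Commute (z i) a) : IsQMatrix q fun i j => z i * y i j := by
  have key : ∀ i j (a b : R), z i * a * (z j * b) = z i * z j * (a * b) := by
    intro i j a b
    rw [mul_assoc, mul_assoc, ← mul_assoc a, ← (hz j a).eq, mul_assoc]
  have hzz : ∀ i j, z j * z i = z i * z j := fun i j => hz j (z i)
  constructor
  · intro i j l hij
    rw [key, key, h.col i j l hij, mul_smul_comm, hzz]
  · intro l i j hij
    rw [key, key, h.row l i j hij, mul_smul_comm]
  · intro r l i j hrl hij
    rw [key, key, h.anti r l i j hrl hij, hzz]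
  · intro r l i j hrl hij
    rw [key, key, key, hzz r l, ← mul_sub, h.diag r l i j hrl hij, mul_smul_comm]

variable (q) in
/-- The quantum determinant of a square matrix. -/
def qdetOf {n : ℕ} (y : Fin n → Fin n → R) : R :=
  ∑ σ : Equiv.Perm (Fin n), (-((q⁻¹ : kˣ) : k)) ^ permLength σ •
    (List.ofFn fun i : Fin n => y i (σ i)).prod

lemma qdet_eq_qdetOf (n : ℕ) : qdet q n = qdetOf q (QMat.x q) := rfl

lemma map_qdetOf {n : ℕ} (y : Fin n → Fin n → R) {S : Type u} [Ring S]
    [Algebra k S] (f : R →ₐ[k] S) : f (qdetOf q y) = qdetOf q fun i j => f (y i j) := by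
  rw [qdetOf, map_sum, qdetOf]
  refine Finset.sum_congr rfl fun σ _ => ?_
  rw [map_smul, map_list_prod, List.map_ofFn]
  rfl

/-- Each monomial has exactly one factor from the first row, and it stands leftmost; hence z comes
out without any commutation. -/
lemma qdetOf_mul_first_row {n : ℕ} (y : Fin (n + 1) → Fin (n + 1) → R) (z : R) :
    qdetOf q (fun i j => (if i = 0 then z else 1) * y i j) = z * qdetOf q y := by
  rw [qdetOf, qdetOf, Finset.mul_sum]
  refine Finset.sum_congr rfl fun σ _ => ?_
  rw [mul_smul_comm, List.ofFn_succ, List.ofFn_succ, List.prod_cons, List.prod_cons, if_pos rfl,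
    mul_assoc]
  congr 4
  refine congrArg List.ofFn (funext fun i => ?_)
  rw [if_neg (Fin.succ_ne_zero i), one_mul]

lemma QMat.isQMatrix (n : ℕ) : IsQMatrix q (QMat.x q (n := n)) := by
  have key : ∀ {a b}, MatrixRel q n a b → QMat.mk q n a = QMat.mk q n b := fun h =>
    RingQuot.mkAlgHom_rel k h
  constructor
  · intro i j l hij
    simpa only [QMat.x, map_mul, map_smul] using key (MatrixRel.col i j l hij)
  · intro l i j hij
    simpa only [QMat.x, map_mul, map_smul] using key (MatrixRel.row i j l hij)
  · intro r l i j hrl hij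
    simpa only [QMat.x, map_mul, map_smul] using key (MatrixRel.anti r l i j hrl hij)
  · intro r l i j hrl hij
    simpa only [QMat.x, map_mul, map_smul, map_sub] using key (MatrixRel.diag r l i j hrl hij)

/-- The homomorphism from `M_q(n)` given by a quantum matrix. -/
def QMat.lift {n : ℕ} (y : Fin n → Fin n → R) (h : IsQMatrix q y) : QMat q n →ₐ[k] R :=
  RingQuot.liftAlgHom k ⟨FreeAlgebra.lift k fun p => y p.1 p.2, by
    have key : ∀ i j, FreeAlgebra.lift k (fun p : Fin n × Fin n => y p.1 p.2) (gen k i j) = y i j :=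
      fun i j => FreeAlgebra.lift_ι_apply _ _
    intro a b hab
    cases hab with
    | col i j l hij => simp only [map_mul, map_smul, key, h.col i j l hij]
    | row i j l hij => simp only [map_mul, map_smul, key, h.row l i j hij]
    | anti r l i j hrl hij => simp only [map_mul, key, h.anti r l i j hrl hij]
    | diag r l i j hrl hij =>
      simp only [map_mul, map_smul, map_sub, key, h.diag r l i j hrl hij]⟩

lemma QMat.lift_x {n : ℕ} (y : Fin n → Fin n → R) (h : IsQMatrix q y) (i j : Fin n) :
    QMat.lift y h (QMat.x q i j) = y i j :=
  (RingQuot.liftAlgHom_mkAlgHom_apply k _ _ _).trans (FreeAlgebra.lift_ι_apply _ _)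

lemma QMat.algHom_ext {n : ℕ} {f g : QMat q n →ₐ[k] R}
    (h : ∀ i j, f (QMat.x q i j) = g (QMat.x q i j)) : f = g :=
  RingQuot.ringQuot_ext' k _ _ (FreeAlgebra.hom_ext (funext fun p => h p.1 p.2))

lemma QSL.algHom_ext {n : ℕ} {f g : QSL q n →ₐ[k] R}
    (h : ∀ i j, f (QSL.ofMat q n (QMat.x q i j)) = g (QSL.ofMat q n (QMat.x q i j))) : f = g :=
  RingQuot.ringQuot_ext' k _ _ (QMat.algHom_ext h)

lemma QGL.algHom_ext {n : ℕ} {f g : QGL q n →ₐ[k] R}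
    (h : ∀ i j, f (QGL.ofMat q n (QMat.x q i j)) = g (QGL.ofMat q n (QMat.x q i j)))
    (hX : f (QGL.mk q n Polynomial.X) = g (QGL.mk q n Polynomial.X)) : f = g := by
  refine RingQuot.ringQuot_ext' k _ _ ?_
  have h0 : (f.comp (QGL.mk q n)).comp Polynomial.CAlgHom =
      (g.comp (QGL.mk q n)).comp Polynomial.CAlgHom := QMat.algHom_ext h
  have h1 : ∀ p, f (QGL.mk q n p) = g (QGL.mk q n p) := ?_
  · exact AlgHom.ext h1
  intro p
  induction p using Polynomial.induction_on with
  | C a => exact AlgHom.congr_fun h0 a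
  | add p r hp hr => rw [map_add, map_add, map_add, hp, hr]
  | monomial m a hm =>
    have h2 := map_mul (QGL.mk q n) (Polynomial.C a * Polynomial.X ^ m) Polynomial.X
    rw [pow_succ, ← mul_assoc, h2, map_mul f, map_mul g, hm, hX]

end QuantumMatrices

section Decomposition

open LaurentPolynomial

variable {k : Type u} [Field k] (q : kˣ) (n : ℕ)

lemma QGL.mk_surjective : Function.Surjective (QGL.mk q n) := RingQuot.mkAlgHom_surjective k _

lemma QGL.mk_X_mul_det : QGL.mk q n (Polynomial.X * Polynomial.C (qdet q n)) = 1 :=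
  (RingQuot.mkAlgHom_rel k GLRel.inv).trans (map_one _)

lemma QGL.t_mul_det : QGL.mk q n Polynomial.X * QGL.ofMat q n (qdet q n) = 1 :=
  (map_mul _ _ _).symm.trans (QGL.mk_X_mul_det q n)

lemma QGL.commute_t (a : QGL q n) : Commute (QGL.mk q n Polynomial.X) a := by
  obtain ⟨p, rfl⟩ := QGL.mk_surjective q n a
  exact (Polynomial.commute_X p).map (QGL.mk q n)

/-- The quantum determinant as a unit of `GL_q(n)`. -/
def QGL.detUnit : (QGL q n)ˣ where
  val := QGL.ofMat q n (qdet q n)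
  inv := QGL.mk q n Polynomial.X
  val_inv := (QGL.commute_t q n _).eq.symm.trans (QGL.t_mul_det q n)
  inv_val := QGL.t_mul_det q n

lemma QGL.commute_detUnit_zpow (a : QGL q n) (i : ℤ) :
    Commute a ((QGL.detUnit q n ^ i : (QGL q n)ˣ) : QGL q n) := by
  have h : Commute a ((QGL.detUnit q n : (QGL q n)ˣ) : QGL q n) :=
    ((Commute.units_inv_left_iff (u := QGL.detUnit q n)).1 (QGL.commute_t q n a)).symm
  exact h.units_zpow_right i

lemma QSL.det_eq_one : QSL.ofMat q n (qdet q n) = 1 :=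
  (RingQuot.mkAlgHom_rel k SLRel.det).trans (map_one _)

/-- The matrix of generators with its first row multiplied by `T`. -/
def toLaurentMatrix (i j : Fin (n + 1)) : (QSL q (n + 1))[T;T⁻¹] :=
  (if i = 0 then T 1 else 1) * Hochschild.laurentC k _ (QSL.ofMat q (n + 1) (QMat.x q i j))

lemma toLaurentMatrix_isQMatrix : IsQMatrix q (toLaurentMatrix q n) := by
  refine IsQMatrix.mul_rows (((QMat.isQMatrix (n + 1)).map (QSL.ofMat q (n + 1))).map
    (Hochschild.laurentC k _)) (fun i => if i = 0 then T 1 else 1) fun i a => ?_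
  split_ifs
  · exact commute_T 1 a
  · exact Commute.one_left a

/-- The homomorphism `M_q(n) → SL_q(n)[T, T⁻¹]` which multiplies the first row by `T`. -/
def QMat.toLaurent : QMat q (n + 1) →ₐ[k] (QSL q (n + 1))[T;T⁻¹] :=
  QMat.lift (toLaurentMatrix q n) (toLaurentMatrix_isQMatrix q n)

/-- Scaling one row by T scales D by T, and D = 1 in SL_q(n). Thus T plays the role of D, and
GL_q(n) maps to the Laurent polynomials with t ↦ T⁻¹. -/
lemma QMat.toLaurent_qdet : QMat.toLaurent q n (qdet q (n + 1)) = T 1 := by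
  have h : (fun i j => QMat.toLaurent q n (QMat.x q i j)) = toLaurentMatrix q n :=
    funext fun i => funext fun j => QMat.lift_x _ _ i j
  rw [qdet_eq_qdetOf, map_qdetOf, h]
  refine (qdetOf_mul_first_row _ _).trans ?_
  rw [← map_qdetOf, ← map_qdetOf, ← qdet_eq_qdetOf, QSL.det_eq_one, map_one, mul_one]

/-- The homomorphism `GL_q(n) → SL_q(n)[T, T⁻¹]`. -/
def QGL.toLaurent : QGL q (n + 1) →ₐ[k] (QSL q (n + 1))[T;T⁻¹] :=
  RingQuot.liftAlgHom k ⟨Polynomial.eval₂AlgHom (QMat.toLaurent q n) (T (-1))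
    fun a => (commute_T _ _).symm, by
    rintro _ _ ⟨⟩
    rw [map_mul, map_one]
    change Polynomial.eval₂ _ _ Polynomial.X * Polynomial.eval₂ _ _ (Polynomial.C _) = 1
    rw [Polynomial.eval₂_X, Polynomial.eval₂_C]
    change T (-1) * QMat.toLaurent q n _ = 1
    rw [QMat.toLaurent_qdet, ← T_add, neg_add_cancel, T_zero]⟩

lemma QGL.toLaurent_ofMat (a : QMat q (n + 1)) :
    QGL.toLaurent q n (QGL.ofMat q (n + 1) a) = QMat.toLaurent q n a :=
  (RingQuot.liftAlgHom_mkAlgHom_apply k _ _ _).trans (Polynomial.eval₂_C _ _)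

lemma QGL.toLaurent_X : QGL.toLaurent q n (QGL.mk q (n + 1) Polynomial.X) = T (-1) :=
  (RingQuot.liftAlgHom_mkAlgHom_apply k _ _ _).trans (Polynomial.eval₂_X _ _)

/-- The matrix of generators of `GL_q(n)` with its first row divided by the determinant. -/
def ofLaurentMatrix (i j : Fin (n + 1)) : QGL q (n + 1) :=
  (if i = 0 then QGL.mk q (n + 1) Polynomial.X else 1) * QGL.ofMat q (n + 1) (QMat.x q i j)

lemma ofLaurentMatrix_isQMatrix : IsQMatrix q (ofLaurentMatrix q n) := by
  refine IsQMatrix.mul_rows ((QMat.isQMatrix (n + 1)).map (QGL.ofMat q (n + 1)))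
    (fun i => if i = 0 then QGL.mk q (n + 1) Polynomial.X else 1) fun i a => ?_
  split_ifs
  · exact QGL.commute_t q _ a
  · exact Commute.one_left a

/-- The homomorphism `SL_q(n) → GL_q(n)` which divides the first row by the determinant. -/
def QSL.toGL : QSL q (n + 1) →ₐ[k] QGL q (n + 1) :=
  RingQuot.liftAlgHom k ⟨QMat.lift (ofLaurentMatrix q n) (ofLaurentMatrix_isQMatrix q n), by
    rintro _ _ ⟨⟩
    have h : (fun i j => QMat.lift (ofLaurentMatrix q n) (ofLaurentMatrix_isQMatrix q n)
        (QMat.x q i j)) = ofLaurentMatrix q n :=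
      funext fun i => funext fun j => QMat.lift_x _ _ i j
    rw [qdet_eq_qdetOf, map_qdetOf, h, map_one]
    refine (qdetOf_mul_first_row _ _).trans ?_
    rw [← map_qdetOf, ← qdet_eq_qdetOf, QGL.t_mul_det]⟩

lemma QSL.toGL_x (i j : Fin (n + 1)) : QSL.toGL q n (QSL.ofMat q (n + 1) (QMat.x q i j)) =
    (if i = 0 then QGL.mk q (n + 1) Polynomial.X else 1) * QGL.ofMat q (n + 1) (QMat.x q i j) :=
  (RingQuot.liftAlgHom_mkAlgHom_apply k _ _ _).trans (QMat.lift_x _ _ i j)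

/-- The homomorphism `SL_q(n)[T, T⁻¹] → GL_q(n)`. -/
def QGL.ofLaurent : (QSL q (n + 1))[T;T⁻¹] →ₐ[k] QGL q (n + 1) :=
  AddMonoidAlgebra.liftNCAlgHom (QSL.toGL q n)
    ((Units.coeHom _).comp (zpowersHom _ (QGL.detUnit q (n + 1))))
    fun _ _ => QGL.commute_detUnit_zpow q (n + 1) _ _

lemma QGL.ofLaurent_C_mul_T (a : QSL q (n + 1)) (i : ℤ) : QGL.ofLaurent q n (C a * T i) =
    QSL.toGL q n a * (QGL.detUnit q (n + 1) ^ i : (QGL q (n + 1))ˣ) := by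
  rw [← single_eq_C_mul_T]
  exact AddMonoidAlgebra.liftNC_single _ _ _ _

lemma QGL.ofLaurent_C (a : QSL q (n + 1)) : QGL.ofLaurent q n (C a) = QSL.toGL q n a := by
  have := QGL.ofLaurent_C_mul_T q n a 0
  rwa [T_zero, mul_one, zpow_zero, Units.val_one, mul_one] at this

lemma QGL.ofLaurent_T (i : ℤ) :
    QGL.ofLaurent q n (T i) = (QGL.detUnit q (n + 1) ^ i : (QGL q (n + 1))ˣ) := by
  have := QGL.ofLaurent_C_mul_T q n 1 i
  rwa [map_one, one_mul, map_one, one_mul] at this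

lemma QGL.ofLaurent_toLaurent (a : QGL q (n + 1)) :
    QGL.ofLaurent q n (QGL.toLaurent q n a) = a := by
  have h : (QGL.ofLaurent q n).comp (QGL.toLaurent q n) = AlgHom.id k _ := by
    refine QGL.algHom_ext (fun i j => ?_) ?_
    · rw [AlgHom.comp_apply, QGL.toLaurent_ofMat, QMat.toLaurent, QMat.lift_x, toLaurentMatrix,
        map_mul, Hochschild.laurentC_apply, QGL.ofLaurent_C, QSL.toGL_x, AlgHom.id_apply]
      split_ifs
      · rw [QGL.ofLaurent_T, zpow_one, ← mul_assoc]
        exact (congrArg (· * _) (QGL.detUnit q (n + 1)).val_inv).trans (one_mul _)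
      · rw [map_one, one_mul, one_mul]
    · rw [AlgHom.comp_apply, QGL.toLaurent_X, QGL.ofLaurent_T, zpow_neg_one]
      rfl
  exact AlgHom.congr_fun h a

lemma QGL.toLaurent_ofLaurent (a : (QSL q (n + 1))[T;T⁻¹]) :
    QGL.toLaurent q n (QGL.ofLaurent q n a) = a := by
  have hC : (QGL.toLaurent q n).comp (QSL.toGL q n) = Hochschild.laurentC k _ := by
    refine QSL.algHom_ext fun i j => ?_
    rw [AlgHom.comp_apply, QSL.toGL_x, map_mul, QGL.toLaurent_ofMat, QMat.toLaurent, QMat.lift_x,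
      toLaurentMatrix]
    split_ifs
    · rw [QGL.toLaurent_X, ← mul_assoc, ← T_add, neg_add_cancel, T_zero, one_mul]
    · rw [map_one, one_mul, one_mul]
  have hT : ∀ i : ℤ, QGL.toLaurent q n (QGL.detUnit q (n + 1) ^ i : (QGL q (n + 1))ˣ) = T i := by
    have h1 : QGL.toLaurent q n (QGL.detUnit q (n + 1) : (QGL q (n + 1))ˣ) = T 1 :=
      (QGL.toLaurent_ofMat q n _).trans (QMat.toLaurent_qdet q n)
    have h2 : QGL.toLaurent q n ((QGL.detUnit q (n + 1))⁻¹ : (QGL q (n + 1))ˣ) = T (-1) :=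
      QGL.toLaurent_X q n
    intro i
    obtain ⟨m, rfl | rfl⟩ := i.eq_nat_or_neg
    · rw [zpow_natCast, Units.val_pow_eq_pow_val, map_pow, h1, T_pow, mul_one]
    · rw [zpow_neg, zpow_natCast, ← inv_pow, Units.val_pow_eq_pow_val, map_pow, h2, T_pow,
        mul_neg, mul_one]
  induction a using AddMonoidAlgebra.induction_linear with
  | zero => simp only [map_zero]
  | add x y hx hy => simp only [map_add, hx, hy]
  | single i a =>
    rw [single_eq_C_mul_T, QGL.ofLaurent_C_mul_T, map_mul, hT]
    exact congrArg (· * T i) (AlgHom.congr_fun hC a)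

variable {q n} {α β : QGL q (n + 1) →ₐ[k] k} {α₀ β₀ : QSL q (n + 1) →ₐ[k] k}

/-- The Hochschild homology of `GL_q(n)` in terms of that of `SL_q(n)`. -/
theorem QGL.charHomology_equiv (hα : α (QGL.mk q (n + 1) Polynomial.X) = 1)
    (hβ : β (QGL.mk q (n + 1) Polynomial.X) = 1)
    (hα₀ : ∀ i j, α₀ (QSL.ofMat q (n + 1) (QMat.x q i j)) = α (QGL.ofMat q (n + 1) (QMat.x q i j)))
    (hβ₀ : ∀ i j, β₀ (QSL.ofMat q (n + 1) (QMat.x q i j)) =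
      β (QGL.ofMat q (n + 1) (QMat.x q i j))) :
    Nonempty (Hochschild.homology k (QGL q (n + 1)) (Hochschild.CharBimodule α β) 0 ≃ₗ[k]
      Hochschild.homology k (QSL q (n + 1)) (Hochschild.CharBimodule α₀ β₀) 0) ∧
    ∀ l, Nonempty (Hochschild.homology k (QGL q (n + 1)) (Hochschild.CharBimodule α β) (l + 1)
      ≃ₗ[k] Hochschild.homology k (QSL q (n + 1)) (Hochschild.CharBimodule α₀ β₀) (l + 1) ×
        Hochschild.homology k (QSL q (n + 1)) (Hochschild.CharBimodule α₀ β₀) l) := by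
  -- A character with value 1 on t does not notice the division of the first row by D, so
  -- restricting along SL_q(n) → GL_q(n) gives the character with the same values on the generators.
  have hC : ∀ {γ : QGL q (n + 1) →ₐ[k] k} {γ₀ : QSL q (n + 1) →ₐ[k] k},
      γ (QGL.mk q (n + 1) Polynomial.X) = 1 →
      (∀ i j, γ₀ (QSL.ofMat q (n + 1) (QMat.x q i j)) = γ (QGL.ofMat q (n + 1) (QMat.x q i j))) →
      γ₀ = (γ.comp (QGL.ofLaurent q n)).comp (Hochschild.laurentC k _) := by
    intro γ γ₀ hγ hγ₀
    refine QSL.algHom_ext fun i j => ?_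
    rw [AlgHom.comp_apply, AlgHom.comp_apply, Hochschild.laurentC_apply, QGL.ofLaurent_C,
      QSL.toGL_x, map_mul, hγ₀]
    split_ifs
    · rw [hγ, one_mul]
    · rw [map_one, one_mul]
  have hT : ∀ {γ : QGL q (n + 1) →ₐ[k] k}, γ (QGL.mk q (n + 1) Polynomial.X) = 1 →
      ∀ i : ℤ, γ.comp (QGL.ofLaurent q n) (T i) = 1 := by
    intro γ hγ i
    have h1 : γ ((QGL.detUnit q (n + 1))⁻¹ : (QGL q (n + 1))ˣ) = 1 := hγ
    have h2 : γ (QGL.detUnit q (n + 1) : (QGL q (n + 1))ˣ) = 1 := by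
      have := congrArg γ (QGL.detUnit q (n + 1)).mul_inv
      rwa [map_mul, h1, mul_one, map_one] at this
    rw [AlgHom.comp_apply, QGL.ofLaurent_T]
    obtain ⟨m, rfl | rfl⟩ := i.eq_nat_or_neg
    · rw [zpow_natCast, Units.val_pow_eq_pow_val, map_pow, h2, one_pow]
    · rw [zpow_neg, zpow_natCast, ← inv_pow, Units.val_pow_eq_pow_val, map_pow, h1, one_pow]
  obtain ⟨⟨e₀⟩, he⟩ := Hochschild.laurent_charHomology (α.comp (QGL.ofLaurent q n))
    (β.comp (QGL.ofLaurent q n)) (hT hα) (hT hβ)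
  have f : ∀ l, Hochschild.homology k (QGL q (n + 1)) (Hochschild.CharBimodule α β) l ≃ₗ[k]
      Hochschild.homology k (QSL q (n + 1))[T;T⁻¹] (Hochschild.CharBimodule
        (α.comp (QGL.ofLaurent q n)) (β.comp (QGL.ofLaurent q n))) l := fun l =>
    LinearEquiv.ofBijective _ (Hochschild.homologyMap_bijective_of_bijective (QGL.toLaurent q n)
      ((Hochschild.CharBimodule.equiv α β).trans (Hochschild.CharBimodule.equiv _ _).symm :
        Hochschild.CharBimodule α β ≃ₗ[k] Hochschild.CharBimodule
        (α.comp (QGL.ofLaurent q n)) (β.comp (QGL.ofLaurent q n))).toLinearMap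
      (fun a m => congrArg (fun b => α b * Hochschild.CharBimodule.equiv _ _ m)
        (QGL.ofLaurent_toLaurent q n a).symm)
      (fun a m => congrArg (fun b => β b * Hochschild.CharBimodule.equiv _ _ m)
        (QGL.ofLaurent_toLaurent q n a).symm)
      (Function.bijective_iff_has_inverse.2 ⟨QGL.ofLaurent q n, QGL.ofLaurent_toLaurent q n,
        QGL.toLaurent_ofLaurent q n⟩) (LinearEquiv.bijective _) l)
  rw [hC hα hα₀, hC hβ hβ₀]
  exact ⟨⟨(f 0).trans e₀⟩, fun l => (he l).map fun e => (f (l + 1)).trans e⟩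

end Decomposition

section Localization

variable {k : Type u} [Field k] (q : kˣ) (n : ℕ)

open Polynomial in
/-- The kernel of `M_q(n)[t] → GL_q(n)`, when the quantum determinant is central. -/
lemma QGL.exists_of_mk_eq_zero (hD : ∀ a, Commute (qdet q n) a) (p : (QMat q n)[X])
    (hp : QGL.mk q n p = 0) : ∃ r, p = (X * C (qdet q n) - 1) * r := by
  have hw : ∀ p : (QMat q n)[X], Commute (X * C (qdet q n) - 1) p := by
    intro p
    refine Commute.sub_left (Commute.mul_left (commute_X p) ?_) (Commute.one_left p)
    ext m
    rw [coeff_C_mul, coeff_mul_C, (hD _).eq]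
  -- A central generator makes this left ideal two-sided; GL_q(n) maps to the quotient by it, which
  -- bounds the kernel by principal multiples.
  let I : Ideal (QMat q n)[X] := Ideal.span {X * C (qdet q n) - 1}
  have : I.IsTwoSided := ⟨fun {a} b ha => by
    obtain ⟨c, rfl⟩ := Ideal.mem_span_singleton'.1 ha
    rw [mul_assoc, (hw b).eq, ← mul_assoc]
    exact Ideal.mem_span_singleton'.2 ⟨c * b, rfl⟩⟩
  let f : QGL q n →+* (QMat q n)[X] ⧸ I := RingQuot.lift ⟨Ideal.Quotient.mk I, by
    rintro _ _ ⟨⟩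
    exact Ideal.Quotient.eq.2 (Ideal.subset_span rfl)⟩
  have hf : ∀ p, f (QGL.mk q n p) = Ideal.Quotient.mk I p := by
    intro p
    have h : QGL.mk q n p = RingQuot.mkRingHom (GLRel q n) p :=
      RingHom.congr_fun (RingQuot.mkAlgHom_coe k (GLRel q n)) p
    rw [h]
    exact RingQuot.lift_mkRingHom_apply _ _ _
  have h0 : p ∈ I := by
    rw [← Ideal.Quotient.eq_zero_iff_mem, ← hf, hp, map_zero]
  obtain ⟨r, rfl⟩ := Ideal.mem_span_singleton'.1 h0
  exact ⟨r, (hw r).eq.symm⟩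

/-- The condition on the right character holds since the counit takes D to the product of the
diagonal entries of the identity matrix. -/
lemma matToGL_bijective (hD : ∀ a, Commute (qdet q n) a) (l : ℕ) :
    Function.Bijective (matToGL q n l) := by
  refine Hochschild.homologyMap_localization (ψ := QGL.mk q n) hD (QGL.mk_X_mul_det q n)
    (QGL.exists_of_mk_eq_zero q n hD) (QGL.mk_surjective q n) (QGL.char_ofMat q 1 (by simp)) ?_
    _ (LinearEquiv.bijective _) _ _ l
  exact (QMat.char_qdet q 1).trans (by simp)

end Localization

end Quantum

/-! ### Expansion operators on functions of finite sets, and quantum minors. -/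

namespace Quantum

section Expansion

variable {k : Type u} [Field k] {κ : Type} [DecidableEq κ] (lt : κ → κ → Prop) [DecidableRel lt]
  {M : Type u} [AddCommGroup M] [Module k M] (s : k)

/-- The position of an element in a finite set. -/
def pos (S : Finset κ) (j : κ) : ℕ := (S.filter fun a => lt a j).card

/-- The operator `F ↦ (S ↦ ∑ j ∈ S, s ^ pos(j, S) e_j F(S \ j))` on functions of finite sets. -/
def expand (e : κ → M →ₗ[k] M) : (Finset κ → M) →ₗ[k] Finset κ → M where
  toFun F S := ∑ j ∈ S, s ^ pos lt S j • e j (F (S.erase j))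
  map_add' F G := by
    ext S
    simp only [Pi.add_apply, map_add, smul_add, Finset.sum_add_distrib]
  map_smul' c F := by
    ext S
    simp only [Pi.smul_apply, map_smul, RingHom.id_apply, Finset.smul_sum, smul_comm c]

lemma expand_apply (e : κ → M →ₗ[k] M) (F : Finset κ → M) (S : Finset κ) :
    expand lt s e F S = ∑ j ∈ S, s ^ pos lt S j • e j (F (S.erase j)) := rfl

variable {lt}

lemma pos_erase_of_lt {S : Finset κ} {a b : κ} (ha : a ∈ S) (h : lt a b) :
    pos lt S b = pos lt (S.erase a) b + 1 := by
  have : (S.erase a).filter (fun c => lt c b) = (S.filter fun c => lt c b).erase a :=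
    Finset.filter_erase _ _ _
  rw [pos, pos, this, Finset.card_erase_add_one (Finset.mem_filter.2 ⟨ha, h⟩)]

lemma pos_erase_of_not_lt {S : Finset κ} {a b : κ} (h : ¬lt a b) :
    pos lt (S.erase a) b = pos lt S b := by
  have : (S.erase a).filter (fun c => lt c b) = (S.filter fun c => lt c b).erase a :=
    Finset.filter_erase _ _ _
  rw [pos, pos, this, Finset.erase_eq_of_notMem]
  exact fun h' => h (Finset.mem_filter.1 h').2

variable [IsStrictTotalOrder κ lt]

lemma sum_sum_erase (S : Finset κ) (G : κ → κ → M) :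
    ∑ a ∈ S, ∑ b ∈ S.erase a, G a b =
      ∑ a ∈ S, ∑ b ∈ S.filter (fun b => lt a b), (G a b + G b a) := by
  have h : ∀ a ∈ S, ∑ b ∈ S.erase a, G a b =
      ∑ b ∈ S.filter (fun b => lt a b), G a b + ∑ b ∈ S.filter (fun b => lt b a), G a b := by
    intro a _
    rw [← Finset.sum_union]
    · refine Finset.sum_congr (Finset.ext fun b => ?_) fun _ _ => rfl
      rw [Finset.mem_erase, Finset.mem_union, Finset.mem_filter, Finset.mem_filter]
      constructor
      · rintro ⟨h1, h2⟩
        rcases trichotomous_of lt a b with h | h | h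
        · exact Or.inl ⟨h2, h⟩
        · exact absurd h.symm h1
        · exact Or.inr ⟨h2, h⟩
      · rintro (⟨h2, h⟩ | ⟨h2, h⟩)
        · exact ⟨fun hab => irrefl_of lt a (hab ▸ h), h2⟩
        · exact ⟨fun hab => irrefl_of lt a (hab ▸ h), h2⟩
    · refine Finset.disjoint_left.2 fun b hb hb' => ?_
      exact irrefl_of lt a (trans_of lt (Finset.mem_filter.1 hb).2 (Finset.mem_filter.1 hb').2)
  rw [Finset.sum_congr rfl h, Finset.sum_add_distrib]
  simp only [Finset.sum_add_distrib]
  congr 1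
  refine Finset.sum_comm' fun a b => ?_
  rw [Finset.mem_filter, Finset.mem_filter]
  tauto

/-- Two elements a before b can be removed in two orders. Removing a first lowers the position of b
by one, whereas removing b first leaves that of a unchanged, so the two terms differ by one factor
s. -/
lemma expand_expand (e f : κ → M →ₗ[k] M) (F : Finset κ → M) (S : Finset κ) :
    expand lt s f (expand lt s e F) S = ∑ a ∈ S, ∑ b ∈ S.filter (fun b => lt a b),
      s ^ (pos lt S a + pos lt (S.erase a) b) • (f a (e b (F ((S.erase a).erase b))) +
        s • f b (e a (F ((S.erase a).erase b)))) := by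
  have h : ∀ a ∈ S, s ^ pos lt S a • f a (expand lt s e F (S.erase a)) = ∑ b ∈ S.erase a,
      s ^ (pos lt S a + pos lt (S.erase a) b) • f a (e b (F ((S.erase a).erase b))) := by
    intro a _
    rw [expand_apply, map_sum, Finset.smul_sum]
    refine Finset.sum_congr rfl fun b _ => ?_
    rw [map_smul, smul_smul, pow_add]
  rw [expand_apply, Finset.sum_congr rfl h, sum_sum_erase (lt := lt)]
  refine Finset.sum_congr rfl fun a ha => Finset.sum_congr rfl fun b hb => ?_
  obtain ⟨hb, hab⟩ := Finset.mem_filter.1 hb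
  rw [smul_add, smul_smul, ← pow_succ, pos_erase_of_not_lt (asymm_of lt hab),
    pos_erase_of_lt ha hab, Finset.erase_right_comm, add_comm (_ + 1), add_assoc]

/-- By `expand_expand`, an identity between products of two operators reduces to quadratic relations
for pairs. With s = −q⁻¹ these are the relations of quantum matrices, and the operators obey the
rules of a q-exterior algebra. -/
lemma expand_comm {e f : κ → M →ₗ[k] M} (h : ∀ a b, lt a b → ∀ v,
    f a (e b v) + s • f b (e a v) = s • (e a (f b v) + s • e b (f a v))) (F : Finset κ → M) :
    expand lt s f (expand lt s e F) = s • expand lt s e (expand lt s f F) := by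
  ext S
  rw [Pi.smul_apply, expand_expand, expand_expand, Finset.smul_sum]
  refine Finset.sum_congr rfl fun a _ => ?_
  rw [Finset.smul_sum]
  refine Finset.sum_congr rfl fun b hb => ?_
  rw [h a b (Finset.mem_filter.1 hb).2, smul_comm]

lemma expand_self {e : κ → M →ₗ[k] M} (h : ∀ a b, lt a b → ∀ v,
    e a (e b v) + s • e b (e a v) = 0) (F : Finset κ → M) :
    expand lt s e (expand lt s e F) = 0 := by
  ext S
  rw [expand_expand]
  refine Finset.sum_eq_zero fun a _ => Finset.sum_eq_zero fun b hb => ?_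
  rw [h a b (Finset.mem_filter.1 hb).2, smul_zero]

end Expansion

section Fold

variable {k : Type u} [Field k] {ι : Type} {lt : ι → ι → Prop} {N : Type u} [AddCommGroup N]
  [Module k N] {s : k} {T : ι → N →ₗ[k] N}

/-- A repeated factor kills a product in an exterior algebra: T i moves right, past smaller indices
only, until it meets its copy. For minors this is the vanishing for a repeated row or column. -/
lemma foldr_eq_zero (hT : ∀ r l, lt r l → ∀ v, T l (T r v) = s • T r (T l v))
    (hT0 : ∀ r v, T r (T r v) = 0) (v : N) {L : List ι} (hL : L.Pairwise lt) {i : ι} (hi : i ∈ L) :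
    T i (L.foldr (fun r => T r) v) = 0 := by
  induction L with
  | nil => exact absurd hi List.not_mem_nil
  | cons a L ih =>
    rw [List.foldr_cons]
    rcases List.mem_cons.1 hi with rfl | hi
    · exact hT0 _ _
    · rw [hT a i (List.rel_of_pairwise_cons hL hi), ih hL.of_cons hi, map_zero, smul_zero]

variable [DecidableEq ι]

lemma toFinset_erase_of_nodup {L : List ι} (hL : L.Nodup) (j : ι) :
    L.toFinset.erase j = (L.erase j).toFinset := by
  ext b
  rw [Finset.mem_erase, List.mem_toFinset, List.mem_toFinset, hL.mem_erase_iff]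

lemma toFinset_cons_erase {a : ι} {L : List ι} (hL : (a :: L).Nodup) {j : ι} (hj : j ∈ L) :
    (a :: L).toFinset.erase j = (a :: L.erase j).toFinset := by
  have haj : ¬(a == j) = true := fun h => (List.nodup_cons.1 hL).1 (beq_iff_eq.1 h ▸ hj)
  rw [toFinset_erase_of_nodup hL, List.erase_cons_tail haj]

lemma toFinset_cons_erase_self {a : ι} {L : List ι} (hL : (a :: L).Nodup) :
    (a :: L).toFinset.erase a = L.toFinset := by
  rw [toFinset_erase_of_nodup hL, List.erase_cons_head]

variable [DecidableRel lt]

lemma pos_cons_of_not_lt {a : ι} {L : List ι} (hL : (a :: L).Nodup) {j : ι} (h : ¬lt a j) :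
    pos lt (a :: L).toFinset j = pos lt L.toFinset j := by
  rw [← pos_erase_of_not_lt h, toFinset_cons_erase_self hL]

variable [IsStrictTotalOrder ι lt]

lemma pos_cons_self {a : ι} {L : List ι} (hL : (a :: L).Nodup) (h : ∀ j ∈ L, lt j a) :
    pos lt (a :: L).toFinset a = L.length := by
  rw [pos_cons_of_not_lt hL (irrefl_of lt a), pos, Finset.filter_true_of_mem,
    List.toFinset_card_of_nodup hL.of_cons]
  exact fun j hj => h j (List.mem_toFinset.1 hj)

/-- Putting the missing factor back costs one s for each smaller index it passes. This is the sign
of a Laplace expansion. -/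
lemma foldr_erase_self (hT : ∀ r l, lt r l → ∀ v, T l (T r v) = s • T r (T l v))
    (v : N) {L : List ι} (hL : L.Pairwise lt) {i : ι} (hi : i ∈ L) :
    T i ((L.erase i).foldr (fun r => T r) v) =
      s ^ pos lt L.toFinset i • L.foldr (fun r => T r) v := by
  induction L with
  | nil => exact absurd hi List.not_mem_nil
  | cons a L ih =>
    by_cases hai : a = i
    · subst hai
      have h : pos lt (a :: L).toFinset a = 0 := by
        rw [pos, Finset.card_eq_zero, Finset.filter_eq_empty_iff]
        intro b hb
        rcases List.mem_cons.1 (List.mem_toFinset.1 hb) with rfl | hb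
        · exact irrefl_of lt _
        · exact asymm_of lt (List.rel_of_pairwise_cons hL hb)
      rw [List.erase_cons_head, h, pow_zero, one_smul, List.foldr_cons]
    · have hi : i ∈ L := (List.mem_cons.1 hi).resolve_left (Ne.symm hai)
      have hlt : lt a i := List.rel_of_pairwise_cons hL hi
      have ha : a ∉ L := fun h => irrefl_of lt a (List.rel_of_pairwise_cons hL h)
      have h : pos lt (a :: L).toFinset i = pos lt L.toFinset i + 1 := by
        rw [pos_erase_of_lt (a := a) (by simp) hlt, List.toFinset_cons,
          Finset.erase_insert (by simpa using ha)]
      rw [List.erase_cons_tail (by simpa using hai), List.foldr_cons, hT a i hlt, ih hL.of_cons hi,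
        map_smul, smul_smul, h, List.foldr_cons, pow_succ']

end Fold

section Minors

variable {k : Type u} [Field k] {q : kˣ} {R : Type u} [Ring R] [Algebra k R] {m n : ℕ}

/-- The operator of multiplication by the entries of a row. -/
def rowOp (q : kˣ) (y : Fin m → Fin n → R) (r : Fin m) :
    (Finset (Fin n) → R) →ₗ[k] Finset (Fin n) → R :=
  expand (· < ·) (-((q⁻¹ : kˣ) : k)) fun j => LinearMap.mulLeft k (y r j)

/-- The operator of multiplication on the right by the entries of a column. -/
def colOp (q : kˣ) (y : Fin m → Fin n → R) (c : Fin n) :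
    (Finset (Fin m) → R) →ₗ[k] Finset (Fin m) → R :=
  expand (· > ·) (-((q⁻¹ : kˣ) : k)) fun i => LinearMap.mulRight k (y i c)

variable {y : Fin m → Fin n → R}

/-- The relations `anti` and `diag` in the form that `expand_comm` needs; the coefficients match
because 1 = −q⁻¹(q⁻¹ − q) + q⁻². -/
lemma IsQMatrix.swap (h : IsQMatrix q y) {r l : Fin m} {a b : Fin n} (hrl : r < l) (hab : a < b) :
    y l a * y r b + (-((q⁻¹ : kˣ) : k)) • (y l b * y r a) =
      (-((q⁻¹ : kˣ) : k)) • (y r a * y l b + (-((q⁻¹ : kˣ) : k)) • (y r b * y l a)) := by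
  have h1 := h.diag r l a b hrl hab
  have h2 : y r a * y l b = y l b * y r a + ((q⁻¹ : kˣ) - (q : k) : k) • (y r b * y l a) :=
    sub_eq_iff_eq_add'.1 h1
  have h3 : (1 : k) = -((q⁻¹ : kˣ) : k) * ((q⁻¹ : kˣ) - (q : k)) +
      -((q⁻¹ : kˣ) : k) * -((q⁻¹ : kˣ) : k) := by
    have := q.inv_mul
    linear_combination -this
  rw [h2, h.anti r l a b hrl hab, smul_add, smul_add, smul_smul, smul_smul, add_assoc, ← add_smul,
    ← h3, one_smul, add_comm]

lemma neg_inv_smul_smul (x : R) : x + (-((q⁻¹ : kˣ) : k)) • ((q : k) • x) = 0 := by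
  rw [smul_smul, neg_mul, Units.inv_mul, neg_one_smul, add_neg_cancel]

lemma IsQMatrix.rowOp_comm (h : IsQMatrix q y) (r l : Fin m) (hrl : r < l)
    (F : Finset (Fin n) → R) :
    rowOp q y l (rowOp q y r F) = (-((q⁻¹ : kˣ) : k)) • rowOp q y r (rowOp q y l F) := by
  refine expand_comm _ (fun a b hab v => ?_) F
  simpa only [LinearMap.mulLeft_apply, add_mul, smul_mul_assoc, mul_assoc] using
    congrArg (· * v) (h.swap hrl hab)

lemma IsQMatrix.rowOp_self (h : IsQMatrix q y) (r : Fin m) (F : Finset (Fin n) → R) :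
    rowOp q y r (rowOp q y r F) = 0 := by
  refine expand_self _ (fun a b hab v => ?_) F
  have h1 : y r a * y r b + (-((q⁻¹ : kˣ) : k)) • (y r b * y r a) = 0 := by
    rw [h.row r a b hab, neg_inv_smul_smul]
  simpa only [LinearMap.mulLeft_apply, add_mul, smul_mul_assoc, mul_assoc, zero_mul] using
    congrArg (· * v) h1

/-- Columns multiply from the right, which reverses products; with both orders reversed, the
relation is again `swap` after exchanging the commuting pair. -/
lemma IsQMatrix.colOp_comm (h : IsQMatrix q y) (d c : Fin n) (hcd : d > c)
    (F : Finset (Fin m) → R) :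
    colOp q y c (colOp q y d F) = (-((q⁻¹ : kˣ) : k)) • colOp q y d (colOp q y c F) := by
  refine expand_comm _ (fun a b hab v => ?_) F
  have h1 : y b d * y a c + (-((q⁻¹ : kˣ) : k)) • (y a d * y b c) =
      (-((q⁻¹ : kˣ) : k)) • (y b c * y a d + (-((q⁻¹ : kˣ) : k)) • (y a c * y b d)) := by
    have h2 := h.swap hab hcd
    rw [h.anti b a c d hab hcd] at h2 ⊢
    exact h2
  simpa only [LinearMap.mulRight_apply, mul_add, mul_smul_comm, mul_assoc] using
    congrArg (v * ·) h1

lemma IsQMatrix.colOp_self (h : IsQMatrix q y) (c : Fin n) (F : Finset (Fin m) → R) :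
    colOp q y c (colOp q y c F) = 0 := by
  refine expand_self _ (fun a b hab v => ?_) F
  have h1 : y b c * y a c + (-((q⁻¹ : kˣ) : k)) • (y a c * y b c) = 0 := by
    rw [h.col b a c hab, neg_inv_smul_smul]
  simpa only [LinearMap.mulRight_apply, mul_add, mul_smul_comm, mul_assoc, mul_zero] using
    congrArg (v * ·) h1

/-- The minors with a given list of rows, as functions of the set of columns. -/
def rowMinor (q : kˣ) (y : Fin m → Fin n → R) (L : List (Fin m)) : Finset (Fin n) → R :=
  L.foldr (fun r => rowOp q y r) (Pi.single ∅ 1)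

/-- The minors with a given list of columns, as functions of the set of rows. -/
def colMinor (q : kˣ) (y : Fin m → Fin n → R) (L : List (Fin n)) : Finset (Fin m) → R :=
  L.foldr (fun c => colOp q y c) (Pi.single ∅ 1)

lemma rowMinor_cons (y : Fin m → Fin n → R) (r : Fin m) (L : List (Fin m)) (S : Finset (Fin n)) :
    rowMinor q y (r :: L) S = ∑ j ∈ S, (-((q⁻¹ : kˣ) : k)) ^ pos (· < ·) S j •
      (y r j * rowMinor q y L (S.erase j)) := rfl

lemma colMinor_cons (y : Fin m → Fin n → R) (c : Fin n) (L : List (Fin n)) (S : Finset (Fin m)) :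
    colMinor q y (c :: L) S = ∑ i ∈ S, (-((q⁻¹ : kˣ) : k)) ^ pos (· > ·) S i •
      (colMinor q y L (S.erase i) * y i c) := rfl

lemma commute_rowMinor {z : R} {L : List (Fin m)} {S : Finset (Fin n)}
    (h : ∀ i ∈ L, ∀ j ∈ S, Commute z (y i j)) : Commute z (rowMinor q y L S) := by
  induction L generalizing S with
  | nil =>
    change Commute z (Pi.single (M := fun _ : Finset (Fin n) => R) ∅ 1 S)
    rw [Pi.single_apply]
    split_ifs
    · exact Commute.one_right z
    · exact Commute.zero_right z
  | cons r L ih =>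
    rw [rowMinor_cons]
    refine Commute.sum_right _ _ _ fun j hj => Commute.smul_right (Commute.mul_right
      (h r List.mem_cons_self j hj) (ih fun i hi j' hj' => ?_)) _
    exact h i (List.mem_cons_of_mem _ hi) j' (Finset.mem_of_mem_erase hj')

/-- Induction on the size. Let r be the smallest row and c the largest column. Expand one side along
r and then c, the other along c and then r: away from the corner entry both give the same double sum
of y r j · minor · y i c, and the two corner terms agree because that entry commutes with its minor.
-/
lemma IsQMatrix.rowMinor_eq_colMinor (h : IsQMatrix q y) {L : List (Fin m)} {L' : List (Fin n)}
    (hL : L.Pairwise (· < ·)) (hL' : L'.Pairwise (· > ·)) (hl : L.length = L'.length) :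
    rowMinor q y L L'.toFinset = colMinor q y L' L.toFinset := by
  generalize hN : L.length = N at hl
  induction N using Nat.strong_induction_on generalizing L L' with | h N ih => ?_
  obtain _ | N := N
  · rw [List.length_eq_zero_iff.1 hN, List.length_eq_zero_iff.1 hl.symm]
    rfl
  obtain ⟨r, L, rfl⟩ : ∃ r I, L = r :: I := List.exists_cons_of_length_eq_add_one hN
  obtain ⟨c, L', rfl⟩ : ∃ r I, L' = r :: I := List.exists_cons_of_length_eq_add_one hl.symm
  have hrL : ∀ i ∈ L, r < i := fun i hi => List.rel_of_pairwise_cons hL hi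
  have hcL : ∀ j ∈ L', j < c := fun j hj => List.rel_of_pairwise_cons hL' hj
  have hr : r ∉ L.toFinset := fun h => lt_irrefl r (hrL r (List.mem_toFinset.1 h))
  have hc : c ∉ L'.toFinset := fun h => lt_irrefl c (hcL c (List.mem_toFinset.1 h))
  have hd : (r :: L).Nodup := hL.imp ne_of_lt
  have hd' : (c :: L').Nodup := hL'.imp ne_of_gt
  have hN : L.length = N := Nat.succ_injective hN
  have hl : N = L'.length := Nat.succ_injective hl
  have h6 : ∀ i ∈ L, ∀ j ∈ L', rowMinor q y (L.erase i) (L'.erase j).toFinset =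
      colMinor q y (L'.erase j) (L.erase i).toFinset := by
    intro i hi j hj
    have h1 := List.length_erase_add_one hi
    have h2 := List.length_erase_add_one hj
    exact ih _ (by omega) (hL.of_cons.sublist List.erase_sublist)
      (hL'.of_cons.sublist List.erase_sublist) rfl (by omega)
  -- The minor left by the row expansion becomes a column minor by induction, is expanded along c,
  -- and the smaller minors are turned back by `h6`.
  have h4 : ∀ j ∈ L'.toFinset, (-((q⁻¹ : kˣ) : k)) ^ pos (· < ·) (c :: L').toFinset j •
      (y r j * rowMinor q y L ((c :: L').toFinset.erase j)) = ∑ i ∈ L.toFinset,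
        (-((q⁻¹ : kˣ) : k)) ^ (pos (· < ·) L'.toFinset j + pos (· > ·) L.toFinset i) •
        (y r j * rowMinor q y (L.erase i) (L'.erase j).toFinset * y i c) := by
    intro j hj
    have hj := List.mem_toFinset.1 hj
    rw [toFinset_cons_erase hd' hj, ih N N.lt_succ_self hL.of_cons _ hN, colMinor_cons,
      Finset.mul_sum, Finset.smul_sum, pos_cons_of_not_lt hd' (hcL j hj).not_gt]
    · refine Finset.sum_congr rfl fun i hi => ?_
      have hi := List.mem_toFinset.1 hi
      rw [toFinset_erase_of_nodup hd.of_cons, ← h6 i hi j hj, mul_smul_comm, smul_smul, pow_add,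
        mul_assoc]
    · rw [List.length_cons, List.length_erase_add_one hj, hl]
    · exact List.pairwise_cons.2 ⟨fun a ha => hcL a (List.mem_of_mem_erase ha),
        hL'.of_cons.sublist List.erase_sublist⟩
  have h5 : ∀ i ∈ L.toFinset, (-((q⁻¹ : kˣ) : k)) ^ pos (· > ·) (r :: L).toFinset i •
      (colMinor q y L' ((r :: L).toFinset.erase i) * y i c) = ∑ j ∈ L'.toFinset,
        (-((q⁻¹ : kˣ) : k)) ^ (pos (· < ·) L'.toFinset j + pos (· > ·) L.toFinset i) •
        (y r j * rowMinor q y (L.erase i) (L'.erase j).toFinset * y i c) := by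
    intro i hi
    have hi := List.mem_toFinset.1 hi
    rw [toFinset_cons_erase hd hi, ← ih N N.lt_succ_self _ hL'.of_cons _ hl, rowMinor_cons,
      Finset.sum_mul, Finset.smul_sum, pos_cons_of_not_lt hd (hrL i hi).not_gt]
    · refine Finset.sum_congr rfl fun j hj => ?_
      rw [toFinset_erase_of_nodup hd'.of_cons, smul_mul_assoc, smul_smul, pow_add, mul_comm]
    · exact List.pairwise_cons.2 ⟨fun a ha => hrL a (List.mem_of_mem_erase ha),
        hL.of_cons.sublist List.erase_sublist⟩
    · rw [List.length_cons, List.length_erase_add_one hi, hN]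
  -- All entries of this minor lie strictly below and to the left of the corner, so `anti` applies
  -- to each.
  have h7 : Commute (y r c) (rowMinor q y L L'.toFinset) := commute_rowMinor fun i hi j hj =>
    (h.anti r i j c (hrL i hi) (hcL j (List.mem_toFinset.1 hj))).symm
  rw [rowMinor_cons, colMinor_cons, List.toFinset_cons, List.toFinset_cons,
    Finset.sum_insert hr, Finset.sum_insert hc, ← List.toFinset_cons, ← List.toFinset_cons,
    Finset.sum_congr rfl h4, Finset.sum_congr rfl h5, Finset.sum_comm, pos_cons_self hd hrL,
    pos_cons_self hd' hcL, toFinset_cons_erase_self hd, toFinset_cons_erase_self hd',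
    ← ih N N.lt_succ_self hL.of_cons hL'.of_cons hN hl, h7.eq, hN, hl]

end Minors

end Quantum

/-! ### Laplace expansions and the centrality of the quantum determinant. -/

namespace Quantum

section Laplace

/-- The permutation with `0 ↦ j` and `i + 1 ↦ j.succAbove (τ i)`. -/
def consPerm {n : ℕ} (j : Fin (n + 1)) (τ : Equiv.Perm (Fin n)) : Equiv.Perm (Fin (n + 1)) :=
  (Equiv.Perm.decomposeFin.symm (0, τ)).trans j.cycleRange.symm

lemma consPerm_zero {n : ℕ} (j : Fin (n + 1)) (τ : Equiv.Perm (Fin n)) : consPerm j τ 0 = j := by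
  rw [consPerm, Equiv.trans_apply, Equiv.Perm.decomposeFin_symm_apply_zero,
    Fin.cycleRange_symm_zero]

lemma consPerm_succ {n : ℕ} (j : Fin (n + 1)) (τ : Equiv.Perm (Fin n)) (i : Fin n) :
    consPerm j τ i.succ = j.succAbove (τ i) := by
  rw [consPerm, Equiv.trans_apply, Equiv.Perm.decomposeFin_symm_apply_succ, Equiv.swap_self,
    Equiv.refl_apply, Fin.cycleRange_symm_succ]

lemma consPerm_bijective (n : ℕ) : Function.Bijective
    fun p : Fin (n + 1) × Equiv.Perm (Fin n) => consPerm p.1 p.2 := by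
  refine (Fintype.bijective_iff_injective_and_card _).2 ⟨?_, ?_⟩
  · rintro ⟨j, τ⟩ ⟨j', τ'⟩ h
    have h : consPerm j τ = consPerm j' τ' := h
    obtain rfl : j = j' := by rw [← consPerm_zero j τ, h, consPerm_zero]
    refine Prod.ext rfl (Equiv.ext fun i => j.succAbove_right_injective ?_)
    rw [← consPerm_succ, h, consPerm_succ]
  · rw [Fintype.card_prod, Fintype.card_fin, Fintype.card_perm, Fintype.card_perm,
      Fintype.card_fin, Fintype.card_fin, Nat.factorial_succ]

lemma permLength_eq_sum {n : ℕ} (σ : Equiv.Perm (Fin n)) :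
    permLength σ = ∑ a, ∑ b, if a < b ∧ σ b < σ a then 1 else 0 := by
  rw [permLength, Finset.card_filter, Fintype.sum_prod_type]

/-- The value j in first place is inverted with exactly the j smaller values, and `succAbove`, being
increasing, keeps the inversions of τ. -/
lemma permLength_consPerm {n : ℕ} (j : Fin (n + 1)) (τ : Equiv.Perm (Fin n)) :
    permLength (consPerm j τ) = j + permLength τ := by
  have h : ∑ b, (if j.succAbove (τ b) < j then 1 else 0) = (j : ℕ) := by
    rw [Equiv.sum_comp τ fun b => if j.succAbove b < j then 1 else 0, ← Finset.card_filter]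
    simp only [Fin.succAbove_lt_iff_castSucc_lt]
    simp only [Fin.lt_def, Fin.val_castSucc]
    rw [Fin.card_filter_val_lt]
    omega
  rw [permLength_eq_sum, permLength_eq_sum, Fin.sum_univ_succ]
  simp only [Fin.sum_univ_succ, consPerm_zero, consPerm_succ, Fin.succ_lt_succ_iff,
    Fin.succAbove_lt_succAbove_iff, Fin.succ_pos, true_and, lt_irrefl, false_and, if_false,
    zero_add, Fin.not_lt_zero, h]

variable {k : Type u} [Field k] {q : kˣ} {R : Type u} [Ring R] [Algebra k R] {m n : ℕ}

lemma qdetOf_succ (y : Fin (n + 1) → Fin (n + 1) → R) :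
    qdetOf q y = ∑ j : Fin (n + 1), (-((q⁻¹ : kˣ) : k)) ^ (j : ℕ) •
      (y 0 j * qdetOf q fun a b => y a.succ (j.succAbove b)) := by
  rw [qdetOf, ← (consPerm_bijective n).sum_comp, Fintype.sum_prod_type]
  refine Finset.sum_congr rfl fun j _ => ?_
  rw [qdetOf, Finset.mul_sum, Finset.smul_sum]
  refine Finset.sum_congr rfl fun τ _ => ?_
  rw [permLength_consPerm, List.ofFn_succ, List.prod_cons, mul_smul_comm, smul_smul, pow_add]
  simp only [consPerm_zero, consPerm_succ]

/-- Both sides satisfy the expansion along the first row; this links the operator calculus to the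
sum over permutations. -/
lemma rowMinor_ofFn (y : Fin m → Fin n → R) {p : ℕ} (r : Fin p → Fin m) {g : Fin p → Fin n}
    (hg : StrictMono g) : rowMinor q y (List.ofFn r) (Finset.univ.image g) =
      qdetOf q fun i j => y (r i) (g j) := by
  induction p with
  | zero =>
    rw [List.ofFn_zero, qdetOf, Fintype.sum_unique, List.ofFn_zero, List.prod_nil]
    have h1 : permLength (default : Equiv.Perm (Fin 0)) = 0 := rfl
    rw [h1, pow_zero, one_smul]
    rfl
  | succ p ih =>
    rw [List.ofFn_succ, rowMinor_cons, qdetOf_succ,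
      Finset.sum_image fun _ _ _ _ h => hg.injective h]
    refine Finset.sum_congr rfl fun j _ => ?_
    have h1 : pos (· < ·) (Finset.univ.image g) (g j) = j := by
      have : (Finset.univ.image g).filter (fun a => a < g j) = (Finset.Iio j).image g := by
        ext a
        simp only [Finset.mem_filter, Finset.mem_image, Finset.mem_univ, true_and, Finset.mem_Iio]
        constructor
        · rintro ⟨⟨b, rfl⟩, h⟩
          exact ⟨b, hg.lt_iff_lt.1 h, rfl⟩
        · rintro ⟨b, h, rfl⟩
          exact ⟨⟨b, rfl⟩, hg h⟩
      rw [pos, this, Finset.card_image_of_injective _ hg.injective, Fin.card_Iio]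
    have h2 : (Finset.univ.image g).erase (g j) = Finset.univ.image (g ∘ j.succAbove) := by
      rw [← Finset.image_image, Fin.image_succAbove_univ, ← Finset.image_erase hg.injective]
      congr 1
      ext a
      simp
    rw [h1, h2, ih (fun i => r i.succ) (hg.comp j.strictMono_succAbove)]
    rfl

end Laplace

section Central

variable {k : Type u} [Field k] {q : kˣ} {R : Type u} [Ring R] [Algebra k R] {n : ℕ}
  {y : Fin n → Fin n → R}

lemma qdetOf_eq_rowMinor (y : Fin n → Fin n → R) :
    qdetOf q y = rowMinor q y (List.finRange n) Finset.univ := by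
  have := rowMinor_ofFn (q := q) y id (strictMono_id (α := Fin n))
  rwa [List.ofFn_id, Finset.image_id, eq_comm] at this

/-- The expansion of the quantum determinant along a row. -/
lemma IsQMatrix.sum_row_mul_minor (h : IsQMatrix q y) (i l : Fin n) :
    ∑ j, (-((q⁻¹ : kˣ) : k)) ^ pos (· < ·) Finset.univ j •
      (y i j * rowMinor q y ((List.finRange n).erase l) (Finset.univ.erase j)) =
    if i = l then (-((q⁻¹ : kˣ) : k)) ^ pos (· < ·) Finset.univ i • qdetOf q y else 0 := by
  change rowOp q y i (rowMinor q y ((List.finRange n).erase l)) Finset.univ = _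
  have hL := List.pairwise_lt_finRange n
  split_ifs with hil
  · subst hil
    have h1 := congrFun (foldr_erase_self h.rowOp_comm (Pi.single ∅ 1) hL (List.mem_finRange i))
      Finset.univ
    rw [List.toFinset_finRange] at h1
    rw [qdetOf_eq_rowMinor]
    exact h1
  -- For `i ≠ l` row `i` is still among the remaining rows, so it occurs twice.
  · refine congrFun (foldr_eq_zero h.rowOp_comm h.rowOp_self (Pi.single ∅ 1)
      (hL.sublist List.erase_sublist) ?_) Finset.univ
    exact (List.mem_erase_of_ne hil).2 (List.mem_finRange i)

/-- The expansion of the quantum determinant along a column. -/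
lemma IsQMatrix.sum_minor_mul_col (h : IsQMatrix q y) (j l : Fin n) :
    ∑ i, (-((q⁻¹ : kˣ) : k)) ^ pos (· > ·) Finset.univ i •
      (rowMinor q y ((List.finRange n).erase i) (Finset.univ.erase j) * y i l) =
    if l = j then (-((q⁻¹ : kˣ) : k)) ^ pos (· > ·) Finset.univ l • qdetOf q y else 0 := by
  have hL := List.pairwise_lt_finRange n
  have hL' : (List.finRange n).reverse.Pairwise (· > ·) := List.pairwise_reverse.2 hL
  have hd' : (List.finRange n).reverse.Nodup := hL'.imp ne_of_gt
  have hu : (List.finRange n).reverse.toFinset = Finset.univ := by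
    rw [List.toFinset_reverse, List.toFinset_finRange]
  -- The minors of the row expansion must reappear here; reading them as column minors lets the
  -- column operators act on them.
  have h1 : ∀ i, rowMinor q y ((List.finRange n).erase i) (Finset.univ.erase j) =
      colMinor q y ((List.finRange n).reverse.erase j) (Finset.univ.erase i) := by
    intro i
    have := h.rowMinor_eq_colMinor (hL.sublist (List.erase_sublist (a := i)))
      (hL'.sublist (List.erase_sublist (a := j))) (by
        rw [List.length_erase_of_mem (List.mem_finRange i),
          List.length_erase_of_mem (List.mem_reverse.2 (List.mem_finRange j)), List.length_reverse])
    rwa [← toFinset_erase_of_nodup hd', ← toFinset_erase_of_nodup (List.nodup_finRange n), hu,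
      List.toFinset_finRange] at this
  have h2 : qdetOf q y = colMinor q y (List.finRange n).reverse Finset.univ := by
    have := h.rowMinor_eq_colMinor hL hL' (List.length_reverse).symm
    rwa [hu, List.toFinset_finRange, ← qdetOf_eq_rowMinor] at this
  simp only [h1]
  change colOp q y l (colMinor q y ((List.finRange n).reverse.erase j)) Finset.univ = _
  split_ifs with hjl
  · subst hjl
    have h1 := congrFun (foldr_erase_self h.colOp_comm (Pi.single ∅ 1) hL'
      (List.mem_reverse.2 (List.mem_finRange l))) Finset.univ
    rw [hu] at h1
    rw [h2]
    exact h1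
  · refine congrFun (foldr_eq_zero h.colOp_comm h.colOp_self (Pi.single ∅ 1)
      (hL'.sublist List.erase_sublist) ?_) Finset.univ
    exact (List.mem_erase_of_ne hjl).2 (List.mem_reverse.2 (List.mem_finRange l))

/-- The row weight and the column weight together give (−q⁻¹) ^ (n − 1) for every index, so both
evaluations in `commute_qdetOf` carry the same scalar. -/
lemma pos_univ_add_pos_univ (i : Fin n) :
    pos (· > ·) Finset.univ i + pos (· < ·) Finset.univ i = n - 1 := by
  have h1 : pos (· > ·) Finset.univ i = n - 1 - i := by
    rw [pos, ← Fin.card_Ioi]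
    congr 1
    ext a
    simp
  have h2 : pos (· < ·) Finset.univ i = i := by
    rw [pos, ← Fin.card_Iio]
    congr 1
    ext a
    simp
  omega

/-- Evaluate the entry (i, l) of matrix · adjugate · matrix. Bracketed to the left it is a multiple
of D y i l, bracketed to the right the same invertible multiple of y i l D. -/
lemma IsQMatrix.commute_qdetOf (h : IsQMatrix q y) (i l : Fin n) :
    Commute (qdetOf q y) (y i l) := by
  have h1 : ∑ b, (-((q⁻¹ : kˣ) : k)) ^ pos (· > ·) Finset.univ b •
      ((∑ j, (-((q⁻¹ : kˣ) : k)) ^ pos (· < ·) Finset.univ j •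
        (y i j * rowMinor q y ((List.finRange n).erase b) (Finset.univ.erase j))) * y b l) =
      (-((q⁻¹ : kˣ) : k)) ^ (n - 1) • (qdetOf q y * y i l) := by
    simp only [h.sum_row_mul_minor]
    rw [Finset.sum_eq_single i, if_pos rfl, smul_mul_assoc, smul_smul, ← pow_add,
      pos_univ_add_pos_univ]
    · intro b _ hb
      rw [if_neg hb.symm, zero_mul, smul_zero]
    · exact fun hi => absurd (Finset.mem_univ i) hi
  have h2 : ∑ j, (-((q⁻¹ : kˣ) : k)) ^ pos (· < ·) Finset.univ j •
      (y i j * ∑ b, (-((q⁻¹ : kˣ) : k)) ^ pos (· > ·) Finset.univ b •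
        (rowMinor q y ((List.finRange n).erase b) (Finset.univ.erase j) * y b l)) =
      (-((q⁻¹ : kˣ) : k)) ^ (n - 1) • (y i l * qdetOf q y) := by
    simp only [h.sum_minor_mul_col]
    rw [Finset.sum_eq_single l, if_pos rfl, mul_smul_comm, smul_smul, ← pow_add, add_comm,
      pos_univ_add_pos_univ]
    · intro b _ hb
      rw [if_neg hb.symm, mul_zero, smul_zero]
    · exact fun hi => absurd (Finset.mem_univ l) hi
  have h3 : IsUnit ((-((q⁻¹ : kˣ) : k)) ^ (n - 1)) := (Units.isUnit q⁻¹).neg.pow _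
  refine h3.smul_left_cancel.1 (h1.symm.trans (Eq.trans ?_ h2))
  simp only [Finset.sum_mul, Finset.mul_sum, Finset.smul_sum, smul_mul_assoc, mul_smul_comm,
    mul_assoc]
  rw [Finset.sum_comm]
  refine Finset.sum_congr rfl fun j _ => Finset.sum_congr rfl fun b _ => smul_comm _ _ _

/-- The quantum determinant is central. -/
theorem commute_qdet (a : QMat q n) : Commute (qdet q n) a := by
  obtain ⟨a, rfl⟩ : ∃ b, QMat.mk q n b = a := RingQuot.mkAlgHom_surjective k _ a
  induction a using FreeAlgebra.induction with
  | grade0 r =>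
    rw [AlgHom.commutes]
    exact Algebra.commute_algebraMap_right r _
  | grade1 p => exact (QMat.isQMatrix n).commute_qdetOf p.1 p.2
  | mul a b ha hb =>
    rw [map_mul]
    exact ha.mul_right hb
  | add a b ha hb =>
    rw [map_add]
    exact ha.add_right hb

end Central

end Quantum

end

theorem mainTheorem2 {k : Type u} [Field k] (q : kˣ) (hq : ∀ m : ℕ, 0 < m → q ^ m ≠ 1)
    (n : ℕ) (hn : 1 ≤ n) :
    (∀ l : ℕ, Function.Bijective (Quantum.matToGL q n l)) ∧
    Nonempty (Quantum.glHomology q n 0 ≃ₗ[k] Quantum.slHomology q n 0) ∧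
    (∀ l : ℕ, Nonempty (Quantum.glHomology q n (l + 1) ≃ₗ[k]
      Quantum.slHomology q n (l + 1) × Quantum.slHomology q n l)) := by
  refine ⟨Quantum.matToGL_bijective q n Quantum.commute_qdet, ?_⟩
  -- The splitting rescales the first row by D, and n ≥ 1 provides that row.
  obtain ⟨n, rfl⟩ := Nat.exists_eq_add_of_le' hn
  have hX : ∀ (a : Fin (n + 1) → k) (ha : ∏ i, a i = 1),
      Quantum.QGL.char q a ha (Quantum.QGL.mk q (n + 1) Polynomial.X) = 1 := fun a ha =>
    (RingQuot.liftAlgHom_mkAlgHom_apply k _ _ _).trans (Polynomial.eval₂_X _ _)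
  exact Quantum.QGL.charHomology_equiv (α := Quantum.QGL.fInv q (n + 1))
    (β := Quantum.QGL.counit q (n + 1)) (α₀ := Quantum.QSL.fInv q (n + 1))
    (β₀ := Quantum.QSL.counit q (n + 1)) (hX _ _) (hX _ _)
    (fun i j => (Quantum.QSL.char_ofMat q _ _ _).trans (Quantum.QGL.char_ofMat q _ _ _).symm)
    (fun i j => (Quantum.QSL.char_ofMat q _ _ _).trans (Quantum.QGL.char_ofMat q _ _ _).symm)
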